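/- Let $\mathbb T=\mathbb R/2\pi\mathbb Z$, let $m\ge 1$ be an integer and let $V\in C^\infty(\mathbb T^2;\mathbb R)$, $V(t,x)=\sum_{k,\ell\in\mathbb Z}v_{k,\ell}\,e^{i(kx+\ell t)}$. Assume that the resonant average $\langle V\rangle_m(x):=\sum_{k\in\mathbb Z}v_{k,mk}\,e^{ikx}$ has no zero on $\mathbb T$. For $\varepsilon>0$ consider $$\partial_t u=(m+\varepsilon V(t,x))\,\partial_x u+\tfrac{\varepsilon}{2}\,\partial_xV(t,x)\,u,\qquad x\in\mathbb T,\ t\in\mathbb R. \tag{1}$$ For $s\in\mathbb R$ let $\mathcal H^s$ be the space of periodic distributions $u$ on $\mathbb T$ with Fourier coefficients $u_k$ such that $\|u\|_s^2:=\sum_{k\in\mathbb Z}(1+k^2)^{s}|u_k|^2<\infty$. For a smooth symbol $a(x,\xi)$, $2\pi$-periodic in $x$ (in the usual symbol classes), $\operatorname{Op^w}(a)$ is its Weyl quantization on $\mathbb T$, that is, $(\operatorname{Op^w}(a)u)_j=\sum_{k\in\mathbb Z}\hat a\big(j-k,\tfrac{j+k}{2}\big)u_k$ with $\hat a(n,\xi)=\frac1{2\pi}\int_0^{2\pi}a(x,\xi)e^{-inx}\,dx$.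 For a first-order operator $H(t)$, a solution of $\partial_tu=H(t)u$ in $\mathcal H^s$ is a function $u\in C(\mathbb R;\mathcal H^s)$ that is differentiable as an $\mathcal H^{s-1}$-valued function with derivative $H(t)u(t)$ for every $t\in\mathbb R$. Then for every integer $N\ge1$ there is $\varepsilon_N=\varepsilon_N(V)>0$ such that for every $0<\varepsilon<\varepsilon_N$ there exist linear bijections $\Phi_{N,\varepsilon}(t)$ of the space of periodic distributions on $\mathbb T$ ($t\in\mathbb R$), $2\pi$-periodic in $t$, a constant $\hat m_N=\hat m_{N,\varepsilon}\in\mathbb R\setminus\{0\}$ and a function $W_N=W_{N,\varepsilon}\in C^\infty(\mathbb T^2;\mathbb R)$ with the following properties. 1. For every $s\in\mathbb R$ there is $C_{N,s}>0$ such that for all $0<\varepsilon<\varepsilon_N$ and all $t\in\mathbb R$, $\Phi_{N,\varepsilon}(t)$ and $\Phi_{N,\varepsilon}(t)^{-1}$ map $\mathcal H^s$ to $\mathcal H^s$ with operator norms at most $C_{N,s}$. 2. For every $0<\varepsilon<\varepsilon_N$, every $s\in\mathbb R$ and all $u,v$ with $u(t)=\Phi_{N,\varepsilon}(t)v(t)$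 for all $t\in\mathbb R$: $u$ is a solution of (1) in $\mathcal H^s$ if and only if $v$ is a solution in $\mathcal H^s$ of $$\partial_t v=\operatorname{Op^w}\!\big(i\xi\,\varepsilon(\hat m_N+\varepsilon^{N}W_N(t,x))\big)v .$$ 3. The remainder is of size $O(\varepsilon^{N+1})$: for every $n\ge0$, all partial derivatives of $W_{N,\varepsilon}$ of order $n$ are bounded on $\mathbb T^2$ uniformly in $0<\varepsilon<\varepsilon_N$. -/

import Mathlib

open scoped ContDiff ENNReal Topology
open Filter

noncomputable section

namespace ResonantTransport

/-- The real function `f` of two variables `(t, x)` belongs to `C^∞(𝕋²; ℝ)`, `𝕋 = ℝ / 2πℤ`. -/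
def IsSmoothTorus (f : ℝ → ℝ → ℝ) : Prop :=
  ContDiff ℝ ∞ (fun p : ℝ × ℝ => f p.1 p.2) ∧
    (∀ t x, f (t + 2 * Real.pi) x = f t x) ∧ ∀ t x, f t (x + 2 * Real.pi) = f t x

/-- The `k`-th Fourier coefficient `(1/2π) ∫₀^{2π} f(x) e^{-ikx} dx` of a `2π`-periodic function. -/
def coeff (f : ℝ → ℂ) (k : ℤ) : ℂ := fourierCoeffOn Real.two_pi_pos f k

/-- The Fourier coefficient `v_{k,ℓ}` of `V(t, x) = ∑_{k,ℓ} v_{k,ℓ} e^{i(kx + ℓt)}`. -/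
def coeff₂ (V : ℝ → ℝ → ℝ) (k l : ℤ) : ℂ :=
  coeff (fun t => coeff (fun x => (V t x : ℂ)) k) l

/-- The resonant average `⟨V⟩_m(x) = ∑_k v_{k,mk} e^{ikx}`. -/
def resonantAverage (m : ℕ) (V : ℝ → ℝ → ℝ) (x : ℝ) : ℂ :=
  ∑' k : ℤ, coeff₂ V k (m * k) * Complex.exp (Complex.I * k * x)

/-- `V ∈ C^∞(𝕋²; ℝ)` is resonantly stable: its resonant average has no zero. -/
def ResonantlyStable (m : ℕ) (V : ℝ → ℝ → ℝ) : Prop :=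
  IsSmoothTorus V ∧ ∀ x : ℝ, resonantAverage m V x ≠ 0

/-- The Japanese bracket `⟨k⟩ = (1 + |k|²)^{1/2}`. -/
def bracket (k : ℤ) : ℝ := Real.sqrt (1 + (k : ℝ) ^ 2)

lemma one_le_bracket (k : ℤ) : 1 ≤ bracket k := by
  unfold bracket
  rw [Real.one_le_sqrt]
  nlinarith [sq_nonneg (k : ℝ)]

/-- The space `𝓓'(𝕋)` of complex periodic distributions, each identified with the family
`(u_k)` of its Fourier coefficients: these are exactly the families of polynomial growth. An
integrable function `f` on `𝕋` is the distribution `coeff f`. -/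
def PeriodicDistribution : Submodule ℂ (ℤ → ℂ) where
  carrier := {u | ∃ (C : ℝ) (n : ℕ), ∀ k, ‖u k‖ ≤ C * bracket k ^ n}
  zero_mem' := ⟨0, 0, fun k => by simp⟩
  add_mem' := by
    rintro u v ⟨C, n, hu⟩ ⟨D, p, hv⟩
    refine ⟨|C| + |D|, max n p, fun k => ?_⟩
    have hb := one_le_bracket k
    have h1 : bracket k ^ n ≤ bracket k ^ max n p := pow_le_pow_right₀ hb (le_max_left _ _)
    have h2 : bracket k ^ p ≤ bracket k ^ max n p := pow_le_pow_right₀ hb (le_max_right _ _)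
    have h3 : 0 ≤ bracket k ^ n := by positivity
    have h4 : 0 ≤ bracket k ^ p := by positivity
    calc ‖(u + v) k‖ ≤ ‖u k‖ + ‖v k‖ := norm_add_le _ _
      _ ≤ C * bracket k ^ n + D * bracket k ^ p := add_le_add (hu k) (hv k)
      _ ≤ |C| * bracket k ^ n + |D| * bracket k ^ p := by
          gcongr <;> exact le_abs_self _
      _ ≤ |C| * bracket k ^ max n p + |D| * bracket k ^ max n p := by gcongr
      _ = (|C| + |D|) * bracket k ^ max n p := by ring
  smul_mem' := by
    rintro c u ⟨C, n, hu⟩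
    refine ⟨‖c‖ * C, n, fun k => ?_⟩
    rw [Pi.smul_apply, norm_smul, mul_assoc]
    exact mul_le_mul_of_nonneg_left (hu k) (norm_nonneg c)

/-- The Sobolev norm `‖u‖_s = (∑_k ⟨k⟩^{2s} |u_k|²)^{1/2}`, with value `∞` off `𝓗^s`. -/
def sobolevNorm (s : ℝ) (u : ℤ → ℂ) : ℝ≥0∞ :=
  (∑' k : ℤ, ENNReal.ofReal (bracket k ^ (2 * s)) * ‖u k‖ₑ ^ 2) ^ (1 / 2 : ℝ)

/-- `u ∈ 𝓗^s(𝕋)`. -/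
def MemSobolev (s : ℝ) (u : ℤ → ℂ) : Prop := sobolevNorm s u < ⊤

/-- The `x`-derivative of a periodic distribution. -/
def dx (u : ℤ → ℂ) : ℤ → ℂ := fun k => Complex.I * k * u k

/-- The product `f u` of a smooth periodic function `f` and a periodic distribution `u`:
`(f u)_j = ∑_k f_{j-k} u_k`. -/
def smoothMul (f : ℝ → ℂ) (u : ℤ → ℂ) : ℤ → ℂ := fun j => ∑' k : ℤ, coeff f (j - k) * u k

/-- The Weyl quantization on `𝕋` of a symbol `a(x, ξ)`, acting on periodic distributions.
The oscillatory integral `(1/2π) ∫∫ e^{i(x-y)ξ} a((x+y)/2, ξ) e^{iky} dy dξ` equals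
`∑_j a_{j-k}((j+k)/2) e^{ijx}`, where `a_n(ξ)` is the `n`-th Fourier coefficient of `a(·, ξ)`;
hence `(Op^w(a) u)_j = ∑_k a_{j-k}((j+k)/2) u_k`. -/
def weylOp (a : ℝ → ℝ → ℂ) (u : ℤ → ℂ) : ℤ → ℂ :=
  fun j => ∑' k : ℤ, coeff (fun x => a x (((j : ℝ) + k) / 2)) (j - k) * u k

/-- `u` is a (global in time) solution of `∂_t u = H(t) u` in `𝓗^s`, where `H(t)` is of order
one: `u ∈ C(ℝ; 𝓗^s)`, and `u` is differentiable in `𝓗^{s-1}` with derivative `H(t) u(t)`. -/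
def IsSolution (s : ℝ) (H : ℝ → (ℤ → ℂ) → (ℤ → ℂ)) (u : ℝ → PeriodicDistribution) : Prop :=
  (∀ t, MemSobolev s (u t)) ∧
  (∀ t, Tendsto (fun r => sobolevNorm s ((u r : ℤ → ℂ) - u t)) (𝓝 t) (𝓝 0)) ∧
  ∀ t, Tendsto (fun r => sobolevNorm (s - 1)
      (((r - t : ℝ) : ℂ)⁻¹ • ((u r : ℤ → ℂ) - u t) - H t (u t))) (𝓝[≠] t) (𝓝 0)

/-- The right-hand side `(m + ε V(t,x)) ∂_x u + (ε/2) ∂_x V(t,x) u` of the transport equation. -/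
def transportOp (m : ℕ) (ε : ℝ) (V : ℝ → ℝ → ℝ) (t : ℝ) (u : ℤ → ℂ) : ℤ → ℂ :=
  smoothMul (fun x => ((m + ε * V t x : ℝ) : ℂ)) (dx u) +
    smoothMul (fun x => ((ε / 2 * deriv (V t) x : ℝ) : ℂ)) u

/-- The operator `Op^w(iξ ε (μ + ε^N W(t, x)))`. -/
def reducedOp (N : ℕ) (ε μ : ℝ) (W : ℝ → ℝ → ℝ) (t : ℝ) (u : ℤ → ℂ) : ℤ → ℂ :=
  weylOp (fun x ξ => Complex.I * ξ * ((ε * (μ + ε ^ N * W t x) : ℝ) : ℂ)) u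

end ResonantTransport

end

/-!
# Reduction of resonantly forced transport equations on the torus

The two equations are conjugated by half-density pull-backs along an explicit family of circle
diffeomorphisms, obtained by averaging; Sobolev bounds follow from Parseval, interpolation and duality.
-/

noncomputable section

namespace ResonantTransport

open MeasureTheory
open scoped NNReal

/-! ### Smooth families of functions and their Fourier coefficients -/

section Families

variable {E : Type*} [NormedAddCommGroup E] [NormedSpace ℝ E]
variable {F : Type*} [NormedAddCommGroup F] [NormedSpace ℝ F]

/-! For real `b`, the equation `u_t = b u_x + (b_x/2) u` transports half-densities. If `ψ(t, ·)`
lifts a circle diffeomorphism and `c(t, ψ) = b ψ_x - ψ_t`, then `v ↦ √ψ_x · (v ∘ ψ)` turns solutions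
with velocity `c` into solutions with velocity `b`. The Weyl operator of `iξ c` is exactly `c ∂_x +
c_x/2`, so no symbolic calculus is needed: it suffices to find diffeomorphisms for which `c = ε(μ +
ε^N W)`.

In the frame `z = x + mt` the speed `m` disappears and the velocity is `εU` with `U(t,z) = V(t, z -
mt)`. The time average `⟨U⟩` is the resonant average (`resonantAverage_eq`). `exists_normalForm`
builds `χ`, polynomial in `ε`, with `εUχ_z - χ_t = ε(μ + ε^N w)` exactly. Its leading term is a
multiple of the primitive of `1/⟨U⟩`. Each further term is a time primitive of the last remainder
plus a function of `z`, chosen so that the next remainder again has zero time average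
(`exists_corrector`). Every choice divides by `⟨U⟩`, which is where its nonvanishing enters. For
small `ε`, `ψ(t,x) = χ(ε,t)(x + mt)` is a family of diffeomorphisms.

The pull-back is unitary on `L²`, with adjoint the pull-back by the inverse map. Differentiation
bounds it on `𝓗^n`, the three lines theorem (`BddOp.interp`) on `𝓗^s` for `s ≥ 0`, and duality
(`pullbackMatrix_conj`) for `s < 0`. In time it is only strongly differentiable, from `𝓗^s` to
`𝓗^{s-1}`; `DiffeoPair.tendsto_quotient` gets this from uniform bounds on difference quotients and
convergence on exponentials. `DiffeoPair.isSolution` is then a product rule, and the converse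
implication uses the inverse diffeomorphisms.

Uniformity in `ε` is compactness: with `ε = δ sin θ`, all the diffeomorphisms form one smooth family
over the vector space of pairs `(θ, t)`. -/

/-- A family of functions on the line depending smoothly on a parameter. -/
def SmoothFamily (f : E → ℝ → F) : Prop := ContDiff ℝ ∞ (fun p : E × ℝ => f p.1 p.2)

theorem SmoothFamily.contDiff {f : E → ℝ → F} (hf : SmoothFamily f) (p : E) :
    ContDiff ℝ ∞ (f p) :=
  ContDiff.comp (g := fun q : E × ℝ => f q.1 q.2) hf (contDiff_prodMk_right p)

theorem SmoothFamily.hasDerivAt {f : E → ℝ → F} (hf : SmoothFamily f) (p : E) (x : ℝ) :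
    HasDerivAt (f p) (deriv (f p) x) x :=
  ((hf.contDiff p).differentiable (by simp) x).hasDerivAt

theorem SmoothFamily.deriv_eq {f : E → ℝ → F} (hf : SmoothFamily f) (p : E) (x : ℝ) :
    deriv (f p) x = fderiv ℝ (fun q : E × ℝ => f q.1 q.2) (p, x) (0, 1) := by
  have h1 : HasFDerivAt (fun q : E × ℝ => f q.1 q.2) _ (p, x) :=
    (ContDiff.differentiable hf (by simp) (p, x)).hasFDerivAt
  have h2 : HasDerivAt (fun y : ℝ => (p, y)) ((0 : E), (1 : ℝ)) x :=
    (hasDerivAt_const x p).prodMk (hasDerivAt_id x)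
  exact (h1.comp_hasDerivAt x h2).deriv

theorem SmoothFamily.deriv {f : E → ℝ → F} (hf : SmoothFamily f) :
    SmoothFamily (fun p x => deriv (f p) x) := by
  unfold SmoothFamily
  simp_rw [hf.deriv_eq]
  exact (ContDiff.fderiv_right hf (m := ∞) (by simp)).clm_apply contDiff_const

theorem SmoothFamily.hasDerivAt_fst {f : ℝ → ℝ → F} (hf : SmoothFamily f) (t x : ℝ) :
    HasDerivAt (fun r => f r x) (_root_.deriv (fun r => f r x) t) t :=
  (((ContDiff.comp (g := fun q : ℝ × ℝ => f q.1 q.2) hf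
    (contDiff_prodMk_left x))).differentiable (by simp) t).hasDerivAt

theorem SmoothFamily.deriv_fst_eq {f : ℝ → ℝ → F} (hf : SmoothFamily f) (t x : ℝ) :
    _root_.deriv (fun r => f r x) t = fderiv ℝ (fun q : ℝ × ℝ => f q.1 q.2) (t, x) (1, 0) := by
  have h1 : HasFDerivAt (fun q : ℝ × ℝ => f q.1 q.2) _ (t, x) :=
    (ContDiff.differentiable hf (by simp) (t, x)).hasFDerivAt
  have h2 : HasDerivAt (fun r : ℝ => (r, x)) ((1 : ℝ), (0 : ℝ)) t :=
    (hasDerivAt_id t).prodMk (hasDerivAt_const t x)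
  exact (h1.comp_hasDerivAt t h2).deriv

theorem SmoothFamily.deriv_fst {f : ℝ → ℝ → F} (hf : SmoothFamily f) :
    SmoothFamily (fun t x => _root_.deriv (fun r => f r x) t) := by
  unfold SmoothFamily
  simp_rw [hf.deriv_fst_eq]
  exact (ContDiff.fderiv_right hf (m := ∞) (by simp)).clm_apply contDiff_const

/-- Needed because the time derivative of `√ψ_x` contains `∂_t ∂_x ψ`, while differentiating the
velocity relation in `x` produces `∂_x ∂_t ψ`. -/
theorem SmoothFamily.deriv_comm {f : ℝ → ℝ → ℝ} (hf : SmoothFamily f) (t x : ℝ) :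
    _root_.deriv (fun r => _root_.deriv (f r) x) t =
      _root_.deriv (fun y => _root_.deriv (fun r => f r y) t) x := by
  have h1 := hf.deriv.deriv_fst_eq t x
  have h2 := hf.deriv_fst.deriv_eq t x
  have hd : DifferentiableAt ℝ (fderiv ℝ (fun q : ℝ × ℝ => f q.1 q.2)) (t, x) :=
    (ContDiff.fderiv_right hf (m := ∞) (by simp)).differentiable (by simp) _
  have hs : IsSymmSndFDerivAt ℝ (fun q : ℝ × ℝ => f q.1 q.2) (t, x) :=
    (ContDiff.contDiffAt hf).isSymmSndFDerivAt (by
      simp only [minSmoothness_of_isRCLikeNormedField]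
      exact WithTop.coe_le_coe.mpr le_top)
  rw [h1, h2]
  simp_rw [hf.deriv_eq, hf.deriv_fst_eq]
  rw [fderiv_clm_apply hd (by fun_prop), fderiv_clm_apply hd (by fun_prop)]
  simp only [fderiv_fun_const, Pi.zero_apply, ContinuousLinearMap.comp_zero, zero_add,
    ContinuousLinearMap.flip_apply]
  exact hs _ _

theorem SmoothFamily.of_contDiff {f : ℝ → F} (hf : ContDiff ℝ ∞ f) :
    SmoothFamily (fun _ : E => f) :=
  hf.comp contDiff_snd

theorem SmoothFamily.exists_bound {f : E → ℝ → F} (hf : SmoothFamily f) {K : Set E}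
    (hK : IsCompact K) : ∃ C : ℝ, 0 ≤ C ∧ ∀ p ∈ K, ∀ x ∈ Set.Icc 0 (2 * Real.pi), ‖f p x‖ ≤ C := by
  obtain ⟨C, hC⟩ := (hK.prod (isCompact_Icc (a := (0 : ℝ)) (b := 2 * Real.pi))).exists_bound_of_continuousOn
    (ContDiff.continuous hf).continuousOn
  exact ⟨max C 0, le_max_right _ _, fun p hp x hx => (hC (p, x) ⟨hp, hx⟩).trans (le_max_left _ _)⟩

end Families

/-! ### Exponentials, Fourier coefficients and their decay -/

/-- The function `x ↦ e^{ikx}`. -/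
def expMode (k : ℤ) (x : ℝ) : ℂ := Complex.exp (Complex.I * k * x)

theorem contDiff_expMode (k : ℤ) : ContDiff ℝ ∞ (expMode k) := by
  unfold expMode
  exact (contDiff_const.mul Complex.ofRealCLM.contDiff).cexp

theorem norm_expMode (k : ℤ) (x : ℝ) : ‖expMode k x‖ = 1 := by
  unfold expMode
  rw [show Complex.I * k * x = ((k * x : ℝ) : ℂ) * Complex.I by push_cast; ring]
  exact Complex.norm_exp_ofReal_mul_I _

theorem hasDerivAt_expMode (k : ℤ) (x : ℝ) :
    HasDerivAt (expMode k) (Complex.I * k * expMode k x) x := by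
  have h : HasDerivAt (fun y : ℝ => Complex.I * k * (y : ℂ)) (Complex.I * k) x := by
    simpa using (Complex.ofRealCLM.hasDerivAt (x := x)).const_mul (Complex.I * k)
  convert! h.cexp using 1
  unfold expMode; ring

theorem expMode_add (k : ℤ) (x y : ℝ) : expMode k (x + y) = expMode k x * expMode k y := by
  unfold expMode; rw [← Complex.exp_add]; push_cast; ring_nf

theorem expMode_int_mul_two_pi (k n : ℤ) : expMode k (n * (2 * Real.pi)) = 1 := by
  unfold expMode
  rw [Complex.exp_eq_one_iff]
  exact ⟨k * n, by push_cast; ring⟩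

theorem expMode_periodic (k : ℤ) : Function.Periodic (expMode k) (2 * Real.pi) := fun x => by
  have := expMode_int_mul_two_pi k 1
  rw [expMode_add]; simp_all

theorem expMode_add_index (k l : ℤ) (x : ℝ) : expMode (k + l) x = expMode k x * expMode l x := by
  unfold expMode; rw [← Complex.exp_add]; push_cast; ring_nf

theorem coeff_eq (f : ℝ → ℂ) (k : ℤ) :
    coeff f k = (2 * Real.pi : ℂ)⁻¹ * ∫ x in (0 : ℝ)..2 * Real.pi, expMode (-k) x * f x := by
  unfold coeff
  rw [fourierCoeffOn_eq_integral, sub_zero, one_div, Complex.real_smul]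
  push_cast
  congr 1
  apply intervalIntegral.integral_congr
  intro x _
  simp only [fourier_coe_apply, smul_eq_mul]
  congr 1
  unfold expMode
  congr 1
  have : (Real.pi : ℂ) ≠ 0 := by exact_mod_cast Real.pi_ne_zero
  push_cast
  field_simp

theorem coeff_const_mul (c : ℂ) (f : ℝ → ℂ) (k : ℤ) :
    coeff (fun x => c * f x) k = c * coeff f k := fourierCoeffOn.const_mul f c k _

theorem coeff_add {f g : ℝ → ℂ} (hf : Continuous f) (hg : Continuous g) (k : ℤ) :
    coeff (fun x => f x + g x) k = coeff f k + coeff g k := by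
  have he : Continuous (expMode (-k)) := (contDiff_expMode _).continuous
  simp_rw [coeff_eq, mul_add]
  rw [intervalIntegral.integral_add, mul_add]
  · exact (he.mul hf).intervalIntegrable _ _
  · exact (he.mul hg).intervalIntegrable _ _

theorem coeff_expMode (k : ℤ) : coeff (expMode k) = Pi.single k 1 := by
  funext j
  rw [coeff_eq]
  simp_rw [← expMode_add_index]
  by_cases h : j = k
  · subst h
    have h0 : ∀ x : ℝ, expMode (-j + j) x = 1 := fun x => by simp [expMode]
    have : (Real.pi : ℂ) ≠ 0 := by exact_mod_cast Real.pi_ne_zero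
    simp only [h0, intervalIntegral.integral_const, Pi.single_eq_same, Complex.real_smul]
    push_cast
    field_simp
    ring
  · have hn : (Complex.I * ((-j + k : ℤ) : ℂ)) ≠ 0 := by
      refine mul_ne_zero Complex.I_ne_zero ?_
      norm_cast
      omega
    have hint : ∫ x in (0 : ℝ)..2 * Real.pi, (Complex.I * ((-j + k : ℤ) : ℂ)) * expMode (-j + k) x = 0 := by
      rw [intervalIntegral.integral_eq_sub_of_hasDerivAt (fun x _ => hasDerivAt_expMode (-j + k) x)
        ((continuous_const.mul (contDiff_expMode _).continuous).intervalIntegrable _ _)]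
      have := expMode_periodic (-j + k) 0
      rw [zero_add] at this
      rw [this, sub_self]
    rw [intervalIntegral.integral_const_mul] at hint
    rw [(mul_eq_zero.mp hint).resolve_left hn, mul_zero, Pi.single_eq_of_ne h]

theorem norm_coeff_le {f : ℝ → ℂ} {C : ℝ} (hC : ∀ x ∈ Set.Icc 0 (2 * Real.pi), ‖f x‖ ≤ C) (k : ℤ) :
    ‖coeff f k‖ ≤ C := by
  have hpi := Real.two_pi_pos
  rw [coeff_eq, norm_mul]
  have h := intervalIntegral.norm_integral_le_of_norm_le_const (a := 0) (b := 2 * Real.pi)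
    (f := fun x => expMode (-k) x * f x) (C := C) (fun x hx => by
      rw [norm_mul, norm_expMode, one_mul]
      rw [Set.uIoc_of_le hpi.le] at hx
      exact hC x ⟨hx.1.le, hx.2⟩)
  rw [sub_zero, abs_of_pos hpi] at h
  have h2 : ‖((2 * Real.pi : ℂ))⁻¹‖ = (2 * Real.pi)⁻¹ := by
    rw [norm_inv]; norm_num [abs_of_pos Real.pi_pos]
  rw [h2]
  calc (2 * Real.pi)⁻¹ * _ ≤ (2 * Real.pi)⁻¹ * (C * (2 * Real.pi)) := by gcongr
    _ = C := by field_simp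

theorem coeff_deriv {f : ℝ → ℂ} (hf : ContDiff ℝ ∞ f) (hp : Function.Periodic f (2 * Real.pi))
    (k : ℤ) : coeff (deriv f) k = Complex.I * k * coeff f k := by
  have hd : ∀ x, HasDerivAt f (deriv f x) x := fun x => (hf.differentiable (by simp) x).hasDerivAt
  have hc : Continuous (deriv f) := hf.continuous_deriv (by simp)
  have he : Continuous (expMode (-k)) := (contDiff_expMode _).continuous
  have h := intervalIntegral.integral_mul_deriv_eq_deriv_mul (a := 0) (b := 2 * Real.pi)
    (fun x _ => hasDerivAt_expMode (-k) x) (fun x _ => hd x)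
    ((continuous_const.mul he).intervalIntegrable _ _) (hc.intervalIntegrable _ _)
  have e1 := expMode_periodic (-k) 0
  have e2 := hp 0
  rw [zero_add] at e1 e2
  rw [coeff_eq, coeff_eq, h, e1, e2, sub_self, zero_sub, ← intervalIntegral.integral_neg]
  rw [mul_left_comm, ← intervalIntegral.integral_const_mul (Complex.I * k)]
  congr 2
  funext x
  push_cast
  ring

theorem abs_le_bracket (k : ℤ) : |(k : ℝ)| ≤ bracket k := by
  unfold bracket
  exact Real.abs_le_sqrt (by linarith)

theorem bracket_pos (k : ℤ) : 0 < bracket k := one_pos.trans_le (one_le_bracket k)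

theorem bracket_le (k : ℤ) : bracket k ≤ 1 + |(k : ℝ)| := by
  unfold bracket
  rw [Real.sqrt_le_left (by positivity)]
  nlinarith [sq_abs (k : ℝ), abs_nonneg (k : ℝ)]

theorem SmoothFamily.deriv_periodic {E F : Type*} [NormedAddCommGroup F] [NormedSpace ℝ F]
    {f : E → ℝ → F} (hp : ∀ p, Function.Periodic (f p) (2 * Real.pi)) (p : E) :
    Function.Periodic (_root_.deriv (f p)) (2 * Real.pi) := fun x => by
  have : f p = fun y => f p (y + 2 * Real.pi) := (funext (hp p)).symm
  conv_rhs => rw [this]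
  rw [deriv_comp_add_const]

/-- Fourier coefficients of a smooth family decay rapidly, locally uniformly in the parameter. -/
theorem SmoothFamily.exists_coeff_bound {E : Type*} [NormedAddCommGroup E] [NormedSpace ℝ E]
    {K : Set E} (hK : IsCompact K) (M : ℕ) :
    ∀ {f : E → ℝ → ℂ}, SmoothFamily f → (∀ p, Function.Periodic (f p) (2 * Real.pi)) →
    ∃ C : ℝ, 0 ≤ C ∧ ∀ p ∈ K, ∀ k, ‖coeff (f p) k‖ * bracket k ^ M ≤ C := by
  induction M with
  | zero =>
    intro f hf _
    obtain ⟨C, hC0, hC⟩ := hf.exists_bound hK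
    exact ⟨C, hC0, fun p hp k => by simpa using norm_coeff_le (hC p hp) k⟩
  | succ M ih =>
    intro f hf hper
    obtain ⟨C, hC0, hC⟩ := ih hf hper
    obtain ⟨D, hD0, hD⟩ := ih hf.deriv (SmoothFamily.deriv_periodic hper)
    refine ⟨C + D, by positivity, fun p hp k => ?_⟩
    have h1 := hC p hp k
    have h2 := hD p hp k
    rw [coeff_deriv (hf.contDiff p) (hper p)] at h2
    simp only [norm_mul, Complex.norm_I, one_mul, Complex.norm_intCast] at h2
    have hb : 0 ≤ ‖coeff (f p) k‖ * bracket k ^ M := by have := bracket_pos k; positivity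
    calc ‖coeff (f p) k‖ * bracket k ^ (M + 1) = ‖coeff (f p) k‖ * bracket k ^ M * bracket k := by ring
      _ ≤ ‖coeff (f p) k‖ * bracket k ^ M * (1 + |(k : ℝ)|) := by gcongr; exact bracket_le k
      _ = ‖coeff (f p) k‖ * bracket k ^ M + |(k : ℝ)| * ‖coeff (f p) k‖ * bracket k ^ M := by ring
      _ ≤ C + D := add_le_add h1 h2

theorem exists_coeff_bound {f : ℝ → ℂ} (hf : ContDiff ℝ ∞ f)
    (hp : Function.Periodic f (2 * Real.pi)) (M : ℕ) :
    ∃ C : ℝ, 0 ≤ C ∧ ∀ k, ‖coeff f k‖ * bracket k ^ M ≤ C := by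
  obtain ⟨C, hC0, hC⟩ := SmoothFamily.exists_coeff_bound (K := {(0 : ℝ)}) isCompact_singleton M
    (SmoothFamily.of_contDiff hf) (fun _ => hp)
  exact ⟨C, hC0, hC 0 rfl⟩

theorem summable_bracket_inv_sq : Summable (fun k : ℤ => (bracket k ^ 2)⁻¹) := by
  have h : Summable (fun k : ℤ => 1 / (k : ℝ) ^ 2) := Real.summable_one_div_int_pow.mpr one_lt_two
  refine Summable.of_norm_bounded_eventually h ?_
  have : ∀ᶠ k : ℤ in cofinite, k ≠ 0 := eventually_cofinite_ne 0
  filter_upwards [this] with k hk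
  have hk' : 0 < (k : ℝ) ^ 2 := by positivity
  have := bracket_pos k
  rw [Real.norm_of_nonneg (by positivity), one_div]
  rw [← sq_abs (k : ℝ)] at hk' ⊢
  gcongr
  exact abs_le_bracket k

theorem summable_of_bound {u : ℤ → ℂ} {C : ℝ} (h : ∀ k, ‖u k‖ * bracket k ^ 2 ≤ C) :
    Summable u := by
  refine Summable.of_norm_bounded (g := fun k => C * (bracket k ^ 2)⁻¹) (summable_bracket_inv_sq.mul_left C) fun k => ?_
  have := bracket_pos k
  rw [← div_eq_mul_inv, le_div_iff₀ (by positivity)]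
  exact h k

theorem summable_coeff {f : ℝ → ℂ} (hf : ContDiff ℝ ∞ f)
    (hp : Function.Periodic f (2 * Real.pi)) : Summable (coeff f) := by
  obtain ⟨C, -, hC⟩ := exists_coeff_bound hf hp 2
  exact summable_of_bound hC

/-- Fourier inversion for smooth periodic functions. -/
theorem hasSum_coeff {f : ℝ → ℂ} (hf : ContDiff ℝ ∞ f)
    (hp : Function.Periodic f (2 * Real.pi)) (x : ℝ) :
    HasSum (fun k => coeff f k * expMode k x) (f x) := by
  have : Fact (0 < 2 * Real.pi) := ⟨Real.two_pi_pos⟩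
  let g : C(AddCircle (2 * Real.pi), ℂ) := ⟨hp.lift, continuous_quot_lift _ hf.continuous⟩
  have hc : ∀ k, fourierCoeff g k = coeff f k := fun k => by
    rw [fourierCoeff_eq_intervalIntegral g k 0, coeff_eq, zero_add, one_div, Complex.real_smul]
    push_cast
    congr 1
    apply intervalIntegral.integral_congr
    intro x _
    simp only [fourier_coe_apply, smul_eq_mul]
    congr 1
    unfold expMode
    congr 1
    have : (Real.pi : ℂ) ≠ 0 := by exact_mod_cast Real.pi_ne_zero
    push_cast
    field_simp
  have hs : Summable (fourierCoeff g) := by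
    rw [show fourierCoeff g = coeff f from funext hc]; exact summable_coeff hf hp
  have := has_pointwise_sum_fourier_series_of_summable hs (x : AddCircle (2 * Real.pi))
  convert! this using 1
  funext k
  rw [hc, smul_eq_mul, fourier_coe_apply]
  unfold expMode
  congr 2
  have : (Real.pi : ℂ) ≠ 0 := by exact_mod_cast Real.pi_ne_zero
  push_cast
  field_simp

/-- Expanding `f` in Fourier series inside a Fourier coefficient of `w · (f ∘ ψ)`. -/
theorem hasSum_coeff_mul_comp {f w : ℝ → ℂ} {ψ : ℝ → ℝ} (hf : ContDiff ℝ ∞ f)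
    (hp : Function.Periodic f (2 * Real.pi)) (hw : Continuous w) (hψ : Continuous ψ) (j : ℤ) :
    HasSum (fun k => coeff (fun x => w x * expMode k (ψ x)) j * coeff f k)
      (coeff (fun x => w x * f (ψ x)) j) := by
  obtain ⟨B, hB⟩ := (isCompact_Icc (a := (0 : ℝ)) (b := 2 * Real.pi)).exists_bound_of_continuousOn
    hw.continuousOn
  have hs := (summable_coeff hf hp).norm
  have he : ∀ k, Continuous (expMode k) := fun k => (contDiff_expMode k).continuous
  -- Since `|e^{ikψ}| = 1`, the `k`-th term is dominated by `B |f_k|`, and the coefficients of `f`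
  -- are absolutely summable.
  have key := intervalIntegral.hasSum_integral_of_dominated_convergence (a := 0)
    (b := 2 * Real.pi) (μ := volume)
    (F := fun k x => expMode (-j) x * (w x * (coeff f k * expMode k (ψ x))))
    (f := fun x => expMode (-j) x * (w x * f (ψ x)))
    (fun k _ => B * ‖coeff f k‖)
    (fun k => ((he _).mul (hw.mul (continuous_const.mul ((he _).comp hψ)))).aestronglyMeasurable)
    (fun k => Eventually.of_forall fun x hx => by
      simp only [norm_mul, norm_expMode, one_mul, mul_one]
      rw [Set.uIoc_of_le Real.two_pi_pos.le] at hx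
      gcongr
      exact hB x ⟨hx.1.le, hx.2⟩)
    (Eventually.of_forall fun x _ => hs.mul_left B)
    (by simp)
    (Eventually.of_forall fun x _ => by
      exact ((hasSum_coeff hf hp (ψ x)).mul_left _).mul_left _)
  have := key.mul_left ((2 * Real.pi : ℂ)⁻¹)
  rw [coeff_eq]
  convert! this using 1
  funext k
  rw [coeff_eq, mul_comm, mul_left_comm, ← intervalIntegral.integral_const_mul]
  congr 2
  funext x
  ring

/-- The case `ψ = id` of the preceding expansion: multiplication by `e^{ikx}` shifts indices by `k`,
so the matrix depends only on `j - k`. -/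
theorem hasSum_coeff_mul {a f : ℝ → ℂ} (ha : Continuous a) (hf : ContDiff ℝ ∞ f)
    (hp : Function.Periodic f (2 * Real.pi)) (j : ℤ) :
    HasSum (fun k => coeff a (j - k) * coeff f k) (coeff (fun x => a x * f x) j) := by
  convert! hasSum_coeff_mul_comp hf hp ha continuous_id j using 2 with k
  congr 1
  rw [coeff_eq, coeff_eq]
  congr 2
  funext x
  rw [neg_sub, sub_eq_add_neg, add_comm, expMode_add_index]
  simp only [id]
  ring

theorem tsum_sq_norm_coeff {f : ℝ → ℂ} (hf : Continuous f) :
    HasSum (fun k => ‖coeff f k‖ ^ 2) ((2 * Real.pi)⁻¹ * ∫ x in (0 : ℝ)..2 * Real.pi, ‖f x‖ ^ 2) := by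
  have h := hasSum_sq_fourierCoeffOn (f := f) Real.two_pi_pos
    ((memLp_two_iff_integrable_sq_norm hf.aestronglyMeasurable).mpr
      ((by fun_prop : Continuous fun x => ‖f x‖ ^ 2).integrableOn_Ioc))
  simpa [coeff] using h

/-! ### Sobolev norms of sequences -/

theorem enorm_ofReal_of_nonneg {r : ℝ} (hr : 0 ≤ r) : ‖(r : ℂ)‖ₑ = ENNReal.ofReal r := by
  rw [← ofReal_norm, Complex.norm_real, Real.norm_of_nonneg hr]

/-- Reading the norm as an `L²` norm for counting measure makes Minkowski's inequality available in
`[0, ∞]`, without summability conditions. -/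
theorem sobolevNorm_eq_eLpNorm (s : ℝ) (u : ℤ → ℂ) :
    sobolevNorm s u = eLpNorm (fun k => ((bracket k ^ s : ℝ) : ℂ) * u k) 2 Measure.count := by
  rw [eLpNorm_eq_lintegral_rpow_enorm_toReal (by simp) (by simp), lintegral_count]
  unfold sobolevNorm
  simp only [ENNReal.toReal_ofNat]
  congr 1
  apply tsum_congr
  intro k
  have hb : 0 ≤ bracket k ^ s := Real.rpow_nonneg (bracket_pos k).le s
  rw [enorm_mul, ENNReal.mul_rpow_of_nonneg _ _ (by norm_num), ENNReal.rpow_ofNat, ENNReal.rpow_ofNat,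
    enorm_ofReal_of_nonneg hb, ← ENNReal.ofReal_pow hb, mul_comm 2 s,
    Real.rpow_mul (bracket_pos k).le, Real.rpow_ofNat]

theorem sobolevNorm_add_le (s : ℝ) (u v : ℤ → ℂ) :
    sobolevNorm s (u + v) ≤ sobolevNorm s u + sobolevNorm s v := by
  simp_rw [sobolevNorm_eq_eLpNorm]
  refine le_trans (le_of_eq ?_) (eLpNorm_add_le (μ := Measure.count) (p := 2)
    (measurable_of_countable _).aestronglyMeasurable
    (measurable_of_countable _).aestronglyMeasurable (by norm_num))
  congr 1
  funext k
  simp [mul_add]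

theorem sobolevNorm_smul (s : ℝ) (c : ℂ) (u : ℤ → ℂ) :
    sobolevNorm s (c • u) = ‖c‖ₑ * sobolevNorm s u := by
  simp_rw [sobolevNorm_eq_eLpNorm, ← eLpNorm_const_smul]
  congr 1
  funext k
  simp only [Pi.smul_apply, smul_eq_mul]
  ring

theorem sobolevNorm_neg (s : ℝ) (u : ℤ → ℂ) : sobolevNorm s (-u) = sobolevNorm s u := by
  unfold sobolevNorm; simp

theorem sobolevNorm_sub_le (s : ℝ) (u v : ℤ → ℂ) :
    sobolevNorm s (u - v) ≤ sobolevNorm s u + sobolevNorm s v := by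
  rw [sub_eq_add_neg, ← sobolevNorm_neg s v]; exact sobolevNorm_add_le s u (-v)

@[simp] theorem sobolevNorm_zero (s : ℝ) : sobolevNorm s 0 = 0 := by
  unfold sobolevNorm; simp

theorem sobolevNorm_sq (s : ℝ) (u : ℤ → ℂ) : sobolevNorm s u ^ 2 =
    ∑' k : ℤ, ENNReal.ofReal (bracket k ^ (2 * s)) * ‖u k‖ₑ ^ 2 := by
  unfold sobolevNorm
  rw [← ENNReal.rpow_ofNat, ← ENNReal.rpow_mul]
  norm_num

theorem sobolevNorm_le_iff {s : ℝ} {u : ℤ → ℂ} {C : ℝ≥0∞} : sobolevNorm s u ≤ C ↔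
    ∀ J : Finset ℤ, ∑ k ∈ J, ENNReal.ofReal (bracket k ^ (2 * s)) * ‖u k‖ₑ ^ 2 ≤ C ^ 2 := by
  rw [← ENNReal.pow_le_pow_left_iff two_ne_zero, sobolevNorm_sq, ENNReal.tsum_eq_iSup_sum, iSup_le_iff]

theorem sobolevNorm_mono_fun {s : ℝ} {u v : ℤ → ℂ} (h : ∀ k, ‖u k‖ ≤ ‖v k‖) :
    sobolevNorm s u ≤ sobolevNorm s v := by
  unfold sobolevNorm
  gcongr with k
  exact enorm_le_iff_norm_le.mpr (h k)

theorem sobolevNorm_mono {s s' : ℝ} (h : s ≤ s') (u : ℤ → ℂ) :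
    sobolevNorm s u ≤ sobolevNorm s' u := by
  unfold sobolevNorm
  gcongr with k
  exact one_le_bracket k

theorem enorm_apply_le (s : ℝ) (u : ℤ → ℂ) (k : ℤ) :
    ENNReal.ofReal (bracket k ^ s) * ‖u k‖ₑ ≤ sobolevNorm s u := by
  rw [← ENNReal.pow_le_pow_left_iff two_ne_zero, sobolevNorm_sq, mul_pow,
    ← ENNReal.ofReal_pow (Real.rpow_nonneg (bracket_pos k).le s), ← Real.rpow_ofNat,
    ← Real.rpow_mul (bracket_pos k).le, mul_comm s]
  exact ENNReal.le_tsum (f := fun k => ENNReal.ofReal (bracket k ^ (2 * s)) * ‖u k‖ₑ ^ 2) k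

theorem eq_zero_of_sobolevNorm_eq_zero {s : ℝ} {u : ℤ → ℂ} (h : sobolevNorm s u = 0) : u = 0 := by
  funext k
  have := enorm_apply_le s u k
  rw [h, nonpos_iff_eq_zero, mul_eq_zero] at this
  rcases this with h1 | h1
  · have := Real.rpow_pos_of_pos (bracket_pos k) s
    rw [ENNReal.ofReal_eq_zero] at h1
    linarith
  · simpa using h1

/-- Fatou's lemma for sequences: the norm is a supremum of finite partial sums, each continuous
under coordinatewise convergence. -/
theorem sobolevNorm_le_of_tendsto {ι : Type*} {l : Filter ι} [l.NeBot] {s : ℝ} {u : ι → ℤ → ℂ}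
    {v : ℤ → ℂ} {C : ℝ≥0∞} (hu : ∀ k, Tendsto (fun i => u i k) l (𝓝 (v k)))
    (hC : ∀ᶠ i in l, sobolevNorm s (u i) ≤ C) : sobolevNorm s v ≤ C := by
  rw [sobolevNorm_le_iff]
  intro J
  refine le_of_tendsto (f := fun i => ∑ k ∈ J, ENNReal.ofReal (bracket k ^ (2 * s)) * ‖u i k‖ₑ ^ 2)
    (x := l) ?_ ?_
  · refine tendsto_finsetSum _ fun k _ => ENNReal.Tendsto.const_mul ?_ (Or.inr ENNReal.ofReal_ne_top)
    exact ((ENNReal.continuous_pow 2).tendsto _).comp ((continuous_enorm.tendsto _).comp (hu k))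
  · filter_upwards [hC] with i hi
    exact sobolevNorm_le_iff.mp hi J

theorem MemSobolev.add {s : ℝ} {u v : ℤ → ℂ} (hu : MemSobolev s u) (hv : MemSobolev s v) :
    MemSobolev s (u + v) := (sobolevNorm_add_le s u v).trans_lt (ENNReal.add_lt_top.mpr ⟨hu, hv⟩)

theorem MemSobolev.sub {s : ℝ} {u v : ℤ → ℂ} (hu : MemSobolev s u) (hv : MemSobolev s v) :
    MemSobolev s (u - v) := (sobolevNorm_sub_le s u v).trans_lt (ENNReal.add_lt_top.mpr ⟨hu, hv⟩)

theorem MemSobolev.smul {s : ℝ} {u : ℤ → ℂ} (c : ℂ) (hu : MemSobolev s u) :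
    MemSobolev s (c • u) := by
  unfold MemSobolev
  rw [sobolevNorm_smul]
  exact ENNReal.mul_lt_top enorm_lt_top hu

theorem MemSobolev.mono {s s' : ℝ} (h : s ≤ s') {u : ℤ → ℂ} (hu : MemSobolev s' u) :
    MemSobolev s u := (sobolevNorm_mono h u).trans_lt hu

theorem memSobolev_of_finite {s : ℝ} {u : ℤ → ℂ} (J : Finset ℤ) (h : ∀ k ∉ J, u k = 0) :
    MemSobolev s u := by
  unfold MemSobolev
  refine (ENNReal.pow_lt_top_iff (n := 2)).mp ?_ |>.resolve_right two_ne_zero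
  rw [sobolevNorm_sq, tsum_eq_sum (s := J) (fun k hk => by simp [h k hk])]
  exact ENNReal.sum_lt_top.mpr fun k _ => ENNReal.mul_lt_top ENNReal.ofReal_lt_top
    (ENNReal.pow_lt_top enorm_lt_top)

theorem memSobolev_single (s : ℝ) (k : ℤ) : MemSobolev s (Pi.single k 1) :=
  memSobolev_of_finite {k} fun j hj => Pi.single_eq_of_ne (by simpa using hj) _

/-- The restriction of a sequence to a finite set of indices. -/
def trunc (J : Finset ℤ) (u : ℤ → ℂ) : ℤ → ℂ := fun k => if k ∈ J then u k else 0

theorem trunc_eq_sum (J : Finset ℤ) (u : ℤ → ℂ) :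
    trunc J u = ∑ k ∈ J, u k • (Pi.single k 1 : ℤ → ℂ) := by
  funext j
  simp [trunc, Finset.sum_apply, Pi.single_apply]

theorem sobolevNorm_trunc_le (s : ℝ) (J : Finset ℤ) (u : ℤ → ℂ) :
    sobolevNorm s (trunc J u) ≤ sobolevNorm s u :=
  sobolevNorm_mono_fun fun k => by unfold trunc; split_ifs <;> simp

theorem memSobolev_trunc (s : ℝ) (J : Finset ℤ) (u : ℤ → ℂ) : MemSobolev s (trunc J u) :=
  memSobolev_of_finite J fun k hk => by simp [trunc, hk]

theorem tendsto_sub_trunc {s : ℝ} {u : ℤ → ℂ} (hu : MemSobolev s u) :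
    Tendsto (fun J => sobolevNorm s (u - trunc J u)) atTop (𝓝 0) := by
  have hne : ∑' k : ℤ, ENNReal.ofReal (bracket k ^ (2 * s)) * ‖u k‖ₑ ^ 2 ≠ ⊤ := by
    rw [← sobolevNorm_sq]; exact ENNReal.pow_ne_top hu.ne
  have h := ENNReal.tendsto_tsum_compl_atTop_zero hne
  have h2 := ((ENNReal.continuous_rpow_const (y := (1 / 2 : ℝ))).tendsto 0).comp h
  rw [ENNReal.zero_rpow_of_pos (by norm_num)] at h2
  refine h2.congr fun J => ?_
  simp only [Function.comp, sobolevNorm]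
  congr 1
  have : ∀ k : ℤ, ENNReal.ofReal (bracket k ^ (2 * s)) * ‖(u - trunc J u) k‖ₑ ^ 2 =
      Set.indicator {k | k ∉ J} (fun k => ENNReal.ofReal (bracket k ^ (2 * s)) * ‖u k‖ₑ ^ 2) k := by
    intro k
    by_cases hk : k ∈ J <;> simp [trunc, hk]
  rw [tsum_congr this]
  exact tsum_subtype {k : ℤ | k ∉ J}
    (fun k => ENNReal.ofReal (bracket k ^ (2 * s)) * ‖u k‖ₑ ^ 2)

/-- The value of the series `∑ ⟨k⟩⁻²`. -/
def bracketConst : ℝ≥0∞ := (∑' k : ℤ, ENNReal.ofReal ((bracket k ^ 2)⁻¹)) ^ (1 / 2 : ℝ)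

theorem tsum_bracket_lt_top : ∑' k : ℤ, ENNReal.ofReal ((bracket k ^ 2)⁻¹) < ⊤ :=
  summable_bracket_inv_sq.tsum_ofReal_lt_top

theorem bracketConst_lt_top : bracketConst < ⊤ :=
  ENNReal.rpow_lt_top_of_nonneg (by norm_num) tsum_bracket_lt_top.ne

/-- The extra power in `s + 1 ≤ M` leaves the summable factor `⟨k⟩⁻²` after squaring. -/
theorem sobolevNorm_le_of_bound {s : ℝ} {M : ℕ} (hM : s + 1 ≤ M) {u : ℤ → ℂ} {C : ℝ} (hC0 : 0 ≤ C)
    (hC : ∀ k, ‖u k‖ * bracket k ^ M ≤ C) : sobolevNorm s u ≤ ENNReal.ofReal C * bracketConst := by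
  rw [← ENNReal.pow_le_pow_left_iff two_ne_zero, sobolevNorm_sq, mul_pow, bracketConst,
    ← ENNReal.rpow_ofNat _ 2, ← ENNReal.rpow_ofNat, ← ENNReal.rpow_mul, ENNReal.rpow_ofNat]
  norm_num only
  rw [ENNReal.rpow_one, ← ENNReal.tsum_mul_left]
  refine ENNReal.tsum_le_tsum fun k => ?_
  have hb := bracket_pos k
  rw [← ENNReal.ofReal_pow hC0, ← ENNReal.ofReal_mul (by positivity), ← ofReal_norm,
    ← ENNReal.ofReal_pow (norm_nonneg _), ← ENNReal.ofReal_mul (by positivity)]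
  apply ENNReal.ofReal_le_ofReal
  rw [← div_eq_mul_inv, le_div_iff₀ (by positivity)]
  have h1 : bracket k ^ (2 * s) * bracket k ^ 2 ≤ (bracket k ^ M) ^ 2 := by
    rw [← Real.rpow_natCast (bracket k) 2, ← Real.rpow_add hb, ← pow_mul, ← Real.rpow_natCast]
    apply Real.rpow_le_rpow_of_exponent_le (one_le_bracket k)
    push_cast
    linarith
  calc bracket k ^ (2 * s) * ‖u k‖ ^ 2 * bracket k ^ 2
      = (bracket k ^ (2 * s) * bracket k ^ 2) * ‖u k‖ ^ 2 := by ring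
    _ ≤ (bracket k ^ M) ^ 2 * ‖u k‖ ^ 2 := by gcongr
    _ = (‖u k‖ * bracket k ^ M) ^ 2 := by ring
    _ ≤ C ^ 2 := by have := hC k; gcongr

theorem memSobolev_of_bound {s : ℝ} {u : ℤ → ℂ} (h : ∀ M : ℕ, ∃ C : ℝ, 0 ≤ C ∧
    ∀ k, ‖u k‖ * bracket k ^ M ≤ C) : MemSobolev s u := by
  obtain ⟨M, hM⟩ := exists_nat_ge (s + 1)
  obtain ⟨C, hC0, hC⟩ := h M
  exact (sobolevNorm_le_of_bound hM hC0 hC).trans_lt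
    (ENNReal.mul_lt_top ENNReal.ofReal_lt_top bracketConst_lt_top)

theorem memSobolev_coeff {f : ℝ → ℂ} (hf : ContDiff ℝ ∞ f)
    (hp : Function.Periodic f (2 * Real.pi)) (s : ℝ) : MemSobolev s (coeff f) :=
  memSobolev_of_bound fun M => exists_coeff_bound hf hp M

/-- Together with `mem_of_memSobolev` this exhibits periodic distributions as the union of all
`𝓗^s`, so operators bounded on every `𝓗^s` act on distributions. -/
theorem exists_memSobolev_of_mem {u : ℤ → ℂ} (hu : u ∈ PeriodicDistribution) :
    ∃ s, MemSobolev s u := by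
  obtain ⟨C, n, h⟩ := hu
  refine ⟨-(n + 1 : ℝ), ?_⟩
  have key : sobolevNorm (-(n + 1 : ℝ)) u ≤ ENNReal.ofReal |C| * bracketConst := by
    refine le_trans ?_ (sobolevNorm_le_of_bound (s := -1) (M := 0)
      (u := fun k => ((bracket k ^ n)⁻¹ : ℝ) * u k) (by norm_num) (abs_nonneg C) fun k => ?_)
    · unfold sobolevNorm
      refine ENNReal.rpow_le_rpow (ENNReal.tsum_le_tsum fun k => ?_) (by norm_num)
      have hb := bracket_pos k
      rw [enorm_mul, mul_pow, ← mul_assoc, enorm_ofReal_of_nonneg (by positivity),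
        ← ENNReal.ofReal_pow (by positivity), ← ENNReal.ofReal_mul (by positivity)]
      gcongr
      rw [← Real.rpow_natCast (bracket k) n, ← Real.rpow_neg hb.le, ← Real.rpow_natCast (bracket k ^ (-(n : ℝ))) 2,
        ← Real.rpow_mul hb.le, ← Real.rpow_add hb]
      apply le_of_eq
      congr 1
      push_cast
      ring
    · have hb := bracket_pos k
      rw [pow_zero, mul_one, norm_mul, Complex.norm_real, Real.norm_of_nonneg (by positivity),
        inv_mul_eq_div, div_le_iff₀ (by positivity)]
      exact (h k).trans (by gcongr; exact le_abs_self C)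
  exact key.trans_lt (ENNReal.mul_lt_top ENNReal.ofReal_lt_top bracketConst_lt_top)

theorem mem_of_memSobolev {s : ℝ} {u : ℤ → ℂ} (hu : MemSobolev s u) :
    u ∈ PeriodicDistribution := by
  obtain ⟨n, hn⟩ := exists_nat_ge (-s)
  refine ⟨(sobolevNorm s u).toReal, n, fun k => ?_⟩
  have hb := bracket_pos k
  have h := enorm_apply_le s u k
  have h2 := ENNReal.toReal_mono hu.ne h
  rw [ENNReal.toReal_mul, ENNReal.toReal_ofReal (by positivity), toReal_enorm] at h2
  calc ‖u k‖ = bracket k ^ (-s) * (bracket k ^ s * ‖u k‖) := by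
        rw [← mul_assoc, ← Real.rpow_add hb]; simp
    _ ≤ bracket k ^ (-s) * (sobolevNorm s u).toReal := by gcongr
    _ ≤ bracket k ^ n * (sobolevNorm s u).toReal := by
        gcongr
        rw [← Real.rpow_natCast]
        exact Real.rpow_le_rpow_of_exponent_le (one_le_bracket k) hn
    _ = _ := mul_comm _ _

/-! ### Bounded operators between Sobolev spaces -/

/-- `T` is a linear operator `𝓗^s → 𝓗^{s'}` of norm at most `C`. -/
structure BddOp (s s' : ℝ) (C : ℝ≥0) (T : (ℤ → ℂ) → (ℤ → ℂ)) : Prop where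
  add : ∀ u v, MemSobolev s u → MemSobolev s v → T (u + v) = T u + T v
  smul : ∀ (c : ℂ) (u), MemSobolev s u → T (c • u) = c • T u
  bound : ∀ u, MemSobolev s u → sobolevNorm s' (T u) ≤ C * sobolevNorm s u

namespace BddOp

variable {s s' s'' : ℝ} {C D : ℝ≥0} {S T : (ℤ → ℂ) → (ℤ → ℂ)}

theorem mem (h : BddOp s s' C T) {u : ℤ → ℂ} (hu : MemSobolev s u) : MemSobolev s' (T u) :=
  (h.bound u hu).trans_lt (ENNReal.mul_lt_top ENNReal.coe_lt_top hu)

theorem sub_apply (h : BddOp s s' C T) {u v : ℤ → ℂ} (hu : MemSobolev s u) (hv : MemSobolev s v) :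
    T (u - v) = T u - T v := by
  have := h.add u ((-1 : ℂ) • v) hu (hv.smul _)
  rw [h.smul _ _ hv] at this
  simpa [sub_eq_add_neg] using this

theorem map_zero (h : BddOp s s' C T) : T 0 = 0 := by
  have := h.smul 0 0 (by simp [MemSobolev])
  simpa using this

theorem comp (hS : BddOp s' s'' D S) (hT : BddOp s s' C T) : BddOp s s'' (D * C) (fun u => S (T u)) where
  add u v hu hv := by rw [hT.add u v hu hv, hS.add _ _ (hT.mem hu) (hT.mem hv)]
  smul c u hu := by rw [hT.smul c u hu, hS.smul _ _ (hT.mem hu)]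
  bound u hu := by
    refine (hS.bound _ (hT.mem hu)).trans ?_
    rw [ENNReal.coe_mul, mul_assoc]
    gcongr
    exact hT.bound u hu

theorem sub (hS : BddOp s s' D S) (hT : BddOp s s' C T) : BddOp s s' (D + C) (fun u => S u - T u) where
  add u v hu hv := by rw [hT.add u v hu hv, hS.add u v hu hv]; abel
  smul c u hu := by rw [hT.smul c u hu, hS.smul c u hu, smul_sub]
  bound u hu := by
    refine (sobolevNorm_sub_le _ _ _).trans ?_
    rw [ENNReal.coe_add, add_mul]
    exact add_le_add (hS.bound u hu) (hT.bound u hu)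

theorem mono (hT : BddOp s s' C T) (hCD : C ≤ D) : BddOp s s' D T :=
  ⟨hT.add, hT.smul, fun u hu => (hT.bound u hu).trans (by gcongr)⟩

theorem of_le (hT : BddOp s s' C T) (h : s'' ≤ s') : BddOp s s'' C T :=
  ⟨hT.add, hT.smul, fun u hu => (sobolevNorm_mono h _).trans (hT.bound u hu)⟩

theorem id (s : ℝ) : BddOp s s 1 (fun u => u) :=
  ⟨fun _ _ _ _ => rfl, fun _ _ _ => rfl, fun _ _ => by simp⟩

theorem sum (hT : BddOp s s' C T) (J : Finset ℤ) (u : ℤ → ℂ) :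
    T (trunc J u) = ∑ k ∈ J, u k • T (Pi.single k 1) := by
  classical
  induction J using Finset.induction_on with
  | empty => 
    rw [trunc_eq_sum]; simpa using hT.map_zero
  | insert a J ha ih =>
    rw [trunc_eq_sum, Finset.sum_insert ha, Finset.sum_insert ha, ← trunc_eq_sum,
      hT.add _ _ ((memSobolev_single s a).smul _) (memSobolev_trunc s J u),
      hT.smul _ _ (memSobolev_single s a), ih]

theorem apply_trunc_tendsto (hT : BddOp s s' C T) {u : ℤ → ℂ} (hu : MemSobolev s u) :
    Tendsto (fun J => sobolevNorm s' (T u - T (trunc J u))) atTop (𝓝 0) := by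
  have h := ENNReal.Tendsto.const_mul (a := (C : ℝ≥0∞)) (tendsto_sub_trunc hu) (Or.inr ENNReal.coe_ne_top)
  rw [mul_zero] at h
  refine tendsto_of_tendsto_of_tendsto_of_le_of_le tendsto_const_nhds h (fun _ => zero_le) fun J => ?_
  simp only []
  rw [← hT.sub_apply hu (memSobolev_trunc s J u)]
  exact hT.bound _ (hu.sub (memSobolev_trunc s J u))

/-- Strong convergence from convergence on the basis and uniform boundedness. -/
theorem tendsto_zero {ι : Type*} {l : Filter ι} {T : ι → (ℤ → ℂ) → (ℤ → ℂ)}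
    (hT : ∀ᶠ i in l, BddOp s s' C (T i))
    (h0 : ∀ k, Tendsto (fun i => sobolevNorm s' (T i (Pi.single k 1))) l (𝓝 0))
    {u : ℤ → ℂ} (hu : MemSobolev s u) : Tendsto (fun i => sobolevNorm s' (T i u)) l (𝓝 0) := by
  have hfin : ∀ J : Finset ℤ, Tendsto (fun i => ∑ k ∈ J, ‖u k‖ₑ * sobolevNorm s' (T i (Pi.single k 1)))
      l (𝓝 0) := fun J => by
    rw [show (0 : ℝ≥0∞) = ∑ k ∈ J, ‖u k‖ₑ * 0 by simp]
    exact tendsto_finsetSum _ fun k _ => ENNReal.Tendsto.const_mul (h0 k) (Or.inr enorm_ne_top)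
  rw [ENNReal.tendsto_nhds_zero]
  intro ε hε
  have h := ENNReal.Tendsto.const_mul (a := (C : ℝ≥0∞)) (tendsto_sub_trunc hu) (Or.inr ENNReal.coe_ne_top)
  rw [mul_zero, ENNReal.tendsto_nhds_zero] at h
  -- The finite set is fixed first, making the tail of `u` contribute at most `ε/2` uniformly in
  -- `i`; only finitely many basis vectors remain.
  obtain ⟨J, hJ⟩ := (h (ε / 2) (ENNReal.half_pos hε.ne')).exists
  filter_upwards [hT, ENNReal.tendsto_nhds_zero.mp (hfin J) (ε / 2) (ENNReal.half_pos hε.ne')] with i hi hs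
  have e : T i u = T i (u - trunc J u) + T i (trunc J u) := by
    rw [hi.sub_apply hu (memSobolev_trunc s J u)]; abel
  rw [e]
  refine (sobolevNorm_add_le _ _ _).trans ?_
  rw [← ENNReal.add_halves ε]
  refine add_le_add ((hi.bound _ (hu.sub (memSobolev_trunc s J u))).trans hJ) (le_trans ?_ hs)
  rw [hi.sum]
  clear hs hJ hfin e
  classical
  induction J using Finset.induction_on with
  | empty => simp
  | insert a J ha ih =>
    rw [Finset.sum_insert ha, Finset.sum_insert ha]
    refine (sobolevNorm_add_le _ _ _).trans ?_
    rw [sobolevNorm_smul]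
    gcongr

/-- Convergence on basis vectors, applied to a constant family along a one-point filter: the norm of
the difference tends to zero, hence is zero. -/
theorem ext (hS : BddOp s s' D S) (hT : BddOp s s' C T)
    (h : ∀ k, S (Pi.single k 1) = T (Pi.single k 1)) {u : ℤ → ℂ} (hu : MemSobolev s u) : S u = T u := by
  have := tendsto_zero (l := (pure () : Filter Unit)) (T := fun _ u => S u - T u) (C := D + C)
    (s := s) (s' := s') (Eventually.of_forall fun _ => hS.sub hT) (fun k => by
      simp [h k]) hu
  rw [tendsto_pure_left] at this
  have h0 : sobolevNorm s' (S u - T u) = 0 := by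
    by_contra hne
    have := this {x | x ≠ sobolevNorm s' (S u - T u)} (isOpen_ne.mem_nhds (Ne.symm hne))
    simp at this
  exact sub_eq_zero.mp (eq_zero_of_sobolevNorm_eq_zero h0)

end BddOp

/-- The action of an infinite matrix on sequences. -/
def mv (A : ℤ → ℤ → ℂ) (u : ℤ → ℂ) : ℤ → ℂ := fun j => ∑' k, A j k * u k

theorem mv_of_finite (A : ℤ → ℤ → ℂ) {u : ℤ → ℂ} (J : Finset ℤ) (h : ∀ k ∉ J, u k = 0) (j : ℤ) :
    mv A u j = ∑ k ∈ J, A j k * u k := tsum_eq_sum fun k hk => by simp [h k hk]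

/-- For matrices, an estimate on finitely supported sequences is enough. It forces absolute
convergence of every row against `𝓗^s`, and the bound then passes to the limit along truncations. -/
theorem bddOp_mv {s s' : ℝ} {C : ℝ≥0} {A : ℤ → ℤ → ℂ}
    (h : ∀ (J : Finset ℤ) (u : ℤ → ℂ), (∀ k ∉ J, u k = 0) →
      sobolevNorm s' (mv A u) ≤ C * sobolevNorm s u) : BddOp s s' C (mv A) := by
  have hsum : ∀ u, MemSobolev s u → ∀ j, Summable fun k => A j k * u k := by
    intro u hu j
    have hb : 0 < bracket j ^ s' := Real.rpow_pos_of_pos (bracket_pos j) s'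
    refine Summable.of_norm ?_
    refine summable_of_sum_le (c := (bracket j ^ s')⁻¹ * (C * (sobolevNorm s u).toReal))
      (fun _ => norm_nonneg _) fun J => ?_
    -- Unimodular phases (zero where the term vanishes) make every term of row `j` equal to its
    -- absolute value without increasing the norm.
    let w : ℤ → ℂ := fun k => if k ∈ J then
      (starRingEnd ℂ (A j k * u k) / ‖A j k * u k‖) * u k else 0
    have hw : ∀ k ∉ J, w k = 0 := fun k hk => by simp [w, hk]
    have hwu : sobolevNorm s w ≤ sobolevNorm s u := sobolevNorm_mono_fun fun k => by
      simp only [w]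
      split_ifs
      · rw [norm_mul, norm_div, RCLike.norm_conj, Complex.norm_real, norm_norm]
        exact mul_le_of_le_one_left (norm_nonneg _) (div_self_le_one _)
      · simp
    have h1 := (enorm_apply_le s' (mv A w) j).trans ((h J w hw).trans
      (mul_le_mul_right hwu _))
    have h2 := ENNReal.toReal_mono (ENNReal.mul_ne_top ENNReal.coe_ne_top hu.ne) h1
    rw [ENNReal.toReal_mul, ENNReal.toReal_ofReal hb.le, toReal_enorm, ENNReal.toReal_mul,
      ENNReal.coe_toReal] at h2
    have h3 : mv A w j = ((∑ k ∈ J, ‖A j k * u k‖ : ℝ) : ℂ) := by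
      rw [mv_of_finite A J hw, Complex.ofReal_sum]
      refine Finset.sum_congr rfl fun k hk => ?_
      simp only [w, hk, if_true]
      by_cases h0 : A j k * u k = 0
      · simp [h0]
      · have hn : (‖A j k * u k‖ : ℂ) ≠ 0 := by simpa using h0
        rw [mul_comm (_ / _), ← mul_assoc, ← mul_div_assoc, Complex.mul_conj, div_eq_iff hn,
          Complex.normSq_eq_norm_sq]
        push_cast
        ring
    rw [h3, Complex.norm_real, Real.norm_of_nonneg (Finset.sum_nonneg fun _ _ => norm_nonneg _)] at h2
    rw [inv_mul_eq_div, le_div_iff₀ hb, mul_comm]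
    exact h2
  refine ⟨fun u v hu hv => ?_, fun c u hu => ?_, fun u hu => ?_⟩
  · funext j
    simp only [mv, Pi.add_apply, mul_add]
    exact (hsum u hu j).tsum_add (hsum v hv j)
  · funext j
    simp only [mv, Pi.smul_apply, smul_eq_mul]
    rw [← tsum_mul_left]
    congr 1
    funext k
    ring
  · refine sobolevNorm_le_of_tendsto (l := atTop) (u := fun J : Finset ℤ => mv A (trunc J u))
      (fun j => ?_) (Eventually.of_forall fun J => ?_)
    · refine (hsum u hu j).hasSum.congr fun J => ?_
      rw [mv_of_finite A J (fun k hk => by simp [trunc, hk])]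
      refine Finset.sum_congr rfl fun k hk => by simp [trunc, hk]
    · refine (h J _ fun k hk => by simp [trunc, hk]).trans ?_
      gcongr
      exact sobolevNorm_trunc_le s J u

/-! ### The Schur test for almost diagonal matrices -/

/-- Peetre's inequality. -/
theorem bracket_le_mul (j k : ℤ) : bracket j ≤ 2 * bracket k * bracket (j - k) := by
  have hj := abs_le_bracket k
  have hk := abs_le_bracket (j - k)
  have h1 := one_le_bracket k
  have h2 := one_le_bracket (j - k)
  have e : bracket j ^ 2 = 1 + (j : ℝ) ^ 2 := Real.sq_sqrt (by positivity)
  have e1 : bracket k ^ 2 = 1 + (k : ℝ) ^ 2 := Real.sq_sqrt (by positivity)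
  have e2 : bracket (j - k) ^ 2 = 1 + ((j - k : ℤ) : ℝ) ^ 2 := Real.sq_sqrt (by positivity)
  refine le_of_sq_le_sq ?_ (by positivity)
  rw [mul_pow, mul_pow, e, e1, e2]
  push_cast
  nlinarith [sq_nonneg ((k : ℝ) - (j - k)), mul_nonneg (sq_nonneg (k : ℝ)) (sq_nonneg ((j : ℝ) - k)), sq_nonneg (k : ℝ), sq_nonneg ((j : ℝ) - k)]

theorem bracket_neg (k : ℤ) : bracket (-k) = bracket k := by simp [bracket]

/-- For negative exponents, Peetre's inequality is used with `j` and `k` exchanged. -/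
theorem bracket_rpow_le (σ : ℝ) (j k : ℤ) :
    bracket j ^ σ ≤ 2 ^ |σ| * bracket k ^ σ * bracket (j - k) ^ |σ| := by
  have hj := bracket_pos j
  have hk := bracket_pos k
  have hjk := bracket_pos (j - k)
  rcases le_total 0 σ with h | h
  · rw [abs_of_nonneg h, ← Real.mul_rpow (by norm_num) hk.le, ← Real.mul_rpow (by positivity) hjk.le]
    exact Real.rpow_le_rpow hj.le (bracket_le_mul j k) h
  · rw [abs_of_nonpos h]
    have h1 := bracket_le_mul k j
    rw [show k - j = -(j - k) by ring, bracket_neg] at h1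
    have h2 := Real.rpow_le_rpow hk.le h1 (neg_nonneg.mpr h)
    rw [Real.mul_rpow (by positivity) hjk.le, Real.mul_rpow (by norm_num) hj.le] at h2
    calc bracket j ^ σ = bracket j ^ σ * bracket k ^ σ * bracket k ^ (-σ) := by
          rw [mul_assoc, ← Real.rpow_add hk]; simp
      _ ≤ bracket j ^ σ * bracket k ^ σ * (2 ^ (-σ) * bracket j ^ (-σ) * bracket (j - k) ^ (-σ)) := by
          gcongr
      _ = (bracket j ^ σ * bracket j ^ (-σ)) * (2 ^ (-σ) * bracket k ^ σ * bracket (j - k) ^ (-σ)) := by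
          ring
      _ = _ := by rw [← Real.rpow_add hj]; simp

/-- Cauchy–Schwarz after writing `q = q^{1/2} q^{1/2}`. -/
theorem ennreal_sq_tsum_mul_le (q a : ℤ → ℝ≥0∞) :
    (∑' k, q k * a k) ^ 2 ≤ (∑' k, q k) * ∑' k, q k * a k ^ 2 := by
  have h := ENNReal.lintegral_mul_le_Lp_mul_Lq (μ := Measure.count) (p := 2) (q := 2)
    (f := fun k : ℤ => q k ^ (1 / 2 : ℝ)) (g := fun k => q k ^ (1 / 2 : ℝ) * a k)
    Real.HolderConjugate.two_two (measurable_of_countable _).aemeasurable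
    (measurable_of_countable _).aemeasurable
  simp only [lintegral_count, Pi.mul_apply, ← mul_assoc] at h
  have e : ∀ k, q k ^ (1 / 2 : ℝ) * q k ^ (1 / 2 : ℝ) = q k := fun k => by
    rw [← ENNReal.rpow_add_of_nonneg _ _ (by norm_num) (by norm_num)]; norm_num
  simp only [e, ENNReal.rpow_ofNat, mul_pow, sq (_ ^ (1 / 2 : ℝ))] at h
  have h2 := pow_le_pow_left₀ zero_le h 2
  refine h2.trans (le_of_eq ?_)
  rw [mul_pow, sq (_ ^ (1 / 2 : ℝ)), sq (_ ^ (1 / 2 : ℝ)),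
    ← ENNReal.rpow_add_of_nonneg _ _ (by norm_num) (by norm_num),
    ← ENNReal.rpow_add_of_nonneg _ _ (by norm_num) (by norm_num)]
  norm_num

/-- After conjugation by the weights, the matrix is dominated by convolution with the summable
kernel `⟨n⟩⁻²`, which is bounded on `ℓ²`. -/
theorem sobolevNorm_mv_le {s s' : ℝ} {C : ℝ≥0} {A : ℤ → ℤ → ℂ}
    (h : ∀ j k, bracket j ^ s' * ‖A j k‖ ≤ C * (bracket (j - k) ^ 2)⁻¹ * bracket k ^ s) (u : ℤ → ℂ) :
    sobolevNorm s' (mv A u) ≤ C * (∑' k : ℤ, ENNReal.ofReal ((bracket k ^ 2)⁻¹)) * sobolevNorm s u := by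
  set q : ℤ → ℝ≥0∞ := fun k => ENNReal.ofReal ((bracket k ^ 2)⁻¹) with hq
  set a : ℤ → ℝ≥0∞ := fun k => ENNReal.ofReal (bracket k ^ s) * ‖u k‖ₑ with ha
  have hsq : ∀ (σ : ℝ) (k : ℤ) (x : ℝ≥0∞), ENNReal.ofReal (bracket k ^ (2 * σ)) * x ^ 2 =
      (ENNReal.ofReal (bracket k ^ σ) * x) ^ 2 := fun σ k x => by
    rw [mul_pow, ← ENNReal.ofReal_pow (Real.rpow_nonneg (bracket_pos k).le σ), mul_comm 2 σ,
      Real.rpow_mul (bracket_pos k).le, Real.rpow_ofNat]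
  have h1 : ∀ j, ENNReal.ofReal (bracket j ^ s') * ‖mv A u j‖ₑ ≤ C * ∑' k, q (j - k) * a k := by
    intro j
    calc ENNReal.ofReal (bracket j ^ s') * ‖mv A u j‖ₑ
        ≤ ENNReal.ofReal (bracket j ^ s') * ∑' k, ‖A j k * u k‖ₑ := by
          gcongr; exact enorm_tsum_le_tsum_enorm
      _ = ∑' k, ENNReal.ofReal (bracket j ^ s') * ‖A j k‖ₑ * ‖u k‖ₑ := by
          rw [← ENNReal.tsum_mul_left]; simp only [enorm_mul, mul_assoc]
      _ ≤ ∑' k, C * (q (j - k) * a k) := by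
          refine ENNReal.tsum_le_tsum fun k => ?_
          simp only [hq, ha]
          rw [← mul_assoc, ← mul_assoc]
          refine mul_le_mul_left ?_ _
          have hk := bracket_pos k
          have hj := bracket_pos j
          have hjk := bracket_pos (j - k)
          rw [← ofReal_norm, ← ENNReal.ofReal_mul (by positivity), ← ENNReal.ofReal_coe_nnreal,
            ← ENNReal.ofReal_mul (by positivity), ← ENNReal.ofReal_mul (by positivity)]
          exact ENNReal.ofReal_le_ofReal (h j k)
      _ = _ := ENNReal.tsum_mul_left
  rw [← ENNReal.pow_le_pow_left_iff two_ne_zero, sobolevNorm_sq, mul_pow, sobolevNorm_sq]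
  simp_rw [hsq]
  calc ∑' j, (ENNReal.ofReal (bracket j ^ s') * ‖mv A u j‖ₑ) ^ 2
      ≤ ∑' j, (C : ℝ≥0∞) ^ 2 * ((∑' k, q k) * ∑' k, q (j - k) * a k ^ 2) := by
        refine ENNReal.tsum_le_tsum fun j => (pow_le_pow_left₀ zero_le (h1 j) 2).trans ?_
        rw [mul_pow]
        gcongr
        refine (ennreal_sq_tsum_mul_le _ _).trans (le_of_eq ?_)
        rw [← (Equiv.subLeft j).tsum_eq q]
        rfl
    _ = (C : ℝ≥0∞) ^ 2 * ((∑' k, q k) * ∑' k, (∑' j, q (j - k)) * a k ^ 2) := by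
        rw [ENNReal.tsum_mul_left, ENNReal.tsum_mul_left, ENNReal.tsum_comm]
        simp_rw [ENNReal.tsum_mul_right]
    _ = (C * ∑' k, q k) ^ 2 * ∑' k, a k ^ 2 := by
        have : ∀ k, ∑' j, q (j - k) = ∑' j, q j := fun k => (Equiv.subRight k).tsum_eq q
        simp_rw [this, ENNReal.tsum_mul_left]
        ring

/-- Matrices with rapid off-diagonal decay are bounded `𝓗^s → 𝓗^{s-r}`, uniformly. -/
theorem exists_bddOp_of_decay (s r : ℝ) (C₀ : ℕ → ℝ) :
    ∃ C : ℝ≥0, ∀ A : ℤ → ℤ → ℂ,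
      (∀ M j k, ‖A j k‖ * bracket (j - k) ^ M ≤ C₀ M * bracket k ^ r) →
      BddOp s (s - r) C (mv A) := by
  -- Of these powers, `|s - r|` pay for moving the weight from `j` to `k` by Peetre's inequality,
  -- and `2` make the kernel summable.
  obtain ⟨M, hM⟩ := exists_nat_ge (|s - r| + 2)
  set Q := ∑' k : ℤ, ENNReal.ofReal ((bracket k ^ 2)⁻¹)
  have hQ : Q ≠ ⊤ := tsum_bracket_lt_top.ne
  refine ⟨Real.toNNReal (2 ^ |s - r| * C₀ M) * Q.toNNReal, fun A hA => bddOp_mv fun J u _ => ?_⟩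
  rw [ENNReal.coe_mul, ENNReal.coe_toNNReal hQ]
  refine sobolevNorm_mv_le (fun j k => ?_) u
  have hj := bracket_pos j
  have hk := bracket_pos k
  have hjk := bracket_pos (j - k)
  calc bracket j ^ (s - r) * ‖A j k‖
      ≤ (2 ^ |s - r| * bracket k ^ (s - r) * bracket (j - k) ^ |s - r|) * ‖A j k‖ := by
        gcongr; exact bracket_rpow_le _ _ _
    _ ≤ (2 ^ |s - r| * bracket k ^ (s - r) * (bracket (j - k) ^ M * (bracket (j - k) ^ 2)⁻¹)) * ‖A j k‖ := by
        gcongr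
        rw [← Real.rpow_natCast _ M, ← Real.rpow_natCast _ 2, ← Real.rpow_neg hjk.le,
          ← Real.rpow_add hjk]
        apply Real.rpow_le_rpow_of_exponent_le (one_le_bracket _)
        push_cast; linarith
    _ = 2 ^ |s - r| * bracket k ^ (s - r) * (bracket (j - k) ^ 2)⁻¹ * (‖A j k‖ * bracket (j - k) ^ M) := by
        ring
    _ ≤ 2 ^ |s - r| * bracket k ^ (s - r) * (bracket (j - k) ^ 2)⁻¹ * (C₀ M * bracket k ^ r) := by
        exact mul_le_mul_of_nonneg_left (hA M j k) (by positivity)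
    _ = (2 ^ |s - r| * C₀ M) * (bracket (j - k) ^ 2)⁻¹ * (bracket k ^ (s - r) * bracket k ^ r) := by ring
    _ ≤ _ := by
        rw [← Real.rpow_add hk, sub_add_cancel]
        gcongr
        exact Real.le_coe_toNNReal _

/-! ### Duality and interpolation -/

/-- The weighted `ℓ²` norm over a finite set of indices. -/
def finNorm (s : ℝ) (J : Finset ℤ) (u : ℤ → ℂ) : ℝ :=
  Real.sqrt (∑ k ∈ J, bracket k ^ (2 * s) * ‖u k‖ ^ 2)

theorem finNorm_nonneg (s : ℝ) (J : Finset ℤ) (u : ℤ → ℂ) : 0 ≤ finNorm s J u := Real.sqrt_nonneg _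

theorem ofReal_finNorm_sq (s : ℝ) (J : Finset ℤ) (u : ℤ → ℂ) : ENNReal.ofReal (finNorm s J u) ^ 2 =
    ∑ k ∈ J, ENNReal.ofReal (bracket k ^ (2 * s)) * ‖u k‖ₑ ^ 2 := by
  have hb : ∀ k : ℤ, 0 ≤ bracket k ^ (2 * s) := fun k => Real.rpow_nonneg (bracket_pos k).le _
  rw [← ENNReal.ofReal_pow (finNorm_nonneg _ _ _), finNorm,
    Real.sq_sqrt (Finset.sum_nonneg fun k _ => mul_nonneg (hb k) (sq_nonneg _)),
    ENNReal.ofReal_sum_of_nonneg fun k _ => mul_nonneg (hb k) (sq_nonneg _)]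
  refine Finset.sum_congr rfl fun k _ => ?_
  rw [ENNReal.ofReal_mul (hb k), ENNReal.ofReal_pow (norm_nonneg _), ofReal_norm]

theorem ofReal_finNorm_le (s : ℝ) (J : Finset ℤ) (u : ℤ → ℂ) :
    ENNReal.ofReal (finNorm s J u) ≤ sobolevNorm s u := by
  rw [← ENNReal.pow_le_pow_left_iff two_ne_zero, ofReal_finNorm_sq]
  exact sobolevNorm_le_iff.mp le_rfl J

theorem sobolevNorm_of_finite {s : ℝ} {J : Finset ℤ} {u : ℤ → ℂ} (h : ∀ k ∉ J, u k = 0) :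
    sobolevNorm s u = ENNReal.ofReal (finNorm s J u) := by
  rw [← (ENNReal.pow_right_strictMono two_ne_zero).injective.eq_iff, ofReal_finNorm_sq, sobolevNorm_sq]
  exact tsum_eq_sum fun k hk => by simp [h k hk]

theorem finNorm_le {s : ℝ} {J : Finset ℤ} {u : ℤ → ℂ} {C : ℝ} (hC : 0 ≤ C)
    (h : sobolevNorm s u ≤ ENNReal.ofReal C) : finNorm s J u ≤ C :=
  (ENNReal.ofReal_le_ofReal_iff hC).mp ((ofReal_finNorm_le s J u).trans h)

theorem norm_sum_mul_le (s : ℝ) (J : Finset ℤ) (b v : ℤ → ℂ) :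
    ‖∑ j ∈ J, b j * v j‖ ≤ finNorm (-s) J b * finNorm s J v := by
  have hb := bracket_pos
  calc ‖∑ j ∈ J, b j * v j‖ ≤ ∑ j ∈ J, ‖b j * v j‖ := norm_sum_le _ _
    _ = ∑ j ∈ J, (bracket j ^ (-s) * ‖b j‖) * (bracket j ^ s * ‖v j‖) := by
        refine Finset.sum_congr rfl fun j _ => ?_
        rw [norm_mul, mul_mul_mul_comm, ← Real.rpow_add (hb j)]
        simp
    _ ≤ Real.sqrt (∑ j ∈ J, (bracket j ^ (-s) * ‖b j‖) ^ 2) *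
          Real.sqrt (∑ j ∈ J, (bracket j ^ s * ‖v j‖) ^ 2) := Real.sum_mul_le_sqrt_mul_sqrt _ _ _
    _ = _ := by
        unfold finNorm
        simp_rw [mul_pow, ← Real.rpow_mul_natCast (hb _).le, mul_comm _ ((2 : ℕ) : ℝ)]
        rfl

theorem sobolevNorm_le_of_dual {s C : ℝ} (hC : 0 ≤ C) {v : ℤ → ℂ}
    (h : ∀ (J : Finset ℤ) (b : ℤ → ℂ), ‖∑ j ∈ J, b j * v j‖ ≤ C * finNorm (-s) J b) :
    sobolevNorm s v ≤ ENNReal.ofReal C := by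
  rw [sobolevNorm_le_iff]
  intro J
  rw [← ofReal_finNorm_sq]
  gcongr
  have hb := bracket_pos
  -- The extremal test sequence `⟨j⟩^{2s} v̄_j`, for which the pairing equals the squared norm of
  -- `v` over `J`.
  have h1 := h J (fun j => (bracket j ^ (2 * s) : ℝ) * starRingEnd ℂ (v j))
  have e1 : finNorm (-s) J (fun j => (bracket j ^ (2 * s) : ℝ) * starRingEnd ℂ (v j)) = finNorm s J v := by
    unfold finNorm
    congr 1
    refine Finset.sum_congr rfl fun j _ => ?_
    rw [norm_mul, RCLike.norm_conj, Complex.norm_real,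
      Real.norm_of_nonneg (Real.rpow_nonneg (hb j).le _), mul_pow, ← mul_assoc, ← Real.rpow_natCast (_ ^ _),
      ← Real.rpow_mul (hb j).le, ← Real.rpow_add (hb j)]
    congr 2
    push_cast; ring
  have e2 : ∑ j ∈ J, (bracket j ^ (2 * s) : ℝ) * starRingEnd ℂ (v j) * v j =
      ((finNorm s J v ^ 2 : ℝ) : ℂ) := by
    rw [finNorm, Real.sq_sqrt (Finset.sum_nonneg fun k _ =>
      mul_nonneg (Real.rpow_nonneg (hb k).le _) (sq_nonneg _)), Complex.ofReal_sum]
    refine Finset.sum_congr rfl fun j _ => ?_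
    rw [mul_assoc, Complex.conj_mul']
    push_cast; ring
  rw [e1, e2, Complex.norm_real, Real.norm_of_nonneg (sq_nonneg _), sq] at h1
  rcases (finNorm_nonneg s J v).eq_or_lt with h0 | h0
  · rwa [← h0]
  · exact le_of_mul_le_mul_right h1 h0

theorem BddOp.finNorm_mv_le {s s' : ℝ} {C : ℝ≥0} {A : ℤ → ℤ → ℂ} (h : BddOp s s' C (mv A))
    {J : Finset ℤ} {u : ℤ → ℂ} (hu : ∀ k ∉ J, u k = 0) (J' : Finset ℤ) :
    finNorm s' J' (mv A u) ≤ C * finNorm s J u := by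
  refine finNorm_le (mul_nonneg C.coe_nonneg (finNorm_nonneg _ _ _)) ?_
  rw [ENNReal.ofReal_mul C.coe_nonneg, ← sobolevNorm_of_finite hu]
  have := h.bound u (memSobolev_of_finite J hu)
  rwa [← ENNReal.ofReal_coe_nnreal] at this

theorem bddOp_mv_of_bilinear {s s' : ℝ} {C : ℝ≥0} {A : ℤ → ℤ → ℂ}
    (h : ∀ (J J' : Finset ℤ) (u b : ℤ → ℂ), 
      ‖∑ j ∈ J', b j * ∑ k ∈ J, A j k * u k‖ ≤ C * finNorm s J u * finNorm (-s') J' b) :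
    BddOp s s' C (mv A) := by
  refine bddOp_mv fun J u hu => ?_
  rw [sobolevNorm_of_finite hu, ← ENNReal.ofReal_coe_nnreal, ← ENNReal.ofReal_mul C.coe_nonneg]
  refine sobolevNorm_le_of_dual (mul_nonneg C.coe_nonneg (finNorm_nonneg _ _ _)) fun J' b => ?_
  simp_rw [mv_of_finite A J hu]
  exact h J J' u b

theorem finNorm_congr {s s' : ℝ} {J : Finset ℤ} {u v : ℤ → ℂ}
    (h : ∀ k ∈ J, bracket k ^ (2 * s) * ‖u k‖ ^ 2 = bracket k ^ (2 * s') * ‖v k‖ ^ 2) :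
    finNorm s J u = finNorm s' J v := by
  unfold finNorm; rw [Finset.sum_congr rfl h]

theorem finNorm_trunc (s : ℝ) (J : Finset ℤ) (u : ℤ → ℂ) : finNorm s J (trunc J u) = finNorm s J u :=
  finNorm_congr fun k hk => by simp [trunc, hk]

theorem mv_trunc (A : ℤ → ℤ → ℂ) (J : Finset ℤ) (u : ℤ → ℂ) (j : ℤ) :
    mv A (trunc J u) j = ∑ k ∈ J, A j k * u k := by
  rw [mv_of_finite A J fun k hk => by simp [trunc, hk]]
  exact Finset.sum_congr rfl fun k hk => by simp [trunc, hk]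

theorem BddOp.norm_sum_le {s s' : ℝ} {C : ℝ≥0} {A : ℤ → ℤ → ℂ} (h : BddOp s s' C (mv A))
    (J J' : Finset ℤ) (u b : ℤ → ℂ) :
    ‖∑ j ∈ J', b j * ∑ k ∈ J, A j k * u k‖ ≤ C * finNorm s J u * finNorm (-s') J' b := by
  simp_rw [← mv_trunc]
  refine (norm_sum_mul_le s' J' b _).trans ?_
  rw [mul_comm]
  gcongr
  · exact finNorm_nonneg _ _ _
  · refine (h.finNorm_mv_le (J := J) (fun k hk => by simp [trunc, hk]) J').trans ?_
    rw [finNorm_trunc]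

/-- The bilinear estimate is symmetric in its two arguments up to conjugation, so the adjoint
satisfies it on the dual spaces with the same constant. -/
theorem BddOp.dual {s s' : ℝ} {C : ℝ≥0} {A B : ℤ → ℤ → ℂ} (h : BddOp s s' C (mv B))
    (hAB : ∀ j k, A j k = starRingEnd ℂ (B k j)) : BddOp (-s') (-s) C (mv A) := by
  refine bddOp_mv_of_bilinear fun J J' u b => ?_
  have h1 := h.norm_sum_le J' J (fun j => starRingEnd ℂ (b j)) (fun k => starRingEnd ℂ (u k))
  have e : ∀ (σ : ℝ) (J : Finset ℤ) (w : ℤ → ℂ), finNorm σ J (fun j => starRingEnd ℂ (w j)) =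
    finNorm σ J w := fun σ J w => finNorm_congr fun k _ => by rw [RCLike.norm_conj]
  rw [e, e] at h1
  rw [neg_neg, mul_right_comm]
  refine le_trans (le_of_eq ?_) h1
  rw [← RCLike.norm_conj (K := ℂ)]
  simp_rw [map_sum, map_mul, map_sum, map_mul, hAB, Complex.conj_conj, Finset.mul_sum]
  rw [Finset.sum_comm]
  congr 1
  refine Finset.sum_congr rfl fun j _ => Finset.sum_congr rfl fun k _ => ?_
  ring

/-- Interpolation between Sobolev spaces, by the three lines theorem. -/
theorem BddOp.interp {n s : ℝ} (hs0 : 0 ≤ s) (hsn : s ≤ n) (hn : 0 < n) {C : ℝ≥0} {A : ℤ → ℤ → ℂ}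
    (h0 : BddOp 0 0 C (mv A)) (h1 : BddOp n n C (mv A)) : BddOp s s C (mv A) := by
  refine bddOp_mv_of_bilinear fun J J' u b => ?_
  have hb := bracket_pos
  have hbc : ∀ k, (bracket k : ℂ) ≠ 0 := fun k => by exact_mod_cast (hb k).ne'
  -- On `Re z = x` the complex powers turn the `𝓗^x` norm of the first argument into `‖u‖_s` and the
  -- `𝓗^{-x}` norm of the second into `‖b‖_{-s}`; at `z = s` the original pairing is recovered. The
  -- sums are finite, so `f` is entire.
  let f : ℂ → ℂ := fun z => ∑ j ∈ J', ((bracket j : ℂ) ^ (z - s) * b j) *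
    ∑ k ∈ J, A j k * ((bracket k : ℂ) ^ (s - z) * u k)
  have hf : Differentiable ℂ f := by
    have hp : ∀ k : ℤ, Differentiable ℂ fun z : ℂ => (bracket k : ℂ) ^ (z - s) := fun k =>
      (differentiable_id.sub_const _).const_cpow (Or.inl (hbc k))
    have hm : ∀ k : ℤ, Differentiable ℂ fun z : ℂ => (bracket k : ℂ) ^ (s - z) := fun k =>
      (differentiable_id.const_sub _).const_cpow (Or.inl (hbc k))
    refine Differentiable.fun_sum fun j _ => ((hp j).mul_const _).mul
      (Differentiable.fun_sum fun k _ => ((hm k).mul_const _).const_mul _)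
  have hline : ∀ x : ℝ, BddOp x x C (mv A) → ∀ z ∈ Complex.re ⁻¹' {x},
      ‖f z‖ ≤ C * finNorm s J u * finNorm (-s) J' b := by
    intro x hx z hz
    have hz : z.re = x := hz
    refine (hx.norm_sum_le J J' (fun k => (bracket k : ℂ) ^ (s - z) * u k)
      (fun j => (bracket j : ℂ) ^ (z - s) * b j)).trans (le_of_eq ?_)
    congr 1
    · congr 1
      refine finNorm_congr fun k _ => ?_
      rw [norm_mul, Complex.norm_cpow_eq_rpow_re_of_pos (hb k), mul_pow, ← mul_assoc,
        ← Real.rpow_natCast (_ ^ _), ← Real.rpow_mul (hb k).le, ← Real.rpow_add (hb k)]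
      congr 2
      simp [hz]; ring
    · refine finNorm_congr fun k _ => ?_
      rw [norm_mul, Complex.norm_cpow_eq_rpow_re_of_pos (hb k), mul_pow, ← mul_assoc,
        ← Real.rpow_natCast (_ ^ _), ← Real.rpow_mul (hb k).le, ← Real.rpow_add (hb k)]
      congr 2
      simp [hz]; ring
  have hB : BddAbove ((norm ∘ f) '' Complex.HadamardThreeLines.verticalClosedStrip 0 n) := by
    refine ⟨∑ j ∈ J', (bracket j ^ (n - s) * ‖b j‖) *
      ∑ k ∈ J, ‖A j k‖ * (bracket k ^ s * ‖u k‖), ?_⟩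
    rintro _ ⟨z, ⟨hz0, hz1⟩, rfl⟩
    refine (_root_.norm_sum_le _ _).trans (Finset.sum_le_sum fun j _ => ?_)
    rw [norm_mul, norm_mul, Complex.norm_cpow_eq_rpow_re_of_pos (hb j)]
    gcongr
    · have := hb j; positivity
    · exact one_le_bracket j
    · simpa using hz1
    · refine (_root_.norm_sum_le _ _).trans (Finset.sum_le_sum fun k _ => ?_)
      rw [norm_mul, norm_mul, Complex.norm_cpow_eq_rpow_re_of_pos (hb k)]
      gcongr
      · exact one_le_bracket k
      · simpa using hz0
  have hX : 0 ≤ C * finNorm s J u * finNorm (-s) J' b :=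
    mul_nonneg (mul_nonneg C.coe_nonneg (finNorm_nonneg _ _ _)) (finNorm_nonneg _ _ _)
  have key := Complex.HadamardThreeLines.norm_le_interp_of_mem_verticalClosedStrip' (f := f)
    (z := (s : ℂ)) hn (by simpa [Complex.HadamardThreeLines.verticalClosedStrip] using ⟨hs0, hsn⟩)
    hf.diffContOnCl hB (hline 0 h0) (hline n h1)
  rw [← Real.rpow_add' hX (by simp)] at key
  simpa [f] using key

/-- The mean value inequality for curves in a Sobolev space given by their coefficients. -/
theorem sobolevNorm_sub_le_of_hasDerivAt {σ M : ℝ} {I : Set ℝ} (hI : Convex ℝ I) {g g' : ℝ → ℤ → ℂ}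
    (hM : 0 ≤ M) (hg : ∀ r ∈ I, ∀ j, HasDerivAt (fun r => g r j) (g' r j) r)
    (hg' : ∀ r ∈ I, sobolevNorm σ (g' r) ≤ ENNReal.ofReal M) {t r : ℝ} (ht : t ∈ I) (hr : r ∈ I) :
    sobolevNorm σ (g r - g t) ≤ ENNReal.ofReal (M * |r - t|) := by
  refine sobolevNorm_le_of_dual (by positivity) fun J b => ?_
  -- By duality only finite pairings matter, so the scalar mean value inequality applies and no
  -- derivative in the Sobolev space itself is required.
  have h := hI.norm_image_sub_le_of_norm_hasDerivWithin_le (f := fun r => ∑ j ∈ J, b j * g r j)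
    (f' := fun r => ∑ j ∈ J, b j * g' r j) (C := M * finNorm (-σ) J b)
    (fun x hx => (HasDerivAt.fun_sum fun j _ => (hg x hx j).const_mul (b j)).hasDerivWithinAt)
    (fun x hx => by
      refine (norm_sum_mul_le σ J b _).trans ?_
      rw [mul_comm]
      gcongr
      · exact finNorm_nonneg _ _ _
      · exact finNorm_le hM (hg' x hx)) ht hr
  rw [Real.norm_eq_abs, mul_right_comm, ← Finset.sum_sub_distrib] at h
  simpa [mul_sub] using h

/-! ### Multiplication operators and transport operators as matrices -/

/-- The matrix of the multiplication by `a`. -/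
def mulMatrix (a : ℝ → ℂ) : ℤ → ℤ → ℂ := fun j k => coeff a (j - k)

/-- The matrix of `u ↦ c u' + c' u / 2`. -/
def transportMatrix (c : ℝ → ℂ) : ℤ → ℤ → ℂ := fun j k => Complex.I * (((j : ℂ) + k) / 2) * coeff c (j - k)

theorem coeff_mul {a f : ℝ → ℂ} (ha : Continuous a) (hf : ContDiff ℝ ∞ f)
    (hp : Function.Periodic f (2 * Real.pi)) : coeff (fun x => a x * f x) = mv (mulMatrix a) (coeff f) :=
  funext fun j => (hasSum_coeff_mul ha hf hp j).tsum_eq.symm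

theorem periodic_deriv {f : ℝ → ℂ} (hp : Function.Periodic f (2 * Real.pi)) :
    Function.Periodic (deriv f) (2 * Real.pi) :=
  SmoothFamily.deriv_periodic (E := Unit) (f := fun _ => f) (fun _ => hp) ()

theorem contDiff_deriv {f : ℝ → ℂ} (hf : ContDiff ℝ ∞ f) : ContDiff ℝ ∞ (deriv f) :=
  (SmoothFamily.of_contDiff (E := ℝ) hf).deriv.contDiff 0

/-- The term `c'/2` symmetrises the frequency: `k + (j - k)/2 = (j + k)/2`. This is why the
transport operator is exactly a Weyl operator. -/
theorem coeff_transport {c f : ℝ → ℂ} (hc : ContDiff ℝ ∞ c) (hcp : Function.Periodic c (2 * Real.pi))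
    (hf : ContDiff ℝ ∞ f) (hp : Function.Periodic f (2 * Real.pi)) :
    coeff (fun x => c x * deriv f x + deriv c x / 2 * f x) = mv (transportMatrix c) (coeff f) := by
  funext j
  have hc' := contDiff_deriv hc
  have hf' := contDiff_deriv hf
  have h1 := hasSum_coeff_mul hc.continuous hf' (periodic_deriv hp) j
  have h2 := hasSum_coeff_mul (a := fun x => deriv c x / 2) (hc'.continuous.div_const _) hf hp j
  rw [coeff_add (f := fun x => c x * deriv f x) (g := fun x => deriv c x / 2 * f x)
    (hc.continuous.mul hf'.continuous) ((hc'.continuous.div_const _).mul hf.continuous)]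
  refine ((h1.add h2).tsum_eq.symm.trans (tsum_congr fun k => ?_))
  have e : coeff (fun x => deriv c x / 2) (j - k) = Complex.I * (j - k) / 2 * coeff c (j - k) := by
    simp_rw [div_eq_inv_mul (deriv c _)]
    rw [coeff_const_mul, coeff_deriv hc hcp]
    push_cast; ring
  rw [e, coeff_deriv hf hp]
  unfold transportMatrix
  ring

section Bounds

variable {E : Type*} [NormedAddCommGroup E] [NormedSpace ℝ E]

theorem exists_bddOp_mulMatrix {a : E → ℝ → ℂ} (ha : SmoothFamily a)
    (hp : ∀ p, Function.Periodic (a p) (2 * Real.pi)) {K : Set E} (hK : IsCompact K) (s : ℝ) :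
    ∃ C : ℝ≥0, ∀ p ∈ K, BddOp s s C (mv (mulMatrix (a p))) := by
  choose C₀ _ hC₀ using fun M => ha.exists_coeff_bound hK M hp
  obtain ⟨C, hC⟩ := exists_bddOp_of_decay s 0 C₀
  refine ⟨C, fun p hpK => ?_⟩
  have := hC (mulMatrix (a p)) fun M j k => by
    simpa [mulMatrix] using hC₀ M p hpK (j - k)
  simpa using this

/-- In `(j + k)/2 = (j - k)/2 + k`, the factor in `j - k` is absorbed by one more power of
coefficient decay; the factor `⟨k⟩` is the loss of one derivative. -/
theorem exists_bddOp_transportMatrix {c : E → ℝ → ℂ} (hc : SmoothFamily c)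
    (hp : ∀ p, Function.Periodic (c p) (2 * Real.pi)) {K : Set E} (hK : IsCompact K) (s : ℝ) :
    ∃ C : ℝ≥0, ∀ p ∈ K, BddOp s (s - 1) C (mv (transportMatrix (c p))) := by
  choose C₀ hC0 hC₀ using fun M => hc.exists_coeff_bound hK M hp
  obtain ⟨C, hC⟩ := exists_bddOp_of_decay s 1 (fun M => 2 * C₀ (M + 1))
  refine ⟨C, fun p hpK => hC _ fun M j k => ?_⟩
  have h1 := hC₀ (M + 1) p hpK (j - k)
  have hk := one_le_bracket k
  have hjk := one_le_bracket (j - k)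
  have hb : ‖((j : ℂ) + k) / 2‖ ≤ 2 * bracket k * bracket (j - k) := by
    have e : ((j : ℂ) + k) / 2 = (((j - k : ℤ) : ℝ) / 2 + (k : ℝ) : ℝ) := by push_cast; ring
    rw [e, Complex.norm_real]
    refine (norm_add_le _ _).trans ?_
    rw [norm_div, Real.norm_two, Real.norm_eq_abs, Real.norm_eq_abs]
    have h2 := abs_le_bracket (j - k)
    have h3 := abs_le_bracket k
    nlinarith
  unfold transportMatrix
  rw [norm_mul, norm_mul, Complex.norm_I, one_mul, Real.rpow_one]
  calc ‖((j : ℂ) + k) / 2‖ * ‖coeff (c p) (j - k)‖ * bracket (j - k) ^ M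
      ≤ (2 * bracket k * bracket (j - k)) * ‖coeff (c p) (j - k)‖ * bracket (j - k) ^ M := by gcongr
    _ = 2 * bracket k * (‖coeff (c p) (j - k)‖ * bracket (j - k) ^ (M + 1)) := by ring
    _ ≤ 2 * bracket k * C₀ (M + 1) := by gcongr
    _ = _ := by ring

end Bounds

theorem sobolevNorm_dx_le (s : ℝ) (u : ℤ → ℂ) : sobolevNorm s (dx u) ≤ sobolevNorm (s + 1) u := by
  unfold sobolevNorm
  refine ENNReal.rpow_le_rpow (ENNReal.tsum_le_tsum fun k => ?_) (by norm_num)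
  have hb := bracket_pos k
  simp only [dx]
  rw [mul_add, Real.rpow_add hb, ENNReal.ofReal_mul (by positivity), mul_assoc (ENNReal.ofReal _)]
  refine mul_le_mul_right ?_ _
  rw [← ofReal_norm, ← ofReal_norm, ← ENNReal.ofReal_pow (norm_nonneg _),
    ← ENNReal.ofReal_pow (norm_nonneg _), ← ENNReal.ofReal_mul (by positivity)]
  apply ENNReal.ofReal_le_ofReal
  rw [norm_mul, norm_mul, Complex.norm_I, one_mul, Complex.norm_intCast, mul_pow, mul_one, Real.rpow_two]
  gcongr
  exact abs_le_bracket k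

/-- From `⟨k⟩ ≤ 1 + |k|`; taking absolute values of the coefficients first prevents cancellation in
the sum. -/
theorem sobolevNorm_add_one_le (s : ℝ) (u : ℤ → ℂ) :
    sobolevNorm (s + 1) u ≤ sobolevNorm s u + sobolevNorm s (dx u) := by
  have h : sobolevNorm (s + 1) u ≤ sobolevNorm s ((fun k => (‖u k‖ : ℂ)) + fun k => (‖dx u k‖ : ℂ)) := by
    unfold sobolevNorm
    refine ENNReal.rpow_le_rpow (ENNReal.tsum_le_tsum fun k => ?_) (by norm_num)
    have hb := bracket_pos k
    rw [mul_add, Real.rpow_add hb, ENNReal.ofReal_mul (by positivity), mul_assoc (ENNReal.ofReal _)]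
    refine mul_le_mul_right ?_ _
    rw [← ofReal_norm, ← ofReal_norm, ← ENNReal.ofReal_pow (norm_nonneg _),
      ← ENNReal.ofReal_pow (norm_nonneg _), ← ENNReal.ofReal_mul (by positivity)]
    apply ENNReal.ofReal_le_ofReal
    rw [mul_one, Real.rpow_two, ← mul_pow]
    gcongr
    simp only [Pi.add_apply]
    rw [← Complex.ofReal_add, Complex.norm_real, Real.norm_of_nonneg (by positivity)]
    simp only [dx]
    rw [norm_mul, norm_mul, Complex.norm_I, one_mul, Complex.norm_intCast]
    calc bracket k * ‖u k‖ ≤ (1 + |(k : ℝ)|) * ‖u k‖ := by gcongr; exact bracket_le k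
      _ = _ := by ring
  refine h.trans ((sobolevNorm_add_le _ _ _).trans ?_)
  exact add_le_add (sobolevNorm_mono_fun fun k => by simp) (sobolevNorm_mono_fun fun k => by simp)

/-! ### Half-density pull-backs by circle diffeomorphisms -/

/-- The pull-back `√ψ' · f ∘ ψ` of the half-density `f`. -/
def pullback (ψ : ℝ → ℝ) (f : ℝ → ℂ) : ℝ → ℂ := fun x => (Real.sqrt (deriv ψ x) : ℂ) * f (ψ x)

/-- The matrix of the half-density pull-back in the Fourier basis. -/
def pullbackMatrix (ψ : ℝ → ℝ) : ℤ → ℤ → ℂ := fun j k => coeff (pullback ψ (expMode k)) j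

/-- A smooth family of lifts of circle diffeomorphisms together with the inverse family. -/
structure DiffeoPair {E : Type*} [NormedAddCommGroup E] [NormedSpace ℝ E] (ψ φ : E → ℝ → ℝ) : Prop where
  smooth_left : SmoothFamily ψ
  smooth_right : SmoothFamily φ
  period_left : ∀ p x, ψ p (x + 2 * Real.pi) = ψ p x + 2 * Real.pi
  period_right : ∀ p x, φ p (x + 2 * Real.pi) = φ p x + 2 * Real.pi
  deriv_left_pos : ∀ p x, 0 < deriv (ψ p) x
  deriv_right_pos : ∀ p x, 0 < deriv (φ p) x
  left_inv : ∀ p x, φ p (ψ p x) = x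
  right_inv : ∀ p x, ψ p (φ p x) = x

namespace DiffeoPair

variable {E : Type*} [NormedAddCommGroup E] [NormedSpace ℝ E] {ψ φ : E → ℝ → ℝ}

theorem symm (h : DiffeoPair ψ φ) : DiffeoPair φ ψ :=
  ⟨h.smooth_right, h.smooth_left, h.period_right, h.period_left, h.deriv_right_pos, h.deriv_left_pos,
    h.right_inv, h.left_inv⟩

theorem deriv_left_periodic (h : DiffeoPair ψ φ) (p : E) :
    Function.Periodic (deriv (ψ p)) (2 * Real.pi) := fun x => by
  have : ψ p = fun y => ψ p (y + 2 * Real.pi) - 2 * Real.pi := funext fun y => by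
    rw [h.period_left]; ring
  conv_rhs => rw [this]
  rw [deriv_sub_const, deriv_comp_add_const]

theorem deriv_mul_deriv (h : DiffeoPair ψ φ) (p : E) (x : ℝ) :
    deriv (φ p) (ψ p x) * deriv (ψ p) x = 1 := by
  have h1 := (h.smooth_right.hasDerivAt p (ψ p x)).comp x (h.smooth_left.hasDerivAt p x)
  have h2 : φ p ∘ ψ p = id := funext (h.left_inv p)
  rw [h2] at h1
  exact h1.unique (hasDerivAt_id x)

theorem smooth_pullback (h : DiffeoPair ψ φ) {f : ℝ → ℂ} (hf : ContDiff ℝ ∞ f) :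
    SmoothFamily (fun p => pullback (ψ p) f) := by
  refine ContDiff.mul (Complex.ofRealCLM.contDiff.comp ?_) (hf.comp h.smooth_left)
  exact ContDiff.sqrt h.smooth_left.deriv fun q => (h.deriv_left_pos q.1 q.2).ne'

theorem contDiff_pullback (h : DiffeoPair ψ φ) (p : E) {f : ℝ → ℂ} (hf : ContDiff ℝ ∞ f) :
    ContDiff ℝ ∞ (pullback (ψ p) f) := (h.smooth_pullback hf).contDiff p

theorem pullback_periodic (h : DiffeoPair ψ φ) (p : E) {f : ℝ → ℂ}
    (hf : Function.Periodic f (2 * Real.pi)) : Function.Periodic (pullback (ψ p) f) (2 * Real.pi) :=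
  fun x => by
    unfold pullback
    rw [h.deriv_left_periodic p x, h.period_left, hf]

theorem continuous_sqrt (h : DiffeoPair ψ φ) (p : E) :
    Continuous fun x => (Real.sqrt (deriv (ψ p) x) : ℂ) :=
  Complex.continuous_ofReal.comp (Real.continuous_sqrt.comp (h.smooth_left.deriv.contDiff p).continuous)

theorem coeff_pullback (h : DiffeoPair ψ φ) (p : E) {f : ℝ → ℂ} (hf : ContDiff ℝ ∞ f)
    (hp : Function.Periodic f (2 * Real.pi)) :
    coeff (pullback (ψ p) f) = mv (pullbackMatrix (ψ p)) (coeff f) :=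
  funext fun j => ((hasSum_coeff_mul_comp hf hp (h.continuous_sqrt p)
    (h.smooth_left.contDiff p).continuous j).tsum_eq).symm

theorem pullback_pullback (h : DiffeoPair ψ φ) (p : E) (f : ℝ → ℂ) :
    pullback (φ p) (pullback (ψ p) f) = f := by
  funext x
  unfold pullback
  rw [h.right_inv, ← mul_assoc, ← Complex.ofReal_mul, ← Real.sqrt_mul (h.deriv_right_pos p x).le]
  have := h.symm.deriv_mul_deriv p x
  rw [mul_comm (deriv (φ p) x), this]
  simp

/-- The substitution `y = ψ(x)` sends a period to an interval of length `2π`, over which a periodic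
function has the same integral. -/
theorem integral_deriv_smul_comp (h : DiffeoPair ψ φ) (p : E) {F : Type*} [NormedAddCommGroup F]
    [NormedSpace ℝ F] [CompleteSpace F] {g : ℝ → F} (hg : Continuous g) (hp : Function.Periodic g (2 * Real.pi)) :
    ∫ x in (0 : ℝ)..2 * Real.pi, deriv (ψ p) x • g (ψ p x) = ∫ x in (0 : ℝ)..2 * Real.pi, g x := by
  have h1 := intervalIntegral.integral_deriv_smul_comp (a := 0) (b := 2 * Real.pi) (g := g)
    (fun x _ => h.smooth_left.hasDerivAt p x)
    (h.smooth_left.deriv.contDiff p).continuous.continuousOn hg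
  have h2 := h.period_left p 0
  rw [zero_add] at h2
  have h3 := hp.intervalIntegral_add_eq (ψ p 0) 0
  rw [h2, h3, zero_add] at h1
  exact h1

theorem integral_norm_pullback (h : DiffeoPair ψ φ) (p : E) {f : ℝ → ℂ} (hf : Continuous f)
    (hp : Function.Periodic f (2 * Real.pi)) :
    ∫ x in (0 : ℝ)..2 * Real.pi, ‖pullback (ψ p) f x‖ ^ 2 = ∫ x in (0 : ℝ)..2 * Real.pi, ‖f x‖ ^ 2 := by
  rw [← h.integral_deriv_smul_comp p (g := fun x => ‖f x‖ ^ 2) (by fun_prop) (fun x => by simp only [hp x])]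
  congr 1
  funext x
  rw [pullback, norm_mul, Complex.norm_real, Real.norm_of_nonneg (Real.sqrt_nonneg _), mul_pow,
    Real.sq_sqrt (h.deriv_left_pos p x).le, smul_eq_mul]

theorem conj_expMode (k : ℤ) (x : ℝ) : starRingEnd ℂ (expMode k x) = expMode (-k) x := by
  unfold expMode
  rw [← Complex.exp_conj]
  simp

/-- Unitarity: substituting `y = ψ(x)` in the coefficient integral shows that the adjoint of the
pull-back is the pull-back by the inverse map. -/
theorem pullbackMatrix_conj (h : DiffeoPair ψ φ) (p : E) (j k : ℤ) :
    pullbackMatrix (φ p) j k = starRingEnd ℂ (pullbackMatrix (ψ p) k j) := by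
  have he : ∀ k, Continuous (expMode k) := fun k => (contDiff_expMode k).continuous
  unfold pullbackMatrix
  rw [coeff_eq, coeff_eq, map_mul, ← intervalIntegral.intervalIntegral_conj]
  have hc : starRingEnd ℂ ((2 * Real.pi : ℂ)⁻¹) = (2 * Real.pi : ℂ)⁻¹ := by
    rw [map_inv₀, map_mul, Complex.conj_ofReal, map_ofNat]
  rw [hc, ← h.integral_deriv_smul_comp p
    (g := fun x => expMode (-j) x * pullback (φ p) (expMode k) x)
    ((he _).mul (h.symm.contDiff_pullback p (contDiff_expMode k)).continuous)
    ((expMode_periodic _).mul (h.symm.pullback_periodic p (expMode_periodic k)))]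
  congr 2
  funext x
  have h1 := h.deriv_mul_deriv p x
  have hpos := h.deriv_left_pos p x
  simp only [pullback, map_mul, conj_expMode, Complex.conj_ofReal, neg_neg, h.left_inv, Complex.real_smul]
  have h2 : deriv (ψ p) x * Real.sqrt (deriv (φ p) (ψ p x)) = Real.sqrt (deriv (ψ p) x) := by
    rw [eq_div_of_mul_eq hpos.ne' h1, one_div, Real.sqrt_inv, ← div_eq_mul_inv, div_eq_iff
      (Real.sqrt_pos.mpr hpos).ne', Real.mul_self_sqrt hpos.le]
  rw [← h2]
  push_cast
  ring

theorem deriv_pullback (h : DiffeoPair ψ φ) (p : E) {f : ℝ → ℂ} (hf : ContDiff ℝ ∞ f) (x : ℝ) :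
    deriv (pullback (ψ p) f) x = ((deriv (ψ p) x : ℝ) : ℂ) * pullback (ψ p) (deriv f) x +
      ((deriv (deriv (ψ p)) x / (2 * deriv (ψ p) x) : ℝ) : ℂ) * pullback (ψ p) f x := by
  have hpos := h.deriv_left_pos p x
  have h1 : HasDerivAt (fun y => Real.sqrt (deriv (ψ p) y)) _ x :=
    (h.smooth_left.deriv.hasDerivAt p x).sqrt hpos.ne'
  have h2 := ((hf.differentiable (by simp) (ψ p x)).hasDerivAt).scomp x (h.smooth_left.hasDerivAt p x)
  have h3 := (h1.ofReal_comp.mul h2).deriv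
  refine Eq.trans ?_ (h3.trans ?_)
  · rfl
  · simp only [pullback, Function.comp, Complex.real_smul]
    have hs : (Real.sqrt (deriv (ψ p) x) : ℂ) ≠ 0 := by
      exact_mod_cast (Real.sqrt_pos.mpr hpos).ne'
    have hsq : ((deriv (ψ p) x : ℝ) : ℂ) = (Real.sqrt (deriv (ψ p) x) : ℂ) ^ 2 := by
      rw [← Complex.ofReal_pow, Real.sq_sqrt hpos.le]
    push_cast
    generalize (Real.sqrt (deriv (ψ p) x) : ℂ) = q at *
    rw [hsq]
    field_simp
    ring

/-- At order zero the pull-back is an isometry of `L²`. Differentiating it gives pull-backs of `f'`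
and `f` with smooth coefficients, so each further order follows from the preceding one, applied to
both `f` and `f'`. -/
theorem exists_bound_pullback (h : DiffeoPair ψ φ) {K : Set E} (hK : IsCompact K) (n : ℕ) :
    ∃ C : ℝ≥0, ∀ p ∈ K, ∀ f : ℝ → ℂ, ContDiff ℝ ∞ f → Function.Periodic f (2 * Real.pi) →
      sobolevNorm n (coeff (pullback (ψ p) f)) ≤ C * sobolevNorm n (coeff f) := by
  induction n with
  | zero =>
    refine ⟨1, fun p _ f hf hp => ?_⟩
    have key : ∀ g : ℝ → ℂ, Continuous g → sobolevNorm (0 : ℕ) (coeff g) ^ 2 =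
        ENNReal.ofReal ((2 * Real.pi)⁻¹ * ∫ x in (0 : ℝ)..2 * Real.pi, ‖g x‖ ^ 2) := fun g hg => by
      have h1 := tsum_sq_norm_coeff hg
      rw [sobolevNorm_sq, ← h1.tsum_eq, ENNReal.ofReal_tsum_of_nonneg (fun _ => sq_nonneg _) h1.summable]
      refine tsum_congr fun k => ?_
      rw [ENNReal.ofReal_pow (norm_nonneg _), ofReal_norm]
      simp
    rw [ENNReal.coe_one, one_mul, ← ENNReal.pow_le_pow_left_iff two_ne_zero,
      key _ (h.contDiff_pullback p hf).continuous, key _ hf.continuous,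
      h.integral_norm_pullback p hf.continuous hp]
  | succ n ih =>
    obtain ⟨C, hC⟩ := ih
    have ha : SmoothFamily (fun p x => ((deriv (ψ p) x : ℝ) : ℂ)) :=
      Complex.ofRealCLM.contDiff.comp h.smooth_left.deriv
    have hb : SmoothFamily (fun p x => ((deriv (deriv (ψ p)) x / (2 * deriv (ψ p) x) : ℝ) : ℂ)) := by
      refine Complex.ofRealCLM.contDiff.comp ?_
      exact ContDiff.div h.smooth_left.deriv.deriv (contDiff_const.mul h.smooth_left.deriv)
        fun q => (mul_pos two_pos (h.deriv_left_pos q.1 q.2)).ne'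
    have hap : ∀ p, Function.Periodic (fun x => ((deriv (ψ p) x : ℝ) : ℂ)) (2 * Real.pi) := fun p x => by
      simp only [h.deriv_left_periodic p x]
    have hbp : ∀ p, Function.Periodic
        (fun x => ((deriv (deriv (ψ p)) x / (2 * deriv (ψ p) x) : ℝ) : ℂ)) (2 * Real.pi) := fun p x => by
      simp only [h.deriv_left_periodic p x, SmoothFamily.deriv_periodic h.deriv_left_periodic p x]
    obtain ⟨A, hA⟩ := exists_bddOp_mulMatrix ha hap hK n
    obtain ⟨B, hB⟩ := exists_bddOp_mulMatrix hb hbp hK n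
    refine ⟨C + (A * C + B * C), fun p hpK f hf hp => ?_⟩
    have hf' := contDiff_deriv hf
    have hp' := periodic_deriv hp
    have hd : dx (coeff (pullback (ψ p) f)) =
        mv (mulMatrix fun x => ((deriv (ψ p) x : ℝ) : ℂ)) (coeff (pullback (ψ p) (deriv f))) +
        mv (mulMatrix fun x => ((deriv (deriv (ψ p)) x / (2 * deriv (ψ p) x) : ℝ) : ℂ))
          (coeff (pullback (ψ p) f)) := by
      rw [← coeff_mul (ha.contDiff p).continuous (h.contDiff_pullback p hf') (h.pullback_periodic p hp'),
        ← coeff_mul (hb.contDiff p).continuous (h.contDiff_pullback p hf) (h.pullback_periodic p hp)]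
      funext j
      rw [Pi.add_apply, ← coeff_add (f := fun x => ((deriv (ψ p) x : ℝ) : ℂ) * pullback (ψ p) (deriv f) x)
        (g := fun x => ((deriv (deriv (ψ p)) x / (2 * deriv (ψ p) x) : ℝ) : ℂ) * pullback (ψ p) f x)
        ((ha.contDiff p).continuous.mul (h.contDiff_pullback p hf').continuous)
        ((hb.contDiff p).continuous.mul (h.contDiff_pullback p hf).continuous)]
      simp_rw [← h.deriv_pullback p hf]
      exact (coeff_deriv (h.contDiff_pullback p hf) (h.pullback_periodic p hp) j).symm
    have hdf : coeff (deriv f) = dx (coeff f) := funext fun j => coeff_deriv hf hp j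
    have hn1 : sobolevNorm n (coeff f) ≤ sobolevNorm (n + 1) (coeff f) := sobolevNorm_mono (by linarith) _
    have hn2 : sobolevNorm n (coeff (deriv f)) ≤ sobolevNorm (n + 1) (coeff f) :=
      hdf ▸ sobolevNorm_dx_le n _
    push_cast
    refine (sobolevNorm_add_one_le _ _).trans ?_
    rw [add_mul, add_mul, hd]
    refine add_le_add ((hC p hpK f hf hp).trans (by gcongr))
      ((sobolevNorm_add_le _ _ _).trans (add_le_add ?_ ?_))
    · refine ((hA p hpK).bound _ (memSobolev_coeff (h.contDiff_pullback p hf') (h.pullback_periodic p hp') _)).trans ?_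
      rw [mul_assoc]
      gcongr
      exact (hC p hpK _ hf' hp').trans (by gcongr)
    · refine ((hB p hpK).bound _ (memSobolev_coeff (h.contDiff_pullback p hf) (h.pullback_periodic p hp) _)).trans ?_
      rw [mul_assoc]
      gcongr
      exact (hC p hpK _ hf hp).trans (by gcongr)

/-- Finitely supported sequences come from trigonometric polynomials, so matrix bounds reduce to
estimates for smooth functions. -/
theorem exists_trigPoly (J : Finset ℤ) {u : ℤ → ℂ} (hu : ∀ k ∉ J, u k = 0) :
    ∃ f : ℝ → ℂ, ContDiff ℝ ∞ f ∧ Function.Periodic f (2 * Real.pi) ∧ coeff f = u := by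
  classical
  have key : ∀ J : Finset ℤ, ∃ f : ℝ → ℂ, ContDiff ℝ ∞ f ∧ Function.Periodic f (2 * Real.pi) ∧
      coeff f = trunc J u := by
    intro J
    induction J using Finset.induction_on with
    | empty => 
      refine ⟨fun _ => 0, contDiff_const, fun _ => rfl, ?_⟩
      funext k; rw [coeff_eq]; simp [trunc]
    | insert a J ha ih =>
      obtain ⟨f, hf, hp, hc⟩ := ih
      refine ⟨fun x => u a * expMode a x + f x, (contDiff_const.mul (contDiff_expMode a)).add hf,
        fun x => by simp only [hp x, expMode_periodic a x], ?_⟩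
      funext k
      rw [coeff_add (f := fun x => u a * expMode a x) (continuous_const.mul (contDiff_expMode a).continuous) hf.continuous,
        coeff_const_mul, hc, coeff_expMode, trunc_eq_sum, trunc_eq_sum, Finset.sum_insert ha]
      simp
  obtain ⟨f, hf, hp, hc⟩ := key J
  refine ⟨f, hf, hp, hc.trans (funext fun k => ?_)⟩
  unfold trunc
  split_ifs with h
  · rfl
  · exact (hu k h).symm

theorem exists_bddOp_nat (h : DiffeoPair ψ φ) {K : Set E} (hK : IsCompact K) (n : ℕ) :
    ∃ C : ℝ≥0, ∀ p ∈ K, BddOp n n C (mv (pullbackMatrix (ψ p))) := by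
  obtain ⟨C, hC⟩ := h.exists_bound_pullback hK n
  refine ⟨C, fun p hp => bddOp_mv fun J u hu => ?_⟩
  obtain ⟨f, hf, hfp, rfl⟩ := exists_trigPoly J hu
  rw [← h.coeff_pullback p hf hfp]
  exact hC p hp f hf hfp

theorem exists_bddOp_of_nonneg (h : DiffeoPair ψ φ) {K : Set E} (hK : IsCompact K) {s : ℝ} (hs : 0 ≤ s) :
    ∃ C : ℝ≥0, ∀ p ∈ K, BddOp s s C (mv (pullbackMatrix (ψ p))) := by
  obtain ⟨n, hn⟩ := exists_nat_gt s
  obtain ⟨C, hC⟩ := h.exists_bddOp_nat hK n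
  obtain ⟨D, hD⟩ := h.exists_bddOp_nat hK 0
  refine ⟨max C D, fun p hp => BddOp.interp hs hn.le (hs.trans_lt hn) ?_ ((hC p hp).mono (le_max_left _ _))⟩
  simpa using (hD p hp).mono (le_max_right C D)

/-- Half-density pull-backs are bounded on every Sobolev space, locally uniformly in the parameter. -/
theorem exists_bddOp (h : DiffeoPair ψ φ) {K : Set E} (hK : IsCompact K) (s : ℝ) :
    ∃ C : ℝ≥0, ∀ p ∈ K, BddOp s s C (mv (pullbackMatrix (ψ p))) := by
  rcases le_total 0 s with hs | hs
  · exact h.exists_bddOp_of_nonneg hK hs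
  · obtain ⟨C, hC⟩ := h.symm.exists_bddOp_of_nonneg hK (neg_nonneg.mpr hs)
    refine ⟨C, fun p hp => ?_⟩
    have := (hC p hp).dual (A := pullbackMatrix (ψ p)) (h.symm.pullbackMatrix_conj p)
    simpa using this

theorem mv_mv (h : DiffeoPair ψ φ) (p : E) {s : ℝ} {u : ℤ → ℂ} (hu : MemSobolev s u) :
    mv (pullbackMatrix (φ p)) (mv (pullbackMatrix (ψ p)) u) = u := by
  obtain ⟨C, hC⟩ := h.exists_bddOp (isCompact_singleton (x := p)) s
  obtain ⟨D, hD⟩ := h.symm.exists_bddOp (isCompact_singleton (x := p)) s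
  refine ((hD p rfl).comp (hC p rfl)).ext (BddOp.id s) (fun k => ?_) hu
  rw [← coeff_expMode, ← h.coeff_pullback p (contDiff_expMode k) (expMode_periodic k),
    ← h.symm.coeff_pullback p (h.contDiff_pullback p (contDiff_expMode k))
      (h.pullback_periodic p (expMode_periodic k)), h.pullback_pullback]

theorem mv_mem (h : DiffeoPair ψ φ) (p : E) {u : ℤ → ℂ} (hu : u ∈ PeriodicDistribution) :
    mv (pullbackMatrix (ψ p)) u ∈ PeriodicDistribution := by
  obtain ⟨s, hs⟩ := exists_memSobolev_of_mem hu
  obtain ⟨C, hC⟩ := h.exists_bddOp (isCompact_singleton (x := p)) s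
  exact mem_of_memSobolev ((hC p rfl).mem hs)

/-- The half-density pull-back as a linear bijection of periodic distributions. -/
def equiv (h : DiffeoPair ψ φ) (p : E) : PeriodicDistribution ≃ₗ[ℂ] PeriodicDistribution where
  toFun u := ⟨mv (pullbackMatrix (ψ p)) u, h.mv_mem p u.2⟩
  invFun u := ⟨mv (pullbackMatrix (φ p)) u, h.symm.mv_mem p u.2⟩
  map_add' u v := by
    obtain ⟨s, hs⟩ := exists_memSobolev_of_mem u.2
    obtain ⟨s', hs'⟩ := exists_memSobolev_of_mem v.2
    obtain ⟨C, hC⟩ := h.exists_bddOp (isCompact_singleton (x := p)) (min s s')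
    exact Subtype.ext ((hC p rfl).add _ _ (hs.mono (min_le_left _ _)) (hs'.mono (min_le_right _ _)))
  map_smul' c u := by
    obtain ⟨s, hs⟩ := exists_memSobolev_of_mem u.2
    obtain ⟨C, hC⟩ := h.exists_bddOp (isCompact_singleton (x := p)) s
    exact Subtype.ext ((hC p rfl).smul _ _ hs)
  left_inv u := by
    obtain ⟨s, hs⟩ := exists_memSobolev_of_mem u.2
    exact Subtype.ext (h.mv_mv p hs)
  right_inv u := by
    obtain ⟨s, hs⟩ := exists_memSobolev_of_mem u.2
    exact Subtype.ext (h.symm.mv_mv p hs)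

end DiffeoPair

/-! ### Time derivatives of Fourier coefficients -/

theorem SmoothFamily.continuous_apply {E F : Type*} [NormedAddCommGroup E] [NormedSpace ℝ E]
    [NormedAddCommGroup F] [NormedSpace ℝ F] {f : E → ℝ → F} (hf : SmoothFamily f) (p : E) :
    Continuous (f p) := (hf.contDiff p).continuous

theorem SmoothFamily.hasDerivAt_coeff {G : ℝ → ℝ → ℂ} (hG : SmoothFamily G) (t : ℝ) (j : ℤ) :
    HasDerivAt (fun r => coeff (G r) j) (coeff (fun x => _root_.deriv (fun r => G r x) t) j) t := by
  have he : Continuous (expMode (-j)) := (contDiff_expMode (-j)).continuous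
  obtain ⟨C, -, hC⟩ := hG.deriv_fst.exists_bound (isCompact_closedBall t 1)
  have h := intervalIntegral.hasDerivAt_integral_of_dominated_loc_of_deriv_le (μ := volume) (a := 0)
    (b := 2 * Real.pi) (F := fun r x => expMode (-j) x * G r x)
    (F' := fun r x => expMode (-j) x * _root_.deriv (fun r => G r x) r) (x₀ := t)
    (bound := fun _ => C) (Metric.ball_mem_nhds t one_pos)
    (Eventually.of_forall fun r => (he.mul (hG.continuous_apply r)).aestronglyMeasurable)
    ((he.mul (hG.continuous_apply t)).intervalIntegrable _ _)
    (he.mul (hG.deriv_fst.continuous_apply t)).aestronglyMeasurable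
    (Eventually.of_forall fun x hx r hr => by
      rw [norm_mul, norm_expMode, one_mul]
      rw [Set.uIoc_of_le Real.two_pi_pos.le] at hx
      exact hC r (Metric.ball_subset_closedBall hr) x ⟨hx.1.le, hx.2⟩)
    intervalIntegrable_const
    (Eventually.of_forall fun x _ r _ => (hG.hasDerivAt_fst r x).const_mul _)
  simp_rw [coeff_eq]
  exact h.2.const_mul _

theorem SmoothFamily.deriv_fst_periodic {G : ℝ → ℝ → ℂ} (hp : ∀ t, Function.Periodic (G t) (2 * Real.pi))
    (t : ℝ) : Function.Periodic (fun x => _root_.deriv (fun r => G r x) t) (2 * Real.pi) := fun x => by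
  simp only [fun r => hp r x]

theorem SmoothFamily.exists_sobolevNorm_coeff_le {G : ℝ → ℝ → ℂ} (hG : SmoothFamily G)
    (hp : ∀ t, Function.Periodic (G t) (2 * Real.pi)) (σ : ℝ) {K : Set ℝ} (hK : IsCompact K) :
    ∃ M : ℝ, 0 ≤ M ∧ ∀ t ∈ K, sobolevNorm σ (coeff (G t)) ≤ ENNReal.ofReal M := by
  obtain ⟨n, hn⟩ := exists_nat_ge (σ + 1)
  obtain ⟨C, hC0, hC⟩ := hG.exists_coeff_bound hK n hp
  refine ⟨C * bracketConst.toReal, by positivity, fun t ht => ?_⟩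
  rw [ENNReal.ofReal_mul hC0, ENNReal.ofReal_toReal bracketConst_lt_top.ne]
  exact sobolevNorm_le_of_bound hn hC0 (hC t ht)

theorem SmoothFamily.exists_coeff_lipschitz {G : ℝ → ℝ → ℂ} (hG : SmoothFamily G)
    (hp : ∀ t, Function.Periodic (G t) (2 * Real.pi)) (σ t : ℝ) :
    ∃ M : ℝ, 0 ≤ M ∧ ∀ r ∈ Set.Icc (t - 1) (t + 1),
      sobolevNorm σ (coeff (G r) - coeff (G t)) ≤ ENNReal.ofReal (M * |r - t|) := by
  obtain ⟨M, hM0, hM⟩ := hG.deriv_fst.exists_sobolevNorm_coeff_le (SmoothFamily.deriv_fst_periodic hp) σ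
    (isCompact_Icc (a := t - 1) (b := t + 1))
  exact ⟨M, hM0, fun r hr => sobolevNorm_sub_le_of_hasDerivAt (convex_Icc _ _) hM0
    (fun r _ j => hG.hasDerivAt_coeff r j) hM ⟨by linarith, by linarith⟩ hr⟩

/-- Mean value inequality for the curve minus its linear part, whose derivative is `O(|r - t|)`
because the time derivative of the family is Lipschitz. -/
theorem SmoothFamily.exists_coeff_taylor {G : ℝ → ℝ → ℂ} (hG : SmoothFamily G)
    (hp : ∀ t, Function.Periodic (G t) (2 * Real.pi)) (σ t : ℝ) :
    ∃ M : ℝ, 0 ≤ M ∧ ∀ r ∈ Set.Icc (t - 1) (t + 1),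
      sobolevNorm σ (coeff (G r) - coeff (G t) -
        ((r - t : ℝ) : ℂ) • coeff (fun x => _root_.deriv (fun r => G r x) t)) ≤
        ENNReal.ofReal (M * |r - t| * |r - t|) := by
  obtain ⟨M, hM0, hM⟩ := hG.deriv_fst.exists_coeff_lipschitz (SmoothFamily.deriv_fst_periodic hp) σ t
  refine ⟨M, hM0, fun r hr => ?_⟩
  set d := coeff (fun x => _root_.deriv (fun r => G r x) t)
  have hsub : Set.uIcc t r ⊆ Set.Icc (t - 1) (t + 1) :=
    Set.uIcc_subset_Icc ⟨by linarith, by linarith⟩ hr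
  have key := sobolevNorm_sub_le_of_hasDerivAt (σ := σ) (M := M * |r - t|) (convex_uIcc t r)
    (g := fun ρ j => coeff (G ρ) j - ((ρ - t : ℝ) : ℂ) * d j)
    (g' := fun ρ => coeff (fun x => _root_.deriv (fun r => G r x) ρ) - d) (by positivity)
    (fun ρ _ j => by
      have h2 : HasDerivAt (fun ρ : ℝ => ((ρ - t : ℝ) : ℂ) * d j) (d j) ρ := by
        simpa using (((hasDerivAt_id ρ).sub_const t).ofReal_comp).mul_const (d j)
      exact (hG.hasDerivAt_coeff ρ j).sub h2)
    (fun ρ hρ => by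
      refine (hM ρ (hsub hρ)).trans ?_
      gcongr ENNReal.ofReal (M * ?_)
      exact Set.abs_sub_left_of_mem_uIcc hρ)
    Set.left_mem_uIcc Set.right_mem_uIcc
  refine le_of_eq_of_le ?_ key
  congr 1
  funext j
  simp
  ring

/-! ### Conjugation of transport equations -/

/-- The complexification of a real-valued function. -/
def cplx (f : ℝ → ℝ) : ℝ → ℂ := fun x => (f x : ℂ)

theorem SmoothFamily.cplx {E : Type*} [NormedAddCommGroup E] [NormedSpace ℝ E] {f : E → ℝ → ℝ}
    (hf : SmoothFamily f) : SmoothFamily (fun p => cplx (f p)) :=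
  Complex.ofRealCLM.contDiff.comp hf

theorem deriv_cplx {f : ℝ → ℝ} {x : ℝ} (hf : DifferentiableAt ℝ f x) :
    deriv (cplx f) x = (deriv f x : ℝ) := hf.hasDerivAt.ofReal_comp.deriv

theorem periodic_cplx {f : ℝ → ℝ} {T : ℝ} (hf : Function.Periodic f T) :
    Function.Periodic (cplx f) T := fun x => by simp [cplx, hf x]

/-- The operator `u ↦ c u' + c' u / 2`. -/
def transportFun (c : ℝ → ℂ) (f : ℝ → ℂ) : ℝ → ℂ := fun x => c x * deriv f x + deriv c x / 2 * f x

/-- The commutator type expression giving the time derivative of a half-density pull-back. -/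
def pullbackDeriv (ψ b c : ℝ → ℝ) (u : ℤ → ℂ) : ℤ → ℂ :=
  mv (transportMatrix (cplx b)) (mv (pullbackMatrix ψ) u) -
    mv (pullbackMatrix ψ) (mv (transportMatrix (cplx c)) u)

section Conjugation

variable {ψ φ b c : ℝ → ℝ → ℝ}

/-- The infinitesimal form of the conjugation: `∂_t Φ = B Φ - Φ C`, where `B` and `C` are the
transport operators with velocities `b` and `c`. -/
theorem DiffeoPair.deriv_fst_pullback (h : DiffeoPair ψ φ) (hb : SmoothFamily b) (hc : SmoothFamily c)
    (hbc : ∀ t x, c t (ψ t x) = b t x * deriv (ψ t) x - deriv (fun r => ψ r x) t)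
    {f : ℝ → ℂ} (hf : ContDiff ℝ ∞ f) (t x : ℝ) :
    deriv (fun r => pullback (ψ r) f x) t = transportFun (cplx (b t)) (pullback (ψ t) f) x -
      pullback (ψ t) (transportFun (cplx (c t)) f) x := by
  have hpos := h.deriv_left_pos t x
  have h1 : HasDerivAt (fun r => Real.sqrt (deriv (ψ r) x)) _ t :=
    (h.smooth_left.deriv.hasDerivAt_fst t x).sqrt hpos.ne'
  have h2 := ((hf.differentiable (by simp) (ψ t x)).hasDerivAt).scomp t (h.smooth_left.hasDerivAt_fst t x)
  have h3 := (h1.ofReal_comp.mul h2).deriv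
  -- The velocity relation differentiated in `x`; it supplies the zeroth-order term `c'/2`.
  have h4 : deriv (c t) (ψ t x) * deriv (ψ t) x =
      deriv (b t) x * deriv (ψ t) x + b t x * deriv (deriv (ψ t)) x -
        deriv (fun r => deriv (ψ r) x) t := by
    have e1 := (hc.hasDerivAt t (ψ t x)).comp x (h.smooth_left.hasDerivAt t x)
    have e2 := ((hb.hasDerivAt t x).mul (h.smooth_left.deriv.hasDerivAt t x)).sub
      (h.smooth_left.deriv_fst.hasDerivAt t x)
    rw [h.smooth_left.deriv_comm]
    exact e1.unique (e2.congr_of_eventuallyEq (Eventually.of_forall fun y => hbc t y))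
  refine Eq.trans ?_ (h3.trans ?_)
  · rfl
  · unfold transportFun
    rw [h.deriv_pullback t hf, deriv_cplx ((hb.hasDerivAt t x).differentiableAt)]
    simp only [pullback, Function.comp, Complex.real_smul]
    rw [deriv_cplx ((hc.hasDerivAt t (ψ t x)).differentiableAt)]
    simp only [cplx]
    rw [hbc t x, eq_div_of_mul_eq hpos.ne' h4]
    have hs : (Real.sqrt (deriv (ψ t) x) : ℂ) ≠ 0 := by
      exact_mod_cast (Real.sqrt_pos.mpr hpos).ne'
    have hsq : ((deriv (ψ t) x : ℝ) : ℂ) = (Real.sqrt (deriv (ψ t) x) : ℂ) ^ 2 := by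
      rw [← Complex.ofReal_pow, Real.sq_sqrt hpos.le]
    push_cast
    generalize (Real.sqrt (deriv (ψ t) x) : ℂ) = q at *
    rw [hsq]
    field_simp
    ring

theorem periodic_transportFun {c f : ℝ → ℂ} (hc : Function.Periodic c (2 * Real.pi))
    (hf : Function.Periodic f (2 * Real.pi)) : Function.Periodic (transportFun c f) (2 * Real.pi) :=
  fun x => by simp only [transportFun, hc x, hf x, periodic_deriv hc x, periodic_deriv hf x]

theorem contDiff_transportFun {c f : ℝ → ℂ} (hc : ContDiff ℝ ∞ c) (hf : ContDiff ℝ ∞ f) :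
    ContDiff ℝ ∞ (transportFun c f) :=
  (hc.mul (contDiff_deriv hf)).add (((contDiff_deriv hc).div_const 2).mul hf)

theorem DiffeoPair.coeff_deriv_fst_pullback (h : DiffeoPair ψ φ) (hb : SmoothFamily b) (hc : SmoothFamily c)
    (hbp : ∀ t, Function.Periodic (b t) (2 * Real.pi)) (hcp : ∀ t, Function.Periodic (c t) (2 * Real.pi))
    (hbc : ∀ t x, c t (ψ t x) = b t x * deriv (ψ t) x - deriv (fun r => ψ r x) t)
    {f : ℝ → ℂ} (hf : ContDiff ℝ ∞ f) (hp : Function.Periodic f (2 * Real.pi)) (t : ℝ) :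
    coeff (fun x => deriv (fun r => pullback (ψ r) f x) t) = pullbackDeriv (ψ t) (b t) (c t) (coeff f) := by
  have hb' := hb.cplx.contDiff t
  have hc' := hc.cplx.contDiff t
  have hbp' := periodic_cplx (hbp t)
  have hcp' := periodic_cplx (hcp t)
  have hcf := contDiff_transportFun hc' hf
  have hcfp := periodic_transportFun hcp' hp
  unfold pullbackDeriv
  rw [← coeff_transport hc' hcp' hf hp, ← h.coeff_pullback t hf hp,
    ← coeff_transport hb' hbp' (h.contDiff_pullback t hf) (h.pullback_periodic t hp)]
  change _ = coeff (transportFun _ _) - mv _ (coeff (transportFun _ _))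
  rw [← h.coeff_pullback t hcf hcfp]
  simp_rw [h.deriv_fst_pullback hb hc hbc hf]
  funext j
  simp_rw [sub_eq_add_neg, Pi.add_apply, Pi.neg_apply]
  rw [coeff_add (g := fun x => -pullback (ψ t) (transportFun (cplx (c t)) f) x)
    (contDiff_transportFun hb' (h.contDiff_pullback t hf)).continuous
    (h.contDiff_pullback t hcf).continuous.neg]
  congr 1
  have := coeff_const_mul (-1) (pullback (ψ t) (transportFun (cplx (c t)) f)) j
  simpa using this

theorem DiffeoPair.exists_bddOp_pullbackDeriv (h : DiffeoPair ψ φ) (hb : SmoothFamily b)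
    (hc : SmoothFamily c) (hbp : ∀ t, Function.Periodic (b t) (2 * Real.pi))
    (hcp : ∀ t, Function.Periodic (c t) (2 * Real.pi)) {K : Set ℝ} (hK : IsCompact K) (s : ℝ) :
    ∃ C : ℝ≥0, ∀ t ∈ K, BddOp s (s - 1) C (pullbackDeriv (ψ t) (b t) (c t)) := by
  obtain ⟨A, hA⟩ := h.exists_bddOp hK s
  obtain ⟨A', hA'⟩ := h.exists_bddOp hK (s - 1)
  obtain ⟨B, hB⟩ := exists_bddOp_transportMatrix hb.cplx (fun t => periodic_cplx (hbp t)) hK s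
  obtain ⟨D, hD⟩ := exists_bddOp_transportMatrix hc.cplx (fun t => periodic_cplx (hcp t)) hK s
  exact ⟨B * A + A' * D, fun t ht => ((hB t ht).comp (hA t ht)).sub ((hA' t ht).comp (hD t ht))⟩

/-- Once some bound is known, density of finitely supported sequences allows a better constant to be
tested on them alone. -/
theorem BddOp.of_trunc {s s' : ℝ} {C D : ℝ≥0} {T : (ℤ → ℂ) → (ℤ → ℂ)} (hT : BddOp s s' D T)
    (h : ∀ (J : Finset ℤ) (u : ℤ → ℂ), (∀ k ∉ J, u k = 0) → sobolevNorm s' (T u) ≤ C * sobolevNorm s u) :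
    BddOp s s' C T := by
  refine ⟨hT.add, hT.smul, fun u hu => ?_⟩
  have hlim := (hT.apply_trunc_tendsto hu).add_const (C * sobolevNorm s u)
  rw [zero_add] at hlim
  refine ge_of_tendsto' hlim fun J => ?_
  have e : T u = (T u - T (trunc J u)) + T (trunc J u) := by abel
  conv_lhs => rw [e]
  refine (sobolevNorm_add_le _ _ _).trans (add_le_add le_rfl
    ((h J _ fun k hk => by simp [trunc, hk]).trans ?_))
  gcongr
  exact sobolevNorm_trunc_le s J u

theorem BddOp.const_smul {s s' : ℝ} {D : ℝ≥0} {T : (ℤ → ℂ) → (ℤ → ℂ)} (hT : BddOp s s' D T) (a : ℂ) :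
    BddOp s s' (‖a‖₊ * D) (fun u => a • T u) where
  add u v hu hv := by rw [hT.add u v hu hv, smul_add]
  smul c u hu := by rw [hT.smul c u hu, smul_comm]
  bound u hu := by
    rw [sobolevNorm_smul, ENNReal.coe_mul, mul_assoc]
    exact mul_le_mul_right (hT.bound u hu) _

/-- Along a trigonometric polynomial the derivative `pullbackDeriv` is uniformly bounded from `𝓗^s`
to `𝓗^{s-1}`, so the mean value inequality bounds the quotients uniformly in `r`. -/
theorem DiffeoPair.exists_bddOp_quotient (h : DiffeoPair ψ φ) (hb : SmoothFamily b) (hc : SmoothFamily c)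
    (hbp : ∀ t, Function.Periodic (b t) (2 * Real.pi)) (hcp : ∀ t, Function.Periodic (c t) (2 * Real.pi))
    (hbc : ∀ t x, c t (ψ t x) = b t x * deriv (ψ t) x - deriv (fun r => ψ r x) t) (s t : ℝ) :
    ∃ C : ℝ≥0, ∀ r ∈ Set.Icc (t - 1) (t + 1), r ≠ t → BddOp s (s - 1) C
      (fun u => ((r - t : ℝ) : ℂ)⁻¹ • (mv (pullbackMatrix (ψ r)) u - mv (pullbackMatrix (ψ t)) u)) := by
  have hK : IsCompact (Set.Icc (t - 1) (t + 1)) := isCompact_Icc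
  have htK : t ∈ Set.Icc (t - 1) (t + 1) := ⟨by linarith, by linarith⟩
  obtain ⟨C, hC⟩ := h.exists_bddOp_pullbackDeriv hb hc hbp hcp hK s
  obtain ⟨A, hA⟩ := h.exists_bddOp hK s
  -- The a priori bound has a constant depending on `|r - t|⁻¹`; it only justifies the reduction to
  -- finite support.
  refine ⟨C, fun r hr hrt => BddOp.of_trunc
    ((((hA r hr).sub (hA t htK)).of_le (by linarith)).const_smul _) fun J u hu => ?_⟩
  obtain ⟨f, hf, hp, rfl⟩ := exists_trigPoly J hu
  have hmem : sobolevNorm s (coeff f) < ⊤ := memSobolev_coeff hf hp s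
  have key := sobolevNorm_sub_le_of_hasDerivAt (σ := s - 1)
    (M := C * (sobolevNorm s (coeff f)).toReal) (convex_Icc (t - 1) (t + 1))
    (g := fun r => coeff (pullback (ψ r) f))
    (g' := fun r => pullbackDeriv (ψ r) (b r) (c r) (coeff f)) (by positivity)
    (fun ρ _ j => by
      rw [← h.coeff_deriv_fst_pullback hb hc hbp hcp hbc hf hp]
      exact (h.smooth_pullback hf).hasDerivAt_coeff ρ j)
    (fun ρ hρ => by
      rw [ENNReal.ofReal_mul C.coe_nonneg, ENNReal.ofReal_toReal hmem.ne, ENNReal.ofReal_coe_nnreal]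
      exact (hC ρ hρ).bound _ hmem) htK hr
  have hne : 0 < |r - t| := abs_pos.mpr (sub_ne_zero.mpr hrt)
  rw [← h.coeff_pullback r hf hp, ← h.coeff_pullback t hf hp, sobolevNorm_smul,
    ← ENNReal.ofReal_coe_nnreal, ← ENNReal.ofReal_toReal hmem.ne, ← ofReal_norm, norm_inv,
    Complex.norm_real, Real.norm_eq_abs, ← ENNReal.ofReal_mul C.coe_nonneg]
  refine (mul_le_mul_right key _).trans ?_
  rw [← ENNReal.ofReal_mul (by positivity)]
  apply ENNReal.ofReal_le_ofReal
  rw [mul_comm, mul_assoc, mul_inv_cancel₀ hne.ne', mul_one]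

theorem tendsto_zero_of_le_ofReal {l : Filter ℝ} {F : ℝ → ℝ≥0∞} {G : ℝ → ℝ}
    (h : ∀ᶠ r in l, F r ≤ ENNReal.ofReal (G r)) (hG : Tendsto G l (𝓝 0)) : Tendsto F l (𝓝 0) := by
  have := ENNReal.tendsto_ofReal hG
  rw [ENNReal.ofReal_zero] at this
  exact tendsto_of_tendsto_of_tendsto_of_le_of_le' tendsto_const_nhds this
    (Eventually.of_forall fun _ => zero_le) h

theorem DiffeoPair.mv_single_eq (h : DiffeoPair ψ φ) (t : ℝ) (k : ℤ) :
    mv (pullbackMatrix (ψ t)) (Pi.single k 1) = coeff (pullback (ψ t) (expMode k)) := by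
  rw [← coeff_expMode, ← h.coeff_pullback t (contDiff_expMode k) (expMode_periodic k)]

theorem eventually_mem_Icc (t : ℝ) : ∀ᶠ r in 𝓝 t, r ∈ Set.Icc (t - 1) (t + 1) :=
  Icc_mem_nhds (by linarith) (by linarith)

theorem DiffeoPair.tendsto_pullback (h : DiffeoPair ψ φ) {s : ℝ} {u : ℤ → ℂ} (hu : MemSobolev s u) (t : ℝ) :
    Tendsto (fun r => sobolevNorm s (mv (pullbackMatrix (ψ r)) u - mv (pullbackMatrix (ψ t)) u)) (𝓝 t) (𝓝 0) := by
  obtain ⟨A, hA⟩ := h.exists_bddOp (isCompact_Icc (a := t - 1) (b := t + 1)) s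
  refine BddOp.tendsto_zero (s := s)
    (T := fun r u => mv (pullbackMatrix (ψ r)) u - mv (pullbackMatrix (ψ t)) u) (C := A + A)
    ?_ (fun k => ?_) hu
  · filter_upwards [eventually_mem_Icc t] with r hr
    exact (hA r hr).sub (hA t ⟨by linarith, by linarith⟩)
  · obtain ⟨M, -, hM⟩ := (h.smooth_pullback (contDiff_expMode k)).exists_coeff_lipschitz
      (fun t => h.pullback_periodic t (expMode_periodic k)) s t
    simp_rw [h.mv_single_eq]
    refine tendsto_zero_of_le_ofReal (G := fun r => M * |r - t|) ?_ ?_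
    · filter_upwards [eventually_mem_Icc t] with r hr using hM r hr
    · have : Continuous fun r => M * |r - t| := by fun_prop
      simpa using this.tendsto t

theorem DiffeoPair.tendsto_quotient (h : DiffeoPair ψ φ) (hb : SmoothFamily b) (hc : SmoothFamily c)
    (hbp : ∀ t, Function.Periodic (b t) (2 * Real.pi)) (hcp : ∀ t, Function.Periodic (c t) (2 * Real.pi))
    (hbc : ∀ t x, c t (ψ t x) = b t x * deriv (ψ t) x - deriv (fun r => ψ r x) t)
    {s : ℝ} {u : ℤ → ℂ} (hu : MemSobolev s u) (t : ℝ) :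
    Tendsto (fun r => sobolevNorm (s - 1) (((r - t : ℝ) : ℂ)⁻¹ •
      (mv (pullbackMatrix (ψ r)) u - mv (pullbackMatrix (ψ t)) u) -
        pullbackDeriv (ψ t) (b t) (c t) u)) (𝓝[≠] t) (𝓝 0) := by
  obtain ⟨A, hA⟩ := h.exists_bddOp_quotient hb hc hbp hcp hbc s t
  obtain ⟨D, hD⟩ := h.exists_bddOp_pullbackDeriv hb hc hbp hcp (isCompact_singleton (x := t)) s
  refine BddOp.tendsto_zero (s := s) (T := fun r u => ((r - t : ℝ) : ℂ)⁻¹ •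
      (mv (pullbackMatrix (ψ r)) u - mv (pullbackMatrix (ψ t)) u) -
        pullbackDeriv (ψ t) (b t) (c t) u) (C := A + D) ?_ (fun k => ?_) hu
  · filter_upwards [nhdsWithin_le_nhds (eventually_mem_Icc t), self_mem_nhdsWithin] with r hr hrt
    exact (hA r hr hrt).sub (hD t rfl)
  · obtain ⟨M, -, hM⟩ := (h.smooth_pullback (contDiff_expMode k)).exists_coeff_taylor
      (fun t => h.pullback_periodic t (expMode_periodic k)) (s - 1) t
    rw [← coeff_expMode, ← h.coeff_deriv_fst_pullback hb hc hbp hcp hbc (contDiff_expMode k)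
      (expMode_periodic k), coeff_expMode]
    simp_rw [h.mv_single_eq]
    refine tendsto_zero_of_le_ofReal (G := fun r => M * |r - t|) ?_ ?_
    · filter_upwards [nhdsWithin_le_nhds (eventually_mem_Icc t), self_mem_nhdsWithin] with r hr hrt
      have hne : ((r - t : ℝ) : ℂ) ≠ 0 := by exact_mod_cast sub_ne_zero.mpr hrt
      have hpos : 0 < |r - t| := abs_pos.mpr (sub_ne_zero.mpr hrt)
      have h1 := mul_le_mul_right (hM r hr) ‖((r - t : ℝ) : ℂ)⁻¹‖ₑ
      rw [← sobolevNorm_smul, smul_sub, smul_smul, inv_mul_cancel₀ hne, one_smul] at h1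
      refine h1.trans ?_
      rw [← ofReal_norm, norm_inv, Complex.norm_real, Real.norm_eq_abs, ← ENNReal.ofReal_mul (by positivity)]
      apply ENNReal.ofReal_le_ofReal
      rw [mul_comm, mul_assoc, mul_inv_cancel₀ hpos.ne', mul_one]
    · have : Continuous fun r => M * |r - t| := by fun_prop
      have h2 : Tendsto (fun r => M * |r - t|) (𝓝 t) (𝓝 0) := by simpa using this.tendsto t
      exact h2.mono_left nhdsWithin_le_nhds

theorem BddOp.tendsto_apply {s s' : ℝ} {C : ℝ≥0} {l : Filter ℝ} {T : ℝ → (ℤ → ℂ) → (ℤ → ℂ)}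
    (hT : ∀ᶠ r in l, BddOp s s' C (T r)) {w : ℝ → ℤ → ℂ} (hw : ∀ᶠ r in l, MemSobolev s (w r))
    (hlim : Tendsto (fun r => sobolevNorm s (w r)) l (𝓝 0)) :
    Tendsto (fun r => sobolevNorm s' (T r (w r))) l (𝓝 0) := by
  have h := ENNReal.Tendsto.const_mul (a := (C : ℝ≥0∞)) hlim (Or.inr ENNReal.coe_ne_top)
  rw [mul_zero] at h
  refine tendsto_of_tendsto_of_tendsto_of_le_of_le' tendsto_const_nhds h
    (Eventually.of_forall fun _ => zero_le) ?_
  filter_upwards [hT, hw] with r h1 h2 using h1.bound _ h2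

/-- Half-density pull-backs map solutions of the transport equation with velocity `c` to solutions
of the transport equation with velocity `b`. -/
theorem DiffeoPair.isSolution (h : DiffeoPair ψ φ) (hb : SmoothFamily b) (hc : SmoothFamily c)
    (hbp : ∀ t, Function.Periodic (b t) (2 * Real.pi)) (hcp : ∀ t, Function.Periodic (c t) (2 * Real.pi))
    (hbc : ∀ t x, c t (ψ t x) = b t x * deriv (ψ t) x - deriv (fun r => ψ r x) t)
    {s : ℝ} {u v : ℝ → PeriodicDistribution} (huv : ∀ t, (u t : ℤ → ℂ) = mv (pullbackMatrix (ψ t)) (v t))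
    (hv : IsSolution s (fun t => mv (transportMatrix (cplx (c t)))) v) :
    IsSolution s (fun t => mv (transportMatrix (cplx (b t)))) u := by
  obtain ⟨hmem, hcont, hderiv⟩ := hv
  have hbdd := fun (s t : ℝ) => h.exists_bddOp (isCompact_Icc (a := t - 1) (b := t + 1)) s
  have htK : ∀ t : ℝ, t ∈ Set.Icc (t - 1) (t + 1) := fun t => ⟨by linarith, by linarith⟩
  refine ⟨fun t => ?_, fun t => ?_, fun t => ?_⟩
  · obtain ⟨A, hA⟩ := hbdd s t
    rw [huv]
    exact (hA t (htK t)).mem (hmem t)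
  · obtain ⟨A, hA⟩ := hbdd s t
    have h1 := BddOp.tendsto_apply (l := 𝓝 t) (T := fun r => mv (pullbackMatrix (ψ r)))
      (by filter_upwards [eventually_mem_Icc t] with r hr using hA r hr)
      (Eventually.of_forall fun r => (hmem r).sub (hmem t)) (hcont t)
    have h2 := h1.add (h.tendsto_pullback (hmem t) t)
    rw [add_zero] at h2
    refine tendsto_of_tendsto_of_tendsto_of_le_of_le' tendsto_const_nhds h2
      (Eventually.of_forall fun _ => zero_le) ?_
    filter_upwards [eventually_mem_Icc t] with r hr
    refine le_trans (le_of_eq ?_) (sobolevNorm_add_le _ _ _)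
    rw [huv, huv, (hA r hr).sub_apply (hmem r) (hmem t)]
    congr 1
    abel
  · obtain ⟨A, hA⟩ := hbdd s t
    obtain ⟨A', hA'⟩ := hbdd (s - 1) t
    obtain ⟨D, hD⟩ := exists_bddOp_transportMatrix hc.cplx (fun t => periodic_cplx (hcp t))
      (isCompact_singleton (x := t)) s
    have hDv := (hD t rfl).mem (hmem t)
    have hq : ∀ r, MemSobolev (s - 1) (((r - t : ℝ) : ℂ)⁻¹ • ((v r : ℤ → ℂ) - v t)) := fun r =>
      (((hmem r).sub (hmem t)).smul _).mono (by linarith)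
    have h1 := BddOp.tendsto_apply (l := 𝓝[≠] t) (T := fun r => mv (pullbackMatrix (ψ r)))
      (by filter_upwards [nhdsWithin_le_nhds (eventually_mem_Icc t)] with r hr using hA' r hr)
      (Eventually.of_forall fun r => (hq r).sub hDv) (hderiv t)
    have h2 := h.tendsto_quotient hb hc hbp hcp hbc (hmem t) t
    have h3 := (h.tendsto_pullback hDv t).mono_left (nhdsWithin_le_nhds (s := {t}ᶜ))
    -- Product rule: `Φ(r)` on the error of the quotient of `v`, the quotient of `Φ` at the fixed
    -- `v(t)`, and `(Φ(r) - Φ(t))` on the fixed derivative of `v`. Freezing the last two arguments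
    -- lets strong convergence suffice.
    have h4 := (h1.add h2).add h3
    rw [add_zero, add_zero] at h4
    refine tendsto_of_tendsto_of_tendsto_of_le_of_le' tendsto_const_nhds h4
      (Eventually.of_forall fun _ => zero_le) ?_
    filter_upwards [nhdsWithin_le_nhds (eventually_mem_Icc t)] with r hr
    refine le_trans (le_of_eq ?_) ((sobolevNorm_add_le _ _ _).trans
      (add_le_add (sobolevNorm_add_le _ _ _) le_rfl))
    rw [huv, huv, (hA' r hr).sub_apply (hq r) hDv,
      (hA' r hr).smul _ _ (((hmem r).sub (hmem t)).mono (by linarith)),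
      (hA r hr).sub_apply (hmem r) (hmem t)]
    unfold pullbackDeriv
    congr 1
    simp only [smul_sub]
    abel

end Conjugation

/-! ### The operators of the two equations as matrices -/

/-- Peetre's inequality `⟨k⟩ ≤ 2⟨j⟩⟨j - k⟩` exchanges polynomial growth in `k` for rapid decay in `j
- k`; two spare powers give summability. -/
theorem summable_coeff_mul {a : ℝ → ℂ} (ha : ContDiff ℝ ∞ a) (hap : Function.Periodic a (2 * Real.pi))
    {u : ℤ → ℂ} (hu : u ∈ PeriodicDistribution) (j : ℤ) : Summable fun k => coeff a (j - k) * u k := by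
  obtain ⟨C, n, hC⟩ := hu
  obtain ⟨D, hD0, hD⟩ := exists_coeff_bound ha hap (n + 2)
  refine summable_of_bound (C := |C| * (2 * bracket j) ^ (n + 2) * D) fun k => ?_
  have hk := bracket_pos k
  have hj := bracket_pos j
  have hjk := bracket_pos (j - k)
  have h1 := bracket_le_mul k j
  rw [show k - j = -(j - k) by ring, bracket_neg] at h1
  rw [norm_mul]
  calc ‖coeff a (j - k)‖ * ‖u k‖ * bracket k ^ 2
      ≤ ‖coeff a (j - k)‖ * (|C| * bracket k ^ n) * bracket k ^ 2 := by
        gcongr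
        exact (hC k).trans (by gcongr; exact le_abs_self C)
    _ = |C| * ‖coeff a (j - k)‖ * bracket k ^ (n + 2) := by ring
    _ ≤ |C| * ‖coeff a (j - k)‖ * (2 * bracket j * bracket (j - k)) ^ (n + 2) := by gcongr
    _ = |C| * (2 * bracket j) ^ (n + 2) * (‖coeff a (j - k)‖ * bracket (j - k) ^ (n + 2)) := by
        rw [mul_pow]; ring
    _ ≤ _ := by gcongr; exact hD (j - k)

theorem dx_mem {u : ℤ → ℂ} (hu : u ∈ PeriodicDistribution) : dx u ∈ PeriodicDistribution := by
  obtain ⟨s, hs⟩ := exists_memSobolev_of_mem hu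
  refine mem_of_memSobolev (s := s - 1) ((sobolevNorm_dx_le (s - 1) u).trans_lt ?_)
  rw [sub_add_cancel]
  exact hs

theorem smoothMul_add_smoothMul {b : ℝ → ℝ} (hb : ContDiff ℝ ∞ b)
    (hbp : Function.Periodic b (2 * Real.pi)) {u : ℤ → ℂ} (hu : u ∈ PeriodicDistribution) :
    smoothMul (cplx b) (dx u) + smoothMul (fun x => ((deriv b x / 2 : ℝ) : ℂ)) u =
      mv (transportMatrix (cplx b)) u := by
  have hc : ContDiff ℝ ∞ (cplx b) := Complex.ofRealCLM.contDiff.comp hb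
  have hcp : Function.Periodic (cplx b) (2 * Real.pi) := periodic_cplx hbp
  have hd : (fun x => ((deriv b x / 2 : ℝ) : ℂ)) = fun x => (2 : ℂ)⁻¹ * deriv (cplx b) x := by
    funext x
    rw [deriv_cplx (hb.differentiable (by simp) x)]
    push_cast; ring
  rw [hd]
  funext j
  simp only [Pi.add_apply, smoothMul, mv]
  rw [← (summable_coeff_mul hc hcp (dx_mem hu) j).tsum_add
    (summable_coeff_mul (contDiff_const.mul (contDiff_deriv hc))
      (fun x => by simp only [periodic_deriv hcp x]) hu j)]
  refine tsum_congr fun k => ?_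
  rw [coeff_const_mul, coeff_deriv hc hcp]
  unfold dx transportMatrix
  push_cast; ring

theorem transportOp_eq (m : ℕ) (ε : ℝ) {V : ℝ → ℝ → ℝ} (hV : IsSmoothTorus V) (t : ℝ) {u : ℤ → ℂ}
    (hu : u ∈ PeriodicDistribution) :
    transportOp m ε V t u = mv (transportMatrix (cplx fun x => m + ε * V t x)) u := by
  have hVt : ContDiff ℝ ∞ (V t) := SmoothFamily.contDiff (f := V) hV.1 t
  rw [← smoothMul_add_smoothMul (contDiff_const.add (contDiff_const.mul hVt))
    (fun x => by simp only [hV.2.2 t x]) hu]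
  unfold transportOp
  congr 2
  funext x
  have : HasDerivAt (fun x => (m : ℝ) + ε * V t x) (ε * deriv (V t) x) x :=
    (((hVt.differentiable (by simp) x).hasDerivAt).const_mul ε).const_add _
  rw [this.deriv]
  congr 1
  ring

theorem reducedOp_eq (N : ℕ) (ε μ : ℝ) (W : ℝ → ℝ → ℝ) (t : ℝ) (u : ℤ → ℂ) :
    reducedOp N ε μ W t u = mv (transportMatrix (cplx fun x => ε * (μ + ε ^ N * W t x))) u := by
  funext j
  unfold reducedOp weylOp mv transportMatrix
  refine tsum_congr fun k => ?_
  rw [coeff_const_mul]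
  congr 2
  push_cast
  ring

theorem isSolution_congr {s : ℝ} {H H' : ℝ → (ℤ → ℂ) → (ℤ → ℂ)} {u : ℝ → PeriodicDistribution}
    (h : ∀ t, ∀ w ∈ PeriodicDistribution, H t w = H' t w) : IsSolution s H u ↔ IsSolution s H' u := by
  unfold IsSolution
  simp_rw [fun t => h t _ (u t).2]

/-! ### Integrals depending on a parameter, time averages -/

/-- Induction on the order by differentiating under the integral; the target space varies because
each derivative takes values in a space of linear maps. -/
theorem contDiff_intervalIntegral {E : Type} [NormedAddCommGroup E] [NormedSpace ℝ E]
    [FiniteDimensional ℝ E] (a b : ℝ) (n : ℕ) :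
    ∀ {G : Type} [NormedAddCommGroup G] [NormedSpace ℝ G] {F : E × ℝ → G}, ContDiff ℝ ∞ F →
      ContDiff ℝ n (fun p => ∫ t in a..b, F (p, t)) := by
  have : ProperSpace E := FiniteDimensional.proper ℝ E
  induction n with
  | zero =>
    intro G _ _ F hF
    rw [Nat.cast_zero, contDiff_zero]
    exact intervalIntegral.continuous_parametric_intervalIntegral_of_continuous' (f := fun p t => F (p, t))
      hF.continuous a b
  | succ n ih =>
    intro G _ _ F hF
    have hF' : ContDiff ℝ ∞ (fun q : E × ℝ => (fderiv ℝ F q).comp (ContinuousLinearMap.inl ℝ E ℝ)) :=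
      (ContDiff.fderiv_right hF (m := ∞) (by simp)).clm_comp contDiff_const
    have hd : ∀ p, HasFDerivAt (fun p => ∫ t in a..b, F (p, t))
        (∫ t in a..b, (fderiv ℝ F (p, t)).comp (ContinuousLinearMap.inl ℝ E ℝ)) p := by
      intro p
      obtain ⟨C, hC⟩ := ((isCompact_closedBall p 1).prod (isCompact_uIcc (a := a) (b := b))).exists_bound_of_continuousOn
        hF'.continuous.continuousOn
      refine intervalIntegral.hasFDerivAt_integral_of_dominated_of_fderiv_le (bound := fun _ => C)
        (F := fun p t => F (p, t))
        (F' := fun p t => (fderiv ℝ F (p, t)).comp (ContinuousLinearMap.inl ℝ E ℝ))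
        (Metric.ball_mem_nhds p one_pos)
        (Eventually.of_forall fun q => (hF.continuous.comp (by fun_prop)).aestronglyMeasurable)
        ((hF.continuous.comp (by fun_prop)).intervalIntegrable _ _)
        (hF'.continuous.comp (g := fun q : E × ℝ => (fderiv ℝ F q).comp (ContinuousLinearMap.inl ℝ E ℝ))
          (f := fun t => (p, t)) (by fun_prop)).aestronglyMeasurable
        (Eventually.of_forall fun t ht q hq => hC (q, t) ⟨Metric.ball_subset_closedBall hq,
          Set.uIoc_subset_uIcc ht⟩) intervalIntegrable_const
        (Eventually.of_forall fun t _ q _ => ?_)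
      have h1 : HasFDerivAt F (fderiv ℝ F (q, t)) (q, t) := (hF.differentiable (by simp) _).hasFDerivAt
      exact h1.comp q (hasFDerivAt_prodMk_left q t)
    have e : fderiv ℝ (fun p => ∫ t in a..b, F (p, t)) =
        fun p => ∫ t in a..b, (fderiv ℝ F (p, t)).comp (ContinuousLinearMap.inl ℝ E ℝ) :=
      funext fun p => (hd p).fderiv
    push_cast
    rw [contDiff_succ_iff_fderiv]
    refine ⟨fun p => (hd p).differentiableAt, by simp, ?_⟩
    rw [e]
    exact ih hF'

theorem contDiff_intervalIntegral_infty {E : Type} [NormedAddCommGroup E] [NormedSpace ℝ E]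
    [FiniteDimensional ℝ E] (a b : ℝ) {F : E × ℝ → ℝ} (hF : ContDiff ℝ ∞ F) :
    ContDiff ℝ ∞ (fun p => ∫ t in a..b, F (p, t)) :=
  contDiff_infty.mpr fun n => contDiff_intervalIntegral a b n hF

/-- The average in time of a function on the torus. -/
def timeAvg (f : ℝ → ℝ → ℝ) (z : ℝ) : ℝ := (2 * Real.pi)⁻¹ * ∫ t in (0 : ℝ)..2 * Real.pi, f t z

theorem contDiff_timeAvg {f : ℝ → ℝ → ℝ} (hf : SmoothFamily f) : ContDiff ℝ ∞ (timeAvg f) := by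
  refine contDiff_const.mul (contDiff_intervalIntegral_infty (F := fun q : ℝ × ℝ => f q.2 q.1) _ _ ?_)
  exact ContDiff.comp (g := fun q : ℝ × ℝ => f q.1 q.2) hf (contDiff_snd.prodMk contDiff_fst)

theorem SmoothFamily.continuous_fst {f : ℝ → ℝ → ℝ} (hf : SmoothFamily f) (z : ℝ) :
    Continuous (fun t => f t z) :=
  (ContDiff.continuous hf).comp (g := fun q : ℝ × ℝ => f q.1 q.2) (f := fun t => (t, z)) (by fun_prop)

/-- The primitive in time of a function on the torus. -/
def timePrim (f : ℝ → ℝ → ℝ) (t z : ℝ) : ℝ := ∫ r in (0 : ℝ)..t, f r z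

theorem smoothFamily_timePrim {f : ℝ → ℝ → ℝ} (hf : SmoothFamily f) : SmoothFamily (timePrim f) := by
  -- The substitution `r = tσ` fixes the endpoints, so `t` becomes an ordinary parameter of the
  -- integrand.
  have h : ∀ q : ℝ × ℝ, timePrim f q.1 q.2 = q.1 * ∫ σ in (0 : ℝ)..1, f (q.1 * σ) q.2 := fun q => by
    have := intervalIntegral.mul_integral_comp_mul_left (a := 0) (b := 1) (f := fun r => f r q.2) q.1
    rw [this]; simp [timePrim]
  unfold SmoothFamily
  simp_rw [h]
  refine contDiff_fst.mul (contDiff_intervalIntegral_infty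
    (F := fun p : (ℝ × ℝ) × ℝ => f (p.1.1 * p.2) p.1.2) _ _ ?_)
  exact ContDiff.comp (g := fun q : ℝ × ℝ => f q.1 q.2) (f := fun p : (ℝ × ℝ) × ℝ => (p.1.1 * p.2, p.1.2))
    hf (by fun_prop)

theorem hasDerivAt_timePrim {f : ℝ → ℝ → ℝ} (hf : SmoothFamily f) (t z : ℝ) :
    HasDerivAt (fun r => timePrim f r z) (f t z) t :=
  intervalIntegral.integral_hasDerivAt_right ((hf.continuous_fst z).intervalIntegrable _ _)
    (hf.continuous_fst z).aestronglyMeasurable.stronglyMeasurableAtFilter (hf.continuous_fst z).continuousAt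

theorem timePrim_isSmoothTorus {f : ℝ → ℝ → ℝ} (hf : IsSmoothTorus f) (h0 : ∀ z, timeAvg f z = 0) :
    IsSmoothTorus (timePrim f) := by
  have hs : SmoothFamily f := hf.1
  refine ⟨smoothFamily_timePrim hs, fun t z => ?_, fun t z => ?_⟩
  · have hc := hs.continuous_fst z
    have hp : Function.Periodic (fun r => f r z) (2 * Real.pi) := fun r => hf.2.1 r z
    have h1 := hp.intervalIntegral_add_eq t 0
    have h2 : ∫ r in (0 : ℝ)..2 * Real.pi, f r z = 0 := by
      have := h0 z
      unfold timeAvg at this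
      have hpi := Real.pi_ne_zero
      simpa [hpi] using this
    rw [zero_add, h2] at h1
    unfold timePrim
    rw [← intervalIntegral.integral_add_adjacent_intervals (hc.intervalIntegrable 0 t)
      (hc.intervalIntegrable t _), h1, add_zero]
  · unfold timePrim
    simp_rw [hf.2.2]

theorem IsSmoothTorus.deriv {f : ℝ → ℝ → ℝ} (hf : IsSmoothTorus f) :
    IsSmoothTorus (fun t z => deriv (f t) z) := by
  have hs : SmoothFamily f := hf.1
  refine ⟨hs.deriv, fun t z => ?_, fun t z => SmoothFamily.deriv_periodic (fun t z => hf.2.2 t z) t z⟩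
  have : f (t + 2 * Real.pi) = f t := funext (hf.2.1 t)
  simp only [this]

theorem IsSmoothTorus.mul {f g : ℝ → ℝ → ℝ} (hf : IsSmoothTorus f) (hg : IsSmoothTorus g) :
    IsSmoothTorus (fun t z => f t z * g t z) :=
  ⟨hf.1.mul hg.1, fun t z => by simp only [hf.2.1, hg.2.1], fun t z => by simp only [hf.2.2, hg.2.2]⟩

theorem IsSmoothTorus.add {f g : ℝ → ℝ → ℝ} (hf : IsSmoothTorus f) (hg : IsSmoothTorus g) :
    IsSmoothTorus (fun t z => f t z + g t z) :=
  ⟨hf.1.add hg.1, fun t z => by simp only [hf.2.1, hg.2.1], fun t z => by simp only [hf.2.2, hg.2.2]⟩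

theorem isSmoothTorus_of_space {f : ℝ → ℝ} (hf : ContDiff ℝ ∞ f) (hp : Function.Periodic f (2 * Real.pi)) :
    IsSmoothTorus (fun _ => f) :=
  ⟨hf.comp contDiff_snd, fun _ _ => rfl, fun _ z => hp z⟩

theorem timeAvg_add {f g : ℝ → ℝ → ℝ} (hf : SmoothFamily f) (hg : SmoothFamily g) (z : ℝ) :
    timeAvg (fun t z => f t z + g t z) z = timeAvg f z + timeAvg g z := by
  unfold timeAvg
  rw [intervalIntegral.integral_add ((hf.continuous_fst z).intervalIntegrable _ _)
    ((hg.continuous_fst z).intervalIntegrable _ _), mul_add]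

theorem timeAvg_mul_space (f : ℝ → ℝ → ℝ) (g : ℝ → ℝ) (z : ℝ) :
    timeAvg (fun t z => f t z * g z) z = timeAvg f z * g z := by
  unfold timeAvg
  rw [intervalIntegral.integral_mul_const, mul_assoc]

theorem timeAvg_space (g : ℝ → ℝ) (z : ℝ) : timeAvg (fun _ => g) z = g z := by
  unfold timeAvg
  have := Real.pi_ne_zero
  simp
  field_simp

theorem timeAvg_periodic {f : ℝ → ℝ → ℝ} (hf : IsSmoothTorus f) :
    Function.Periodic (timeAvg f) (2 * Real.pi) := fun z => by
  unfold timeAvg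
  simp_rw [hf.2.2]

theorem contDiff_primitive {h : ℝ → ℝ} (hh : ContDiff ℝ ∞ h) :
    ContDiff ℝ ∞ (fun z => ∫ y in (0 : ℝ)..z, h y) := by
  have hd : ∀ z, HasDerivAt (fun z => ∫ y in (0 : ℝ)..z, h y) (h z) z := fun z =>
    intervalIntegral.integral_hasDerivAt_right (hh.continuous.intervalIntegrable _ _)
      hh.continuous.aestronglyMeasurable.stronglyMeasurableAtFilter hh.continuous.continuousAt
  rw [contDiff_infty_iff_deriv]
  refine ⟨fun z => (hd z).differentiableAt, ?_⟩
  rwa [funext fun z => (hd z).deriv]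

theorem hasDerivAt_primitive {h : ℝ → ℝ} (hh : ContDiff ℝ ∞ h) (z : ℝ) :
    HasDerivAt (fun z => ∫ y in (0 : ℝ)..z, h y) (h z) z :=
  intervalIntegral.integral_hasDerivAt_right (hh.continuous.intervalIntegrable _ _)
    hh.continuous.aestronglyMeasurable.stronglyMeasurableAtFilter hh.continuous.continuousAt

theorem primitive_add_period {h : ℝ → ℝ} (hh : ContDiff ℝ ∞ h) (hp : Function.Periodic h (2 * Real.pi)) (z : ℝ) :
    ∫ y in (0 : ℝ)..z + 2 * Real.pi, h y = (∫ y in (0 : ℝ)..z, h y) + ∫ y in (0 : ℝ)..2 * Real.pi, h y := by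
  have h1 := hp.intervalIntegral_add_eq z 0
  rw [zero_add] at h1
  rw [← h1, intervalIntegral.integral_add_adjacent_intervals (hh.continuous.intervalIntegrable 0 z)
      (hh.continuous.intervalIntegrable z _)]

/-! ### Averaging -/

theorem pos_or_neg_of_ne_zero {a : ℝ → ℝ} (ha : Continuous a) (h0 : ∀ z, a z ≠ 0) :
    (∀ z, 0 < a z) ∨ ∀ z, a z < 0 := by
  by_contra hcon
  push Not at hcon
  obtain ⟨⟨x, hx⟩, y, hy⟩ := hcon
  obtain ⟨z, hz⟩ := mem_range_of_exists_le_of_exists_ge ha ⟨x, hx⟩ ⟨y, hy⟩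
  exact h0 z hz

/-- A nonvanishing continuous function has constant sign, shared with the integral of its inverse.
This covers a negative average too: the constant is then negative, but the density remains positive.
-/
theorem pos_div_integral_inv {a : ℝ → ℝ} (ha : Continuous a) (h0 : ∀ z, a z ≠ 0) :
    (∫ y in (0 : ℝ)..2 * Real.pi, (a y)⁻¹) ≠ 0 ∧
      ∀ z, 0 < 2 * Real.pi / (∫ y in (0 : ℝ)..2 * Real.pi, (a y)⁻¹) * (a z)⁻¹ := by
  have hc : Continuous fun y => (a y)⁻¹ := ha.inv₀ h0
  have hpi := Real.two_pi_pos
  rcases pos_or_neg_of_ne_zero ha h0 with h | h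
  · have hI : 0 < ∫ y in (0 : ℝ)..2 * Real.pi, (a y)⁻¹ :=
      intervalIntegral.intervalIntegral_pos_of_pos (hc.intervalIntegrable _ _)
        (fun y => inv_pos.mpr (h y)) hpi
    exact ⟨hI.ne', fun z => mul_pos (div_pos hpi hI) (inv_pos.mpr (h z))⟩
  · have hI : 0 < ∫ y in (0 : ℝ)..2 * Real.pi, -(a y)⁻¹ :=
      intervalIntegral.intervalIntegral_pos_of_pos (hc.neg.intervalIntegrable _ _)
        (fun y => neg_pos.mpr (inv_lt_zero.mpr (h y))) hpi
    rw [intervalIntegral.integral_neg, neg_pos] at hI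
    exact ⟨hI.ne, fun z => mul_pos_of_neg_of_neg (div_neg_of_pos_of_neg hpi hI) (inv_lt_zero.mpr (h z))⟩

/-- One averaging step. -/
theorem exists_corrector {U : ℝ → ℝ → ℝ} (hU : IsSmoothTorus U) (h0 : ∀ z, timeAvg U z ≠ 0)
    {w : ℝ → ℝ → ℝ} (hw : IsSmoothTorus w) (hw0 : ∀ z, timeAvg w z = 0) :
    ∃ (X : ℝ → ℝ → ℝ) (c : ℝ), IsSmoothTorus X ∧
      (∀ t z, deriv (fun r => X r z) t = w t z) ∧
      IsSmoothTorus (fun t z => U t z * deriv (X t) z + -c) ∧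
      ∀ z, timeAvg (fun t z => U t z * deriv (X t) z + -c) z = 0 := by
  have hUs : SmoothFamily U := hU.1
  have hws : SmoothFamily w := hw.1
  have ha := contDiff_timeAvg hUs
  have hP := timePrim_isSmoothTorus hw hw0
  have hPs : SmoothFamily (timePrim w) := hP.1
  set g := timeAvg (fun t z => U t z * deriv (timePrim w t) z) with hg
  have hUP := hU.mul hP.deriv
  have hgs : ContDiff ℝ ∞ g := contDiff_timeAvg hUP.1
  have hinv : ContDiff ℝ ∞ (fun z => (timeAvg U z)⁻¹) := ha.inv h0
  obtain ⟨hI, -⟩ := pos_div_integral_inv ha.continuous h0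
  set I := ∫ y in (0 : ℝ)..2 * Real.pi, (timeAvg U y)⁻¹
  -- The time primitive of `w` is free up to a function `Q(z)`. Zero average of the new remainder
  -- means `⟨U⟩Q' + g = c`, and this `c` is the value for which `Q' = (c - g)/⟨U⟩` integrates to
  -- zero, so that `Q` is periodic.
  set c := (∫ y in (0 : ℝ)..2 * Real.pi, g y * (timeAvg U y)⁻¹) / I with hc
  set h : ℝ → ℝ := fun z => c * (timeAvg U z)⁻¹ - g z * (timeAvg U z)⁻¹ with hh
  have hhs : ContDiff ℝ ∞ h := (contDiff_const.mul hinv).sub (hgs.mul hinv)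
  have hhp : Function.Periodic h (2 * Real.pi) := fun z => by
    simp only [hh, hg, timeAvg_periodic hU z, timeAvg_periodic hUP z]
  have hint : ∫ y in (0 : ℝ)..2 * Real.pi, h y = 0 := by
    simp only [hh]
    rw [intervalIntegral.integral_sub ((contDiff_const.mul hinv).continuous.intervalIntegrable _ _)
      ((hgs.mul hinv).continuous.intervalIntegrable _ _), intervalIntegral.integral_const_mul, hc,
      div_mul_cancel₀ _ hI, sub_self]
  set Q : ℝ → ℝ := fun z => ∫ y in (0 : ℝ)..z, h y with hQ
  have hQp : Function.Periodic Q (2 * Real.pi) := fun z => by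
    simp only [hQ]
    rw [primitive_add_period hhs hhp, hint, add_zero]
  have hQT : IsSmoothTorus (fun _ => Q) := isSmoothTorus_of_space (contDiff_primitive hhs) hQp
  have hX : IsSmoothTorus (fun t z => timePrim w t z + Q z) := hP.add hQT
  have hdX : ∀ t z, deriv (fun z => timePrim w t z + Q z) z = deriv (timePrim w t) z + h z := fun t z =>
    ((hPs.hasDerivAt t z).add (hasDerivAt_primitive hhs z)).deriv
  have hcT : IsSmoothTorus (fun _ _ => -c) := ⟨contDiff_const, fun _ _ => rfl, fun _ _ => rfl⟩
  refine ⟨fun t z => timePrim w t z + Q z, c, hX, fun t z => ?_, (hU.mul hX.deriv).add hcT, fun z => ?_⟩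
  · exact ((hasDerivAt_timePrim hws t z).add_const _).deriv
  · simp_rw [hdX, mul_add]
    have hUh : IsSmoothTorus (fun t z => U t z * h z) := hU.mul (isSmoothTorus_of_space hhs hhp)
    have e1 := timeAvg_add (f := fun t z => U t z * deriv (timePrim w t) z + U t z * h z)
      (g := fun _ _ => -c) (hUP.add hUh).1 hcT.1 z
    have e2 := timeAvg_add (f := fun t z => U t z * deriv (timePrim w t) z)
      (g := fun t z => U t z * h z) hUP.1 hUh.1 z
    have e3 := timeAvg_mul_space U h z
    have e4 := timeAvg_space (fun _ => -c) z
    rw [e1, e2, e3, e4]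
    have := h0 z
    simp only [hh, ← hg]
    field_simp
    ring

/-- The averaging normal form: a formal change of variables straightening the vector field
`∂_t - ε U ∂_z` up to order `ε^{N+1}`. -/
theorem exists_normalForm {U : ℝ → ℝ → ℝ} (hU : IsSmoothTorus U) (h0 : ∀ z, timeAvg U z ≠ 0) (N : ℕ) :
    ∃ (χ : ℝ × ℝ → ℝ → ℝ) (μ : ℝ → ℝ) (w : ℝ → ℝ → ℝ), SmoothFamily χ ∧
      (∀ ε t z, χ (ε, t + 2 * Real.pi) z = χ (ε, t) z) ∧
      (∀ p z, χ p (z + 2 * Real.pi) = χ p z + 2 * Real.pi) ∧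
      Continuous μ ∧ μ 0 ≠ 0 ∧ IsSmoothTorus w ∧ (∀ z, timeAvg w z = 0) ∧
      (∀ t z, 0 < deriv (χ (0, t)) z) ∧
      ∀ ε t z, ε * U t z * deriv (χ (ε, t)) z - deriv (fun r => χ (ε, r) z) t =
        ε * (μ ε + ε ^ N * w t z) := by
  induction N with
  | zero =>
    have ha := contDiff_timeAvg (f := U) hU.1
    obtain ⟨hI, hpos⟩ := pos_div_integral_inv ha.continuous h0
    -- The harmonic mean of `⟨U⟩`: with it the primitive of `κ/⟨U⟩` grows by exactly `2π` over a
    -- period.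
    set κ := 2 * Real.pi / ∫ y in (0 : ℝ)..2 * Real.pi, (timeAvg U y)⁻¹ with hκ
    have hκ0 : κ ≠ 0 := div_ne_zero Real.two_pi_pos.ne' hI
    have hh : ContDiff ℝ ∞ (fun z => κ * (timeAvg U z)⁻¹) := contDiff_const.mul (ha.inv h0)
    have hhp : Function.Periodic (fun z => κ * (timeAvg U z)⁻¹) (2 * Real.pi) := fun z => by
      simp only [timeAvg_periodic hU z]
    have hd : ∀ z, deriv (fun z => ∫ y in (0 : ℝ)..z, κ * (timeAvg U y)⁻¹) z = κ * (timeAvg U z)⁻¹ :=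
      fun z => (hasDerivAt_primitive hh z).deriv
    have hcT : IsSmoothTorus (fun _ _ => -κ) := ⟨contDiff_const, fun _ _ => rfl, fun _ _ => rfl⟩
    have hUh : IsSmoothTorus (fun t z => U t z * (κ * (timeAvg U z)⁻¹)) :=
      hU.mul (isSmoothTorus_of_space hh hhp)
    refine ⟨fun _ z => ∫ y in (0 : ℝ)..z, κ * (timeAvg U y)⁻¹, fun _ => κ,
      fun t z => U t z * (κ * (timeAvg U z)⁻¹) + -κ, SmoothFamily.of_contDiff (contDiff_primitive hh),
      fun _ _ _ => rfl, fun _ z => ?_, continuous_const, hκ0, hUh.add hcT, fun z => ?_, fun _ z => ?_,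
      fun ε t z => ?_⟩
    · simp only []
      rw [primitive_add_period hh hhp, intervalIntegral.integral_const_mul,
        intervalIntegral.integral_const_mul, hκ, div_mul_cancel₀ _ hI]
    · have e1 := timeAvg_add (f := fun t z => U t z * (κ * (timeAvg U z)⁻¹)) (g := fun _ _ => -κ)
        hUh.1 hcT.1 z
      have e2 := timeAvg_mul_space U (fun z => κ * (timeAvg U z)⁻¹) z
      have e3 := timeAvg_space (fun _ => -κ) z
      rw [e1, e2, e3]
      have := h0 z
      field_simp
      ring
    · rw [hd]; exact hpos z
    · rw [hd, deriv_const]; ring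
  | succ N ih =>
    obtain ⟨χ, μ, w, hχ, hχt, hχz, hμ, hμ0, hw, hw0, hpos, hid⟩ := ih
    obtain ⟨X, c, hX, hXt, hw', hw0'⟩ := exists_corrector hU h0 hw hw0
    have hXs : SmoothFamily X := hX.1
    have hdz : ∀ ε t z, deriv (fun z => χ (ε, t) z + ε ^ (N + 1) * X t z) z =
        deriv (χ (ε, t)) z + ε ^ (N + 1) * deriv (X t) z := fun ε t z =>
      ((hχ.hasDerivAt (ε, t) z).add ((hXs.hasDerivAt t z).const_mul _)).deriv
    have hdt : ∀ ε t z, deriv (fun r => χ (ε, r) z + ε ^ (N + 1) * X r z) t =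
        deriv (fun r => χ (ε, r) z) t + ε ^ (N + 1) * w t z := fun ε t z => by
      have h1 : DifferentiableAt ℝ (fun r => χ (ε, r) z) t :=
        ((ContDiff.comp (g := fun q : (ℝ × ℝ) × ℝ => χ q.1 q.2) (f := fun r : ℝ => ((ε, r), z)) hχ
          (by fun_prop)).differentiable (by simp)) t
      have h2 := (hXs.hasDerivAt_fst t z).const_mul (ε ^ (N + 1))
      rw [hXt] at h2
      exact (h1.hasDerivAt.add h2).deriv
    -- Adding `ε^{N+1}X` with `X_t = w` cancels the old remainder `ε · ε^N w`; the new error `ε ·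
    -- ε^{N+1} U X_z` splits into the constant `c` and a part of zero time average.
    refine ⟨fun p z => χ p z + p.1 ^ (N + 1) * X p.2 z, fun ε => μ ε + ε ^ (N + 1) * c,
      fun t z => U t z * deriv (X t) z + -c, ?_, fun ε t z => ?_, fun p z => ?_, by fun_prop, by simpa using hμ0,
      hw', hw0', fun t z => ?_, fun ε t z => ?_⟩
    · refine ContDiff.add hχ (ContDiff.mul (by fun_prop) ?_)
      exact ContDiff.comp (g := fun q : ℝ × ℝ => X q.1 q.2)
        (f := fun q : (ℝ × ℝ) × ℝ => (q.1.2, q.2)) hXs (by fun_prop)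
    · simp only [hχt, hX.2.1]
    · simp only [hχz, hX.2.2]; ring
    · simp only [hdz]
      simpa using hpos t z
    · simp only [hdz, hdt]
      linear_combination hid ε t z

/-! ### The resonant average -/

/-- Fubini's theorem on the square of side `2π`. -/
theorem coeff_timeAvg {U : ℝ → ℝ → ℝ} (hU : IsSmoothTorus U) (k : ℤ) :
    coeff (cplx (timeAvg U)) k =
      (2 * Real.pi : ℂ)⁻¹ * ∫ t in (0 : ℝ)..2 * Real.pi, coeff (cplx (U t)) k := by
  have hUs : SmoothFamily U := hU.1
  have he : Continuous (expMode (-k)) := (contDiff_expMode _).continuous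
  have h1 : ∀ x, expMode (-k) x * cplx (timeAvg U) x =
      (2 * Real.pi : ℂ)⁻¹ * ∫ t in (0 : ℝ)..2 * Real.pi, expMode (-k) x * cplx (U t) x := fun x => by
    rw [intervalIntegral.integral_const_mul]
    simp only [cplx, timeAvg]
    rw [intervalIntegral.integral_ofReal]
    push_cast
    ring
  rw [coeff_eq]
  simp_rw [h1, coeff_eq]
  rw [intervalIntegral.integral_const_mul, intervalIntegral.integral_const_mul]
  congr 1
  simp_rw [intervalIntegral.integral_of_le Real.two_pi_pos.le, integral_const_mul]
  rw [← integral_const_mul, ← integral_const_mul]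
  simp_rw [← integral_const_mul]
  refine integral_integral_swap (f := fun x t => (2 * Real.pi : ℂ)⁻¹ * (expMode (-k) x * cplx (U t) x)) ?_
  rw [Measure.prod_restrict]
  have hc : Continuous (Function.uncurry fun x t =>
      (2 * Real.pi : ℂ)⁻¹ * (expMode (-k) x * cplx (U t) x)) := by
    refine continuous_const.mul ((he.comp continuous_fst).mul (Complex.continuous_ofReal.comp ?_))
    exact (ContDiff.continuous hUs).comp (g := fun q : ℝ × ℝ => U q.1 q.2)
      (f := fun q : ℝ × ℝ => (q.2, q.1)) (by fun_prop)
  exact (hc.continuousOn.integrableOn_compact (isCompact_Icc.prod isCompact_Icc)).mono_set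
    (Set.prod_mono Set.Ioc_subset_Icc_self Set.Ioc_subset_Icc_self)

theorem coeff_comp_sub {f : ℝ → ℂ} (hp : Function.Periodic f (2 * Real.pi)) (a : ℝ)
    (k : ℤ) : coeff (fun x => f (x - a)) k = expMode (-k) a * coeff f k := by
  have hg : Function.Periodic (fun x => expMode (-k) x * f x) (2 * Real.pi) :=
    (expMode_periodic _).mul hp
  have h1 := hg.intervalIntegral_add_eq (-a) 0
  rw [zero_add, neg_add_eq_sub] at h1
  rw [coeff_eq, coeff_eq, mul_left_comm, ← h1]
  congr 1
  have h2 := intervalIntegral.integral_comp_sub_right (a := 0) (b := 2 * Real.pi)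
    (fun x => expMode (-k) x * f x) a
  rw [zero_sub] at h2
  rw [← h2, ← intervalIntegral.integral_const_mul]
  congr 1
  funext x
  rw [← mul_assoc, ← expMode_add, add_sub_cancel]

/-- The potential in the frame moving with the resonant speed. -/
def movingFrame (m : ℕ) (V : ℝ → ℝ → ℝ) (t z : ℝ) : ℝ := V t (z - m * t)

theorem movingFrame_isSmoothTorus (m : ℕ) {V : ℝ → ℝ → ℝ} (hV : IsSmoothTorus V) :
    IsSmoothTorus (movingFrame m V) := by
  refine ⟨?_, fun t z => ?_, fun t z => ?_⟩
  · exact hV.1.comp (f := fun q : ℝ × ℝ => (q.1, q.2 - m * q.1)) (by fun_prop)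
  · unfold movingFrame
    rw [hV.2.1, mul_add, ← sub_sub]
    exact (show Function.Periodic (V t) (2 * Real.pi) from hV.2.2 t).sub_nat_mul_eq m
  · unfold movingFrame
    rw [add_sub_right_comm, hV.2.2]

/-- Translation by `mt` multiplies the `k`-th space coefficient by `e^{-ikmt}`; averaging in `t`
then selects the time frequency `mk`. Fourier inversion for the smooth average identifies the sum.
-/
theorem resonantAverage_eq (m : ℕ) {V : ℝ → ℝ → ℝ} (hV : IsSmoothTorus V) (z : ℝ) :
    resonantAverage m V z = timeAvg (movingFrame m V) z := by
  have hU := movingFrame_isSmoothTorus m hV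
  have hUs : SmoothFamily (movingFrame m V) := hU.1
  have hs := hasSum_coeff (f := cplx (timeAvg (movingFrame m V)))
    (Complex.ofRealCLM.contDiff.comp (contDiff_timeAvg hUs)) (periodic_cplx (timeAvg_periodic hU)) z
  unfold resonantAverage
  refine (tsum_congr fun k => ?_).trans hs.tsum_eq
  unfold expMode
  congr 1
  rw [coeff_timeAvg hU, coeff₂, coeff_eq]
  congr 2
  funext t
  have h := coeff_comp_sub (f := cplx (V t)) (periodic_cplx (hV.2.2 t)) (m * t) k
  refine Eq.trans ?_ h.symm
  congr 1
  unfold expMode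
  congr 1
  push_cast
  ring

/-! ### Inverting families of circle diffeomorphisms -/

/-- As `f(x) - x` is periodic, `f(2πn) = f(0) + 2πn` takes arbitrarily large and small values, and
the intermediate value theorem applies. -/
theorem bijective_of_deriv_pos {f : ℝ → ℝ} (hf : ContDiff ℝ ∞ f)
    (hper : ∀ x, f (x + 2 * Real.pi) = f x + 2 * Real.pi) (hpos : ∀ x, 0 < deriv f x) :
    Function.Bijective f := by
  have hpi := Real.two_pi_pos
  refine ⟨(strictMono_of_deriv_pos hpos).injective, fun y => ?_⟩
  have hg : Function.Periodic (fun x => f x - x) (2 * Real.pi) := fun x => by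
    simp only [hper]; ring
  have hn : ∀ n : ℤ, f (n * (2 * Real.pi)) = f 0 + n * (2 * Real.pi) := fun n => by
    have := hg.int_mul_eq n
    simp only [sub_zero] at this
    linarith
  obtain ⟨n, hn1⟩ := exists_int_lt ((y - f 0) / (2 * Real.pi))
  obtain ⟨k, hk1⟩ := exists_int_gt ((y - f 0) / (2 * Real.pi))
  rw [lt_div_iff₀ hpi] at hn1
  rw [div_lt_iff₀ hpi] at hk1
  exact mem_range_of_exists_le_of_exists_ge hf.continuous
    ⟨n * (2 * Real.pi), by rw [hn]; linarith⟩ ⟨k * (2 * Real.pi), by rw [hn]; linarith⟩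

/-- A family of circle diffeomorphisms has a smooth inverse family. -/
theorem exists_diffeoPair {E : Type*} [NormedAddCommGroup E] [NormedSpace ℝ E] [CompleteSpace E]
    {ψ : E → ℝ → ℝ} (hψ : SmoothFamily ψ) (hper : ∀ p x, ψ p (x + 2 * Real.pi) = ψ p x + 2 * Real.pi)
    (hpos : ∀ p x, 0 < deriv (ψ p) x) : ∃ φ, DiffeoPair ψ φ := by
  have hbij := fun p => bijective_of_deriv_pos (hψ.contDiff p) (hper p) (hpos p)
  choose φ hφ using fun p => (hbij p).surjective
  have hleft : ∀ p x, φ p (ψ p x) = x := fun p x => (hbij p).injective (hφ p _)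
  have hsmooth : SmoothFamily φ := by
    -- Carrying the parameter along gives joint smoothness of the inverse from the inverse function
    -- theorem.
    let P : E × ℝ → E × ℝ := fun q => (q.1, ψ q.1 q.2)
    have hP : ContDiff ℝ ∞ P := contDiff_fst.prodMk hψ
    have hPinj : Function.Injective P := by
      rintro ⟨p, x⟩ ⟨p', x'⟩ h
      obtain ⟨rfl, h2⟩ := Prod.mk.inj h
      exact Prod.ext rfl ((hbij p).injective h2)
    suffices h : ∀ q : E × ℝ, ContDiffAt ℝ ∞ (fun q : E × ℝ => (q.1, φ q.1 q.2)) q from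
      contDiff_iff_contDiffAt.mpr fun q => (h q).snd
    rintro ⟨p, y⟩
    set a : E × ℝ := (p, φ p y)
    have hPa : P a = (p, y) := Prod.ext rfl (hφ p y)
    have hd : HasFDerivAt (fun q : E × ℝ => ψ q.1 q.2) (fderiv ℝ (fun q : E × ℝ => ψ q.1 q.2) a) a :=
      (ContDiff.differentiable hψ (by simp) a).hasFDerivAt
    set D := fderiv ℝ (fun q : E × ℝ => ψ q.1 q.2) a
    have hD : D (0, 1) ≠ 0 := by
      rw [← hψ.deriv_eq p (φ p y)]; exact (hpos _ _).ne'
    have hsplit : ∀ v x, D (v, x) = D (v, 0) + x * D (0, 1) := fun v x => by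
      rw [← smul_eq_mul, ← map_smul, ← map_add]; simp
    -- The derivative of `P` is triangular, with diagonal entries the identity and `ψ_x > 0`; it is
    -- inverted explicitly.
    let L : (E × ℝ) ≃L[ℝ] (E × ℝ) := ContinuousLinearEquiv.equivOfInverse
      ((ContinuousLinearMap.fst ℝ E ℝ).prod D)
      ((ContinuousLinearMap.fst ℝ E ℝ).prod ((D (0, 1))⁻¹ •
        (ContinuousLinearMap.snd ℝ E ℝ - (D.comp (ContinuousLinearMap.inl ℝ E ℝ)).comp
          (ContinuousLinearMap.fst ℝ E ℝ))))
      (fun q => by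
        obtain ⟨v, x⟩ := q
        simp [hsplit v x]
        field_simp)
      (fun q => by
        obtain ⟨v, x⟩ := q
        simp only [ContinuousLinearMap.prod_apply, ContinuousLinearMap.coe_fst']
        rw [hsplit]
        simp
        field_simp
        ring)
    have hL : HasFDerivAt P (L : E × ℝ →L[ℝ] E × ℝ) a := hasFDerivAt_fst.prodMk hd
    have hloc := hP.contDiffAt.to_localInverse hL (by simp)
    rw [hPa] at hloc
    refine hloc.congr_of_eventuallyEq ?_
    have hstrict := hP.contDiffAt.hasStrictFDerivAt' hL (by simp)
    have hev := hstrict.eventually_right_inverse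
    rw [hPa] at hev
    filter_upwards [hev] with q hq
    -- Global injectivity identifies the local inverse with the pointwise inverse chosen above.
    refine hPinj ?_
    exact Eq.trans (b := q) (Prod.ext rfl (hφ q.1 q.2)) hq.symm
  refine ⟨φ, hψ, hsmooth, hper, fun p x => (hbij p).injective ?_, hpos, fun p x => ?_, hleft, hφ⟩
  · rw [hφ, hper, hφ]
  · have h1 := (hψ.hasDerivAt p (φ p x)).comp x (hsmooth.hasDerivAt p x)
    have h2 : ψ p ∘ φ p = id := funext (hφ p)
    rw [h2] at h1
    have h3 := h1.unique (hasDerivAt_id x)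
    exact (mul_pos_iff_of_pos_left (hpos p (φ p x))).mp (h3 ▸ one_pos)

/-- Differentiate `ψ(t, φ(t,y)) = y` in time and use `ψ_x(φ) φ_y = 1`. -/
theorem DiffeoPair.velocity_symm {ψ φ b c : ℝ → ℝ → ℝ} (h : DiffeoPair ψ φ)
    (hbc : ∀ t x, c t (ψ t x) = b t x * deriv (ψ t) x - deriv (fun r => ψ r x) t) (t y : ℝ) :
    b t (φ t y) = c t y * deriv (φ t) y - deriv (fun r => φ r y) t := by
  have h1 : HasFDerivAt (fun q : ℝ × ℝ => ψ q.1 q.2) _ (t, φ t y) :=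
    (ContDiff.differentiable h.smooth_left (by simp) (t, φ t y)).hasFDerivAt
  have h2 : HasDerivAt (fun r => (r, φ r y)) ((1 : ℝ), deriv (fun r => φ r y) t) t :=
    (hasDerivAt_id t).prodMk (h.smooth_right.hasDerivAt_fst t y)
  have h3 := h1.comp_hasDerivAt t h2
  have h4 : (fun q : ℝ × ℝ => ψ q.1 q.2) ∘ (fun r => (r, φ r y)) = fun _ => y :=
    funext fun r => h.right_inv r y
  rw [h4] at h3
  have h5 := h3.unique (hasDerivAt_const t y)
  have hsplit : ((1 : ℝ), deriv (fun r => φ r y) t) =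
      (1, 0) + deriv (fun r => φ r y) t • ((0 : ℝ), (1 : ℝ)) := by simp
  rw [hsplit, map_add, map_smul, ← h.smooth_left.deriv_eq, ← h.smooth_left.deriv_fst_eq, smul_eq_mul] at h5
  have h6 := h.symm.deriv_mul_deriv t y
  have h7 := hbc t (φ t y)
  rw [h.right_inv] at h7
  rw [h7]
  linear_combination (deriv (φ t) y) * h5 - (b t (φ t y) + deriv (fun r => φ r y) t) * h6

theorem DiffeoPair.comp_param {E E' : Type*} [NormedAddCommGroup E] [NormedSpace ℝ E]
    [NormedAddCommGroup E'] [NormedSpace ℝ E'] {ψ φ : E → ℝ → ℝ} (h : DiffeoPair ψ φ) {g : E' → E}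
    (hg : ContDiff ℝ ∞ g) : DiffeoPair (fun p => ψ (g p)) (fun p => φ (g p)) where
  smooth_left := ContDiff.comp (g := fun q : E × ℝ => ψ q.1 q.2) h.smooth_left
    ((hg.comp contDiff_fst).prodMk contDiff_snd)
  smooth_right := ContDiff.comp (g := fun q : E × ℝ => φ q.1 q.2) h.smooth_right
    ((hg.comp contDiff_fst).prodMk contDiff_snd)
  period_left p := h.period_left (g p)
  period_right p := h.period_right (g p)
  deriv_left_pos p := h.deriv_left_pos (g p)
  deriv_right_pos p := h.deriv_right_pos (g p)
  left_inv p := h.left_inv (g p)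
  right_inv p := h.right_inv (g p)

theorem isSolution_iff {ψ φ b c : ℝ → ℝ → ℝ} (h : DiffeoPair ψ φ) (hb : SmoothFamily b)
    (hc : SmoothFamily c) (hbp : ∀ t, Function.Periodic (b t) (2 * Real.pi))
    (hcp : ∀ t, Function.Periodic (c t) (2 * Real.pi))
    (hbc : ∀ t x, c t (ψ t x) = b t x * deriv (ψ t) x - deriv (fun r => ψ r x) t)
    {s : ℝ} {u v : ℝ → PeriodicDistribution} (huv : ∀ t, u t = h.equiv t (v t)) :
    IsSolution s (fun t => mv (transportMatrix (cplx (b t)))) u ↔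
      IsSolution s (fun t => mv (transportMatrix (cplx (c t)))) v := by
  refine ⟨fun hu => ?_, fun hv => ?_⟩
  · refine h.symm.isSolution hc hb hcp hbp (h.velocity_symm hbc) (fun t => ?_) hu
    have : v t = (h.equiv t).symm (u t) := by rw [huv, LinearEquiv.symm_apply_apply]
    rw [this]
    rfl
  · exact h.isSolution hb hc hbp hcp hbc (fun t => by rw [huv]; rfl) hv

/-! ### Uniform bounds for the derivatives of a smooth periodic family -/

theorem exists_iteratedFDeriv_bound {F : ℝ × (ℝ × ℝ) → ℝ} (hF : ContDiff ℝ ∞ F)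
    (h1 : ∀ θ t x, F (θ, t + 2 * Real.pi, x) = F (θ, t, x))
    (h2 : ∀ θ t x, F (θ, t, x + 2 * Real.pi) = F (θ, t, x)) {K : Set ℝ} (hK : IsCompact K) (n : ℕ) :
    ∃ C : ℝ, ∀ θ ∈ K, ∀ q : ℝ × ℝ, ‖iteratedFDeriv ℝ n (fun q => F (θ, q)) q‖ ≤ C := by
  have hpi := Real.two_pi_pos
  have hKc := hK.prod ((isCompact_Icc (a := (0 : ℝ)) (b := 2 * Real.pi)).prod
    (isCompact_Icc (a := (0 : ℝ)) (b := 2 * Real.pi)))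
  obtain ⟨C, hC⟩ := hKc.exists_bound_of_continuousOn
    (hF.continuous_iteratedFDeriv (m := n) (by exact_mod_cast le_top)).continuousOn
  refine ⟨C, fun θ hθ q => ?_⟩
  have hG : ContDiff ℝ ∞ (fun q : ℝ × ℝ => F (θ, q)) := hF.comp (contDiff_prodMk_right θ)
  have hp1 : Function.Periodic (iteratedFDeriv ℝ n (fun q => F (θ, q))) (2 * Real.pi, 0) := fun q => by
    rw [← iteratedFDeriv_comp_add_right]
    congr 1
    funext q
    obtain ⟨t, x⟩ := q
    simpa using h1 θ t x
  have hp2 : Function.Periodic (iteratedFDeriv ℝ n (fun q => F (θ, q))) (0, 2 * Real.pi) := fun q => by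
    rw [← iteratedFDeriv_comp_add_right]
    congr 1
    funext q
    obtain ⟨t, x⟩ := q
    simpa using h2 θ t x
  obtain ⟨t, x⟩ := q
  have hpt : Function.Periodic (fun r => iteratedFDeriv ℝ n (fun q => F (θ, q)) (r, x)) (2 * Real.pi) :=
    fun r => by simpa using hp1 (r, x)
  obtain ⟨t', ht', et⟩ := hpt.exists_mem_Ico₀ hpi t
  have hpx : Function.Periodic (fun r => iteratedFDeriv ℝ n (fun q => F (θ, q)) (t', r)) (2 * Real.pi) :=
    fun r => by simpa using hp2 (t', r)
  obtain ⟨x', hx', ex⟩ := hpx.exists_mem_Ico₀ hpi x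
  rw [et, ex]
  refine le_trans ?_ (hC (θ, t', x') ⟨hθ, ⟨ht'.1, ht'.2.le⟩, ⟨hx'.1, hx'.2.le⟩⟩)
  -- The slice is a translate of `F` composed with an inclusion of norm at most one, so its
  -- derivatives are bounded by those of `F` at the same point.
  have hcomp : (fun q : ℝ × ℝ => F (θ, q)) =
      (fun z => F (z + (θ, 0))) ∘ (ContinuousLinearMap.inr ℝ ℝ (ℝ × ℝ)) := by
    funext q; simp
  have hshift : ContDiff ℝ ∞ (fun z => F (z + (θ, 0))) := hF.comp (by fun_prop)
  rw [hcomp, ContinuousLinearMap.iteratedFDeriv_comp_right _ hshift _ (i := n) (by exact_mod_cast le_top),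
    iteratedFDeriv_comp_add_right]
  refine (ContinuousMultilinearMap.norm_compContinuousLinearMap_le _ _).trans ?_
  simp only [ContinuousLinearMap.inr_apply, Prod.mk_add_mk, zero_add, add_zero]
  refine mul_le_of_le_one_right (norm_nonneg _) (Finset.prod_le_one (fun _ _ => norm_nonneg _) fun _ _ => ?_)
  exact ContinuousLinearMap.norm_inr_le_one ℝ ℝ (ℝ × ℝ)

/-! ### The reduction -/

/-- Positivity at `ε = 0` is an open condition, uniform over a compact period square; periodicity
extends it to all `(t, z)`. -/
theorem exists_uniform_pos {χ : ℝ × ℝ → ℝ → ℝ} {μ : ℝ → ℝ} (hχ : SmoothFamily χ)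
    (hχt : ∀ ε t z, χ (ε, t + 2 * Real.pi) z = χ (ε, t) z)
    (hχz : ∀ p z, χ p (z + 2 * Real.pi) = χ p z + 2 * Real.pi)
    (hμ : Continuous μ) (hμ0 : μ 0 ≠ 0) (hpos : ∀ t z, 0 < deriv (χ (0, t)) z) :
    ∃ δ > 0, ∀ ε, |ε| ≤ δ → μ ε ≠ 0 ∧ ∀ t z, 0 < deriv (χ (ε, t)) z := by
  have hpi := Real.two_pi_pos
  have h1 : ∀ᶠ ε in 𝓝 (0 : ℝ), μ ε ≠ 0 := hμ.continuousAt.eventually_ne hμ0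
  have hc : Continuous fun q : ℝ × (ℝ × ℝ) => deriv (χ (q.1, q.2.1)) q.2.2 :=
    (ContDiff.continuous hχ.deriv).comp (g := fun q : (ℝ × ℝ) × ℝ => deriv (χ q.1) q.2)
      (f := fun q : ℝ × (ℝ × ℝ) => ((q.1, q.2.1), q.2.2)) (by fun_prop)
  have h2 : ∀ᶠ ε in 𝓝 (0 : ℝ), ∀ q ∈ Set.Icc (0 : ℝ) (2 * Real.pi) ×ˢ Set.Icc (0 : ℝ) (2 * Real.pi),
      0 < deriv (χ (ε, q.1)) q.2 :=
    (isCompact_Icc.prod isCompact_Icc).eventually_forall_of_forall_eventually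
      (P := fun ε q => 0 < deriv (χ (ε, q.1)) q.2) fun q _ =>
      hc.continuousAt.eventually_const_lt (hpos q.1 q.2)
  obtain ⟨δ, hδ, h⟩ := Metric.eventually_nhds_iff.mp (h1.and h2)
  refine ⟨δ / 2, by positivity, fun ε hε => ?_⟩
  obtain ⟨h3, h4⟩ := h (y := ε) (by rw [dist_zero_right, Real.norm_eq_abs]; linarith)
  refine ⟨h3, fun t z => ?_⟩
  have hpt : Function.Periodic (fun t => deriv (χ (ε, t)) z) (2 * Real.pi) := fun t => by
    simp only [show χ (ε, t + 2 * Real.pi) = χ (ε, t) from funext (hχt ε t)]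
  obtain ⟨t', ht', et⟩ := hpt.exists_mem_Ico₀ hpi t
  have hpz : Function.Periodic (deriv (χ (ε, t'))) (2 * Real.pi) := fun z => by
    have : χ (ε, t') = fun y => χ (ε, t') (y + 2 * Real.pi) - 2 * Real.pi := funext fun y => by
      rw [hχz]; ring
    conv_rhs => rw [this]
    rw [deriv_sub_const, deriv_comp_add_const]
  obtain ⟨z', hz', ez⟩ := hpz.exists_mem_Ico₀ hpi z
  rw [show deriv (χ (ε, t)) z = deriv (χ (ε, t')) z from et, ez]
  exact h4 (t', z') ⟨⟨ht'.1, ht'.2.le⟩, hz'.1, hz'.2.le⟩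

/-- Off `𝓗^s` the right-hand side is infinite, which is why the constant must be strictly positive.
-/
theorem BddOp.sobolevNorm_le {s : ℝ} {C : ℝ≥0} {T : (ℤ → ℂ) → (ℤ → ℂ)} (h : BddOp s s C T) {D : ℝ}
    (hD : 0 < D) (hCD : C ≤ D) (u : ℤ → ℂ) : sobolevNorm s (T u) ≤ ENNReal.ofReal D * sobolevNorm s u := by
  by_cases hu : MemSobolev s u
  · refine (h.bound u hu).trans ?_
    gcongr
    rw [← ENNReal.ofReal_coe_nnreal]
    exact ENNReal.ofReal_le_ofReal hCD
  · have : sobolevNorm s u = ⊤ := not_lt_top_iff.mp hu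
    rw [this, ENNReal.mul_top (by simpa using hD)]
    exact le_top

/-- Over one time period the lift moves by `2πm`; this makes the operator, though not the lift,
periodic in time. -/
theorem pullback_add_nat_mul (ψ : ℝ → ℝ) (m : ℕ) (f : ℝ → ℂ) (hf : Function.Periodic f (2 * Real.pi)) :
    pullback (fun x => ψ x + m * (2 * Real.pi)) f = pullback ψ f := by
  funext x
  unfold pullback
  rw [deriv_add_const, hf.nat_mul m]

theorem DiffeoPair.equiv_eq {E : Type*} [NormedAddCommGroup E] [NormedSpace ℝ E] {ψ φ : E → ℝ → ℝ}
    (h : DiffeoPair ψ φ) {p q : E} {m : ℕ} (hpq : ∀ x, ψ p x = ψ q x + m * (2 * Real.pi)) :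
    h.equiv p = h.equiv q := by
  have hm : pullbackMatrix (ψ p) = pullbackMatrix (ψ q) := by
    unfold pullbackMatrix
    rw [show ψ p = fun x => ψ q x + m * (2 * Real.pi) from funext hpq]
    simp_rw [fun k => pullback_add_nat_mul (ψ q) m (expMode k) (expMode_periodic k)]
  refine LinearEquiv.ext fun u => Subtype.ext ?_
  change mv (pullbackMatrix (ψ p)) u = mv (pullbackMatrix (ψ q)) u
  rw [hm]

end ResonantTransport

end

/-! ### Proof of the main theorem -/

open ResonantTransport

theorem mainTheorem2 (m : ℕ) (hm : 1 ≤ m) (V : ℝ → ℝ → ℝ)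
    (hV : ResonantTransport.ResonantlyStable m V) (N : ℕ) (hN : 1 ≤ N) :
    ∃ εN : ℝ, 0 < εN ∧
      ∃ (Φ : ℝ → ℝ → (ResonantTransport.PeriodicDistribution ≃ₗ[ℂ]
            ResonantTransport.PeriodicDistribution))
        (mhat : ℝ → ℝ) (W : ℝ → ℝ → ℝ → ℝ),
        -- for each admissible `ε`: periodicity in time, nonzero constant, smoothness
        (∀ ε : ℝ, 0 < ε → ε < εN →
          (∀ t : ℝ, Φ ε (t + 2 * Real.pi) = Φ ε t) ∧
          mhat ε ≠ 0 ∧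
          ResonantTransport.IsSmoothTorus (W ε)) ∧
        -- all seminorms of `W` are bounded uniformly in `ε`
        (∀ n : ℕ, ∃ C : ℝ, ∀ ε : ℝ, 0 < ε → ε < εN → ∀ p : ℝ × ℝ,
          ‖iteratedFDeriv ℝ n (fun q : ℝ × ℝ => W ε q.1 q.2) p‖ ≤ C) ∧
        -- bounds on every Sobolev space, uniformly in `ε` and `t`
        (∀ s : ℝ, ∃ C : ℝ, 0 < C ∧ ∀ ε : ℝ, 0 < ε → ε < εN → ∀ t : ℝ,
          ∀ u : ResonantTransport.PeriodicDistribution,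
            ResonantTransport.sobolevNorm s (Φ ε t u) ≤
              ENNReal.ofReal C * ResonantTransport.sobolevNorm s u ∧
            ResonantTransport.sobolevNorm s ((Φ ε t).symm u) ≤
              ENNReal.ofReal C * ResonantTransport.sobolevNorm s u) ∧
        -- conjugation of the two equations
        (∀ ε : ℝ, 0 < ε → ε < εN → ∀ (s : ℝ) (u v : ℝ → ResonantTransport.PeriodicDistribution),
          (∀ t : ℝ, u t = Φ ε t (v t)) →
            (ResonantTransport.IsSolution s (ResonantTransport.transportOp m ε V) u ↔
              ResonantTransport.IsSolution s
                (ResonantTransport.reducedOp N ε (mhat ε) (W ε)) v)) := by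

  have hpi := Real.two_pi_pos
  obtain ⟨hVs, hV0⟩ := hV
  have hU := movingFrame_isSmoothTorus m hVs
  have h0 : ∀ z, timeAvg (movingFrame m V) z ≠ 0 := fun z hz => hV0 z (by
    rw [resonantAverage_eq m hVs, hz, Complex.ofReal_zero])
  obtain ⟨χ, μ, w, hχ, hχt, hχz, hμ, hμ0, hw, -, hpos, hid⟩ := exists_normalForm hU h0 N
  obtain ⟨δ, hδ, hδpos⟩ := exists_uniform_pos hχ hχt hχz hμ hμ0 hpos
  have hsin : ∀ θ, |δ * Real.sin θ| ≤ δ := fun θ => by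
    rw [abs_mul, abs_of_pos hδ]
    exact mul_le_of_le_one_right hδ.le (Real.abs_sin_le_one θ)
  -- Replacing `ε` by `δ sin θ` keeps it in `[-δ, δ]` for every real `θ`, so the family consists of
  -- diffeomorphisms over all of `ℝ × ℝ`. The shift `x + mt` undoes the moving frame.
  let ψ : ℝ × ℝ → ℝ → ℝ := fun p x => χ (δ * Real.sin p.1, p.2) (x + m * p.2)
  have hψ : SmoothFamily ψ := ContDiff.comp (g := fun q : (ℝ × ℝ) × ℝ => χ q.1 q.2)
    (f := fun q : (ℝ × ℝ) × ℝ => ((δ * Real.sin q.1.1, q.1.2), q.2 + m * q.1.2)) hχ (by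
      have : ContDiff ℝ ∞ fun q : (ℝ × ℝ) × ℝ => Real.sin q.1.1 := Real.contDiff_sin.comp (by fun_prop)
      fun_prop)
  have hψx : ∀ p x, deriv (ψ p) x = deriv (χ (δ * Real.sin p.1, p.2)) (x + m * p.2) := fun p x =>
    deriv_comp_add_const _ _ _
  have hψ2 : ∀ p x, ψ p (x + 2 * Real.pi) = ψ p x + 2 * Real.pi := fun p x => by
    simp only [ψ]
    rw [add_right_comm, hχz]
  obtain ⟨φ, hφ⟩ := exists_diffeoPair hψ hψ2 fun p x => by
    rw [hψx]
    exact (hδpos _ (hsin p.1)).2 _ _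
  have hψt : ∀ θ t x, ψ (θ, t + 2 * Real.pi) x = ψ (θ, t) x + m * (2 * Real.pi) := fun θ t x => by
    simp only [ψ]
    have hg : Function.Periodic (fun z => χ (δ * Real.sin θ, t) z - z) (2 * Real.pi) := fun z => by
      simp only [hχz]; ring
    have := hg.nat_mul m (x + m * t)
    rw [hχt, mul_add, ← add_assoc]
    linarith
  have hφt : ∀ θ t y, φ (θ, t + 2 * Real.pi) y = φ (θ, t) y - m * (2 * Real.pi) := fun θ t y => by
    have hinj : Function.Injective (ψ (θ, t + 2 * Real.pi)) := fun a b hab => by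
      rw [← hφ.left_inv (θ, t + 2 * Real.pi) a, hab, hφ.left_inv]
    apply hinj
    have hg : Function.Periodic (fun x => ψ (θ, t) x - x) (2 * Real.pi) := fun x => by
      simp only [hψ2]; ring
    have h1 := hg.sub_nat_mul_eq m (x := φ (θ, t) y)
    have h2 := hφ.right_inv (θ, t) y
    rw [hφ.right_inv, hψt]
    linarith
  let W₀ : ℝ × ℝ → ℝ → ℝ := fun p y => w p.2 (φ p y + m * p.2)
  have hW₀ : SmoothFamily W₀ := by
    have hφs := hφ.smooth_right
    unfold SmoothFamily at hφs
    exact ContDiff.comp (g := fun q : ℝ × ℝ => w q.1 q.2)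
      (f := fun q : (ℝ × ℝ) × ℝ => (q.1.2, φ q.1 q.2 + m * q.1.2)) hw.1 (by fun_prop)
  have hW₀t : ∀ θ t y, W₀ (θ, t + 2 * Real.pi) y = W₀ (θ, t) y := fun θ t y => by
    simp only [W₀]
    rw [hφt, hw.2.1]
    congr 1
    ring
  have hW₀y : ∀ θ t y, W₀ (θ, t) (y + 2 * Real.pi) = W₀ (θ, t) y := fun θ t y => by
    simp only [W₀]
    rw [hφ.period_right, add_right_comm, hw.2.2]
  have hW₀θ : ∀ θ, IsSmoothTorus (fun t y => W₀ (θ, t) y) := fun θ =>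
    ⟨ContDiff.comp (g := fun q : (ℝ × ℝ) × ℝ => W₀ q.1 q.2) (f := fun q : ℝ × ℝ => ((θ, q.1), q.2))
      hW₀ (by fun_prop), hW₀t θ, hW₀y θ⟩
  -- A section of `θ ↦ δ sin θ` with values in the compact interval `[-π/2, π/2]`, the source of all
  -- bounds uniform in `ε`; no regularity in `ε` is needed.
  let θ : ℝ → ℝ := fun ε => Real.arcsin (ε / δ)
  have hθ : ∀ ε, θ ε ∈ Set.Icc (-(Real.pi / 2)) (Real.pi / 2) := fun ε => Real.arcsin_mem_Icc _
  have hθsin : ∀ ε, 0 < ε → ε < δ → δ * Real.sin (θ ε) = ε := fun ε h1 h2 => by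
    simp only [θ]
    rw [Real.sin_arcsin (by have := div_pos h1 hδ; linarith) ((div_le_one hδ).mpr h2.le),
      mul_div_cancel₀ _ hδ.ne']
  refine ⟨δ, hδ, fun ε t => hφ.equiv (θ ε, t), μ, fun ε t y => W₀ (θ ε, t) y, fun ε h1 h2 => ⟨fun t => ?_, ?_, ?_⟩,
    fun n => ?_, fun s => ?_, fun ε h1 h2 s u v huv => ?_⟩
  · exact hφ.equiv_eq (hψt (θ ε) t)
  · exact (hδpos ε (by rw [abs_of_pos h1]; exact h2.le)).1
  · exact hW₀θ (θ ε)
  · obtain ⟨C, hC⟩ := exists_iteratedFDeriv_bound (F := fun q : ℝ × (ℝ × ℝ) => W₀ (q.1, q.2.1) q.2.2)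
      (ContDiff.comp (g := fun q : (ℝ × ℝ) × ℝ => W₀ q.1 q.2)
        (f := fun q : ℝ × (ℝ × ℝ) => ((q.1, q.2.1), q.2.2)) hW₀ (by fun_prop)) hW₀t hW₀y
      (isCompact_Icc (a := -(Real.pi / 2)) (b := Real.pi / 2)) n
    exact ⟨C, fun ε _ _ p => hC (θ ε) (hθ ε) p⟩
  · have hK : IsCompact (Set.Icc (-(Real.pi / 2)) (Real.pi / 2) ×ˢ Set.Icc (0 : ℝ) (2 * Real.pi)) :=
      isCompact_Icc.prod isCompact_Icc
    obtain ⟨A, hA⟩ := hφ.exists_bddOp hK s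
    obtain ⟨B, hB⟩ := hφ.symm.exists_bddOp hK s
    refine ⟨A + B + 1, by positivity, fun ε _ _ t u => ?_⟩
    have hper : Function.Periodic (fun t => hφ.equiv (θ ε, t)) (2 * Real.pi) := fun t =>
      hφ.equiv_eq (hψt (θ ε) t)
    obtain ⟨t', ht', et⟩ := hper.exists_mem_Ico₀ hpi t
    have hmem : (θ ε, t') ∈ Set.Icc (-(Real.pi / 2)) (Real.pi / 2) ×ˢ Set.Icc (0 : ℝ) (2 * Real.pi) :=
      ⟨hθ ε, ht'.1, ht'.2.le⟩
    have hA0 := A.coe_nonneg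
    have hB0 := B.coe_nonneg
    simp only [show hφ.equiv (θ ε, t) = hφ.equiv (θ ε, t') from et]
    exact ⟨(hA _ hmem).sobolevNorm_le (by positivity) (by linarith) _,
      (hB _ hmem).sobolevNorm_le (by positivity) (by linarith) _⟩
  · have hpair := hφ.comp_param (g := fun t : ℝ => (θ ε, t)) (contDiff_prodMk_right (θ ε))
    have hsε := hθsin ε h1 h2
    have hb : IsSmoothTorus (fun t x => (m : ℝ) + ε * V t x) :=
      ⟨contDiff_const.add (contDiff_const.mul hVs.1), fun t x => by simp only [hVs.2.1],
        fun t x => by simp only [hVs.2.2]⟩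
    have hc : IsSmoothTorus (fun t y => ε * (μ ε + ε ^ N * W₀ (θ ε, t) y)) :=
      ⟨contDiff_const.mul (contDiff_const.add (contDiff_const.mul (hW₀θ (θ ε)).1)),
        fun t x => by simp only [hW₀t], fun t x => by simp only [hW₀y]⟩
    rw [isSolution_congr fun t u hu => transportOp_eq m ε hVs t hu,
      isSolution_congr fun t u _ => reducedOp_eq N ε (μ ε) (fun t y => W₀ (θ ε, t) y) t u]
    refine isSolution_iff hpair (b := fun t x => (m : ℝ) + ε * V t x)
      (c := fun t y => ε * (μ ε + ε ^ N * W₀ (θ ε, t) y)) hb.1 hc.1 hb.2.2 hc.2.2 (fun t x => ?_) huv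
    have hdt : HasDerivAt (fun r => ψ (θ ε, r) x)
        (deriv (fun r => χ (ε, r) (x + m * t)) t + m * deriv (χ (ε, t)) (x + m * t)) t := by
      have hχε : SmoothFamily (fun t => χ (ε, t)) :=
        ContDiff.comp (g := fun q : (ℝ × ℝ) × ℝ => χ q.1 q.2) (f := fun q : ℝ × ℝ => ((ε, q.1), q.2))
          hχ (by fun_prop)
      have e1 : HasFDerivAt (fun q : ℝ × ℝ => χ (ε, q.1) q.2) _ (t, x + m * t) :=
        (ContDiff.differentiable hχε (by simp) (t, x + m * t)).hasFDerivAt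
      have e2 : HasDerivAt (fun r : ℝ => (r, x + m * r)) ((1 : ℝ), (m : ℝ)) t :=
        (hasDerivAt_id t).prodMk (by simpa using ((hasDerivAt_id t).const_mul (m : ℝ)).const_add x)
      have e3 := e1.comp_hasDerivAt t e2
      rw [show ((1 : ℝ), (m : ℝ)) = (1, 0) + (m : ℝ) • ((0 : ℝ), (1 : ℝ)) by simp, map_add, map_smul,
        ← hχε.deriv_eq, ← hχε.deriv_fst_eq, smul_eq_mul] at e3
      refine e3.congr_of_eventuallyEq (Filter.Eventually.of_forall fun r => ?_)
      simp only [ψ, hsε, Function.comp]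
    -- At `z = x + mt` the term `mχ_z` in `ψ_t` cancels the speed `m`: `(m + εV)ψ_x - ψ_t = εVχ_z -
    -- χ_t`, the left side of the normal form.
    have hz := hid ε t (x + m * t)
    simp only [movingFrame, add_sub_cancel_right] at hz
    rw [hdt.deriv, hψx]
    simp only [W₀, hφ.left_inv, hsε]
    linear_combination -hz
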